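/- **Setting.** A lattice is a finite simple graph $G=(L,E)$ with graph distance $\mathrm{dist}$ (sites in different components are at infinite distance). Site $j$ carries the Hilbert space $\mathbb{C}^{d_j}$, and $\mathcal H=\bigotimes_{j\in L}\mathbb{C}^{d_j}$. A Hamiltonian on $\mathcal H$ is called local with range $r\in\mathbb{N}$ and strength $J$ if $H=\sum_{X\subseteq L}H_X$, where each $H_X$ is self-adjoint, acts non-trivially only on the sites of $X$, satisfies $\|H_X\|\le J$ (operator norm), and is zero unless $\mathrm{dist}(i,j)\le r$ for all $i,j\in X$. A product state vector is $|\psi\rangle=\bigotimes_{j\in L}|\varphi_j\rangle$ with unit vectors $|\varphi_j\rangle$. Put $\rho(t)=e^{-\mathrm{i}tH}|\psi\rangle\langle\psi|e^{\mathrm{i}tH}$, let $\rho_I(t)=\mathrm{tr}_{L\setminus I}\,\rho(t)$ for $I\subseteq L$, let $S(\rho)=-\mathrm{tr}[\rho\log_2\rho]$, and let $s(I)$ be the number of sites of $I$ that have a neighbour in $L\setminus I$. **Theorem (Area laws in non-equilibrium systems).** 1. For all $\Delta,q,r\in\mathbb{N}$, $J\in\mathbb{R}$ and every time $t>0$ there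 are constants $c_0,c_1>0$, depending only on $\Delta,q,r,J,t$, such that for every lattice in which each site has at most $\Delta$ neighbours, all local dimensions $d_j\le q$, every local Hamiltonian $H$ with range $r$ and strength $J$, every product state vector $|\psi\rangle$ and every $I\subseteq L$, $$S(\rho_I(t))\le c_0\,s(I)+c_1 .$$ 2. In particular, for all $\mathcal D,q,r\in\mathbb{N}$, $J\in\mathbb{R}$ and $t>0$ there are $c_0,c_1>0$ such that the same bound holds on the cubic lattices $(\mathbb{Z}/n\mathbb{Z})^{\mathcal D}$ with periodic boundary conditions for every $n\ge1$, with local dimensions at most $q$, for every local Hamiltonian with range $r$ and strength $J$, every product state vector and every region $I$. 3. Conversely, there are a local dimension $q$, a strength $J$ and, for every $N$, a product state vector $|\psi_N\rangle\in(\mathbb{C}^q)^{\otimes N}$ and a nearest-neighbour (range $1$) Hamiltonian $H_N$ with strength $J$ on the open chain $\{1,\dots,N\}$, as well as constants $c_2,c_3,c_4,t_0>0$ and positive integers $L_0,s_0$, such that for all $N\ge L_0$, all $s$ with $s_0\le s\le N$, the block $I=\{1,\dots,s\}$, and all $t$ with $t_0\le t\le c_4\min(s,N-s)$, $$S(\rho_I(t))\ge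 c_2\,t+c_3 .$$ -/

import Mathlib

namespace SpinLattice

section Quantum

variable {L : Type} [Fintype L] [DecidableEq L] {d : L → ℕ}

/-- Labels of the standard product basis of the Hilbert space `⨂ j, ℂ^(d j)`. Vectors of that
space are functions `Config d → ℂ`, operators are matrices indexed by `Config d`. -/
abbrev Config (d : L → ℕ) : Type := ∀ j, Fin (d j)

/-- Basis labels of the subsystem `I`. -/
abbrev ConfigIn (d : L → ℕ) (I : Finset L) : Type := ∀ j : {j : L // j ∈ I}, Fin (d j)

/-- Basis labels of the complement of `I`. -/
abbrev ConfigOut (d : L → ℕ) (I : Finset L) : Type := ∀ j : {j : L // j ∉ I}, Fin (d j)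

/-- The splitting of the whole system into the region `I` and its complement. -/
def split (d : L → ℕ) (I : Finset L) : Config d ≃ ConfigIn d I × ConfigOut d I :=
  Equiv.piEquivPiSubtypeProd (fun j => j ∈ I) (fun j => Fin (d j))

/-- `A` acts only on the sites in `X`: `A = B ⊗ 1` for an operator `B` on the subsystem `X`. -/
def SupportedOn (X : Finset L) (A : Matrix (Config d) (Config d) ℂ) : Prop :=
  ∃ B : Matrix (ConfigIn d X) (ConfigIn d X) ℂ,
    A = (Matrix.kronecker B (1 : Matrix (ConfigOut d X) (ConfigOut d X) ℂ)).submatrix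
      (split d X) (split d X)

/-- `H = ∑ X, h X` with self-adjoint terms `h X` that act on the sites of `X` only, vanish unless
`X` has diameter at most `r` in the graph `G`, and have operator norm at most `J`.
The extended distance is used, so that sites in different components are infinitely far apart. -/
def IsLocalHamiltonian (G : SimpleGraph L) (r : ℕ) (J : ℝ)
    (H : Matrix (Config d) (Config d) ℂ) : Prop :=
  ∃ h : Finset L → Matrix (Config d) (Config d) ℂ,
    (∀ X, (h X).IsHermitian) ∧
    (∀ X, SupportedOn X (h X)) ∧
    (∀ X, h X ≠ 0 → ∀ i ∈ X, ∀ j ∈ X, G.edist i j ≤ (r : ℕ∞)) ∧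
    (∀ X, ‖Matrix.toEuclideanCLM (n := Config d) (𝕜 := ℂ) (h X)‖ ≤ J) ∧
    H = ∑ X, h X

/-- A product vector `⨂ j, φ j` of unit vectors. -/
def IsProductState (ψ : Config d → ℂ) : Prop :=
  ∃ φ : ∀ j, Fin (d j) → ℂ, (∀ j, ∑ a, ‖φ j a‖ ^ 2 = 1) ∧ ∀ σ, ψ σ = ∏ j, φ j (σ j)

/-- `ψ(t) = exp(-i t H) ψ`. -/
noncomputable def evolve (H : Matrix (Config d) (Config d) ℂ) (t : ℝ) (ψ : Config d → ℂ) :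
    Config d → ℂ :=
  (NormedSpace.exp ((-(Complex.I * (t : ℂ))) • H)).mulVec ψ

/-- The density operator `|ψ⟩⟨ψ|`. -/
def pureState (ψ : Config d → ℂ) : Matrix (Config d) (Config d) ℂ :=
  Matrix.vecMulVec ψ (star ψ)

/-- The reduction `ρ_I` of `ρ` to the region `I`: the partial trace over the complement. -/
def reducedState (I : Finset L) (ρ : Matrix (Config d) (Config d) ℂ) :
    Matrix (ConfigIn d I) (ConfigIn d I) ℂ :=
  fun a b => ∑ o : ConfigOut d I, ρ ((split d I).symm (a, o)) ((split d I).symm (b, o))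

/-- `S(ρ) = -tr (ρ log₂ ρ)`, computed from the eigenvalues of `ρ`. -/
noncomputable def vonNeumannEntropy {n : Type} [Fintype n] [DecidableEq n] {ρ : Matrix n n ℂ}
    (hρ : ρ.IsHermitian) : ℝ :=
  -∑ k, hρ.eigenvalues k * Real.logb 2 (hρ.eigenvalues k)

theorem reducedState_pureState_isHermitian (I : Finset L) (ψ : Config d → ℂ) :
    (reducedState I (pureState ψ)).IsHermitian := by
  refine Matrix.IsHermitian.ext fun a b => ?_
  simp only [reducedState, pureState, Matrix.vecMulVec_apply, Pi.star_apply]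
  rw [star_sum]
  refine Finset.sum_congr rfl fun o _ => ?_
  rw [star_mul, star_star]

/-- The entropy `S(ρ_I)` of the reduction to `I` of the pure state `ψ`. -/
noncomputable def entanglementEntropy (I : Finset L) (ψ : Config d → ℂ) : ℝ :=
  vonNeumannEntropy (reducedState_pureState_isHermitian I ψ)

end Quantum

/-- The number of sites of `I` that have a neighbour outside `I`. -/
noncomputable def boundaryArea {L : Type} (G : SimpleGraph L) (I : Finset L) : ℕ :=
  {i : L | i ∈ I ∧ ∃ j, j ∉ I ∧ G.Adj i j}.ncard

/-- The cubic lattice `(ℤ/n)^D` with periodic boundary conditions: two distinct sites are adjacent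
when they differ by `±1` in one coordinate and agree in all others. -/
def cubicLattice (D n : ℕ) : SimpleGraph (Fin D → ZMod n) where
  Adj x y := x ≠ y ∧ ∃ k, (y k = x k + 1 ∨ x k = y k + 1) ∧ ∀ l, l ≠ k → x l = y l
  symm := ⟨by
    rintro x y ⟨hne, k, hk, hl⟩
    exact ⟨hne.symm, k, hk.symm, fun l h => (hl l h).symm⟩⟩
  loopless := ⟨fun _ h => h.1 rfl⟩

/-- The block of the first `s` sites of the open chain with `N` sites. -/
def block (N s : ℕ) : Finset (Fin N) := Finset.univ.filter (fun j => j.val < s)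

end SpinLattice

set_option linter.unusedSectionVars false
namespace SpinLattice
open scoped Matrix.Norms.L2Operator
open Matrix

/-! ### Operator norms of complex matrices. -/

section OperatorNorm

variable {m n : Type*} [Fintype m] [Fintype n] [DecidableEq m] [DecidableEq n]

/-! Cut the system into `I` and its complement and read a state vector as a matrix `M` from the
complement to `I` (`reshape`). The reduced state is `M * Mᴴ`, so the entropy is a function of the
singular values of `M`: their sum (the trace norm) bounds it from above, their maximum (the operator
norm) from below.

Upper bound. The entropy is at most the Rényi entropy of order 1/2, which is 2 log₂ of the trace
norm. By duality the trace norm is the largest overlap with vectors `w` whose reshaped matrix is a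
contraction (`entanglementEntropy_le_of_overlap_le`), and in this overlap the evolution can be moved
from the state to `w`. A product vector reshapes to a matrix of rank one, so its overlap with any
vector is at most the operator norm of that vector's matrix. What remains is the growth of this
operator norm under the evolution. Terms of `H` inside `I` or outside it act by left or right
multiplication and generate unitaries, which preserve the norm. A term across the cut is a bounded
combination of products of two contractions, one on each side, and adds a constant to the growth
rate. Grönwall's inequality (`reshape_evolution_norm_le`) gives growth at most exp(c t) with c
proportional to the number of terms across the cut, hence to the boundary area.

Lower bound. The XX chain is started in the Néel state. Jordan–Wigner turns it into free fermions,
and the state remains a Slater determinant. After a unitary change of the occupied orbitals they are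
orthogonal on each side of the cut separately; with weights ν and 1 - ν on the two sides the squared
operator norm is at most ∏ max(ν, 1 - ν). Hence the entropy is at least ∑ ν (1 - ν), which is the
sum of |C x z|² over x in `I` and z outside, for the correlation matrix C
(`sum_norm_sq_le_entanglementEntropy_slater`). Hopping changes sign under the staggered sign, so off
the diagonal C is, up to phase, half the one-particle propagator at time 2t. Well inside the chain
there are j pairs of sites at distance j across the cut, so the sum is controlled by the mean
displacement of a hopping particle. This grows linearly (`le_sum_natAbs_mul_norm_sq_propagator`), as
Fourier analysis on a cycle of length 2(N + 1) shows; the open ends enter by the method of images,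
and the images are negligible while t is small compared with the distance from the cut to the ends.
-/

theorem sum_norm_sq_mulVec_le (A : Matrix m n ℂ) (v : n → ℂ) :
    ∑ i, ‖(A *ᵥ v) i‖ ^ 2 ≤ ‖A‖ ^ 2 * ∑ j, ‖v j‖ ^ 2 := by
  have h := A.l2_opNorm_mulVec (WithLp.toLp 2 v)
  have h2 := mul_self_le_mul_self (norm_nonneg _) h
  rw [mul_mul_mul_comm, ← sq, ← sq, ← sq, EuclideanSpace.norm_sq_eq, EuclideanSpace.norm_sq_eq] at h2
  exact h2

theorem opNorm_le_of_sum_norm_sq_le (A : Matrix m n ℂ) {c : ℝ} (hc : 0 ≤ c)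
    (h : ∀ v : n → ℂ, ∑ i, ‖(A *ᵥ v) i‖ ^ 2 ≤ c ^ 2 * ∑ j, ‖v j‖ ^ 2) : ‖A‖ ≤ c := by
  rw [l2_opNorm_def]
  refine ContinuousLinearMap.opNorm_le_bound _ hc fun v => ?_
  refine le_of_sq_le_sq ?_ (by positivity)
  rw [mul_pow, EuclideanSpace.norm_sq_eq, EuclideanSpace.norm_sq_eq]
  exact h v.ofLp

theorem norm_entry_le_opNorm (A : Matrix m n ℂ) (i : m) (j : n) : ‖A i j‖ ≤ ‖A‖ := by
  have h := sum_norm_sq_mulVec_le A (Pi.single j 1)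
  have h1 : ∑ k, ‖(Pi.single j 1 : n → ℂ) k‖ ^ 2 = 1 := by
    rw [Finset.sum_eq_single j] <;> simp +contextual
  rw [h1, mul_one] at h
  have h2 := Finset.single_le_sum (f := fun i => ‖(A *ᵥ Pi.single j 1) i‖ ^ 2)
    (fun i _ => by positivity) (Finset.mem_univ i)
  simp only [mulVec_single_one, col_apply] at h2 h
  exact le_of_sq_le_sq (h2.trans h) (norm_nonneg _)

/-- Each output coordinate reads at most one input coordinate and no input is read twice, so squared
norms cannot increase. -/
theorem opNorm_le_one_of_partial_injection (A : Matrix m n ℂ) (hA : ∀ i j, ‖A i j‖ ≤ 1)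
    (hr : ∀ i j j', A i j ≠ 0 → A i j' ≠ 0 → j = j')
    (hc : ∀ i i' j, A i j ≠ 0 → A i' j ≠ 0 → i = i') : ‖A‖ ≤ 1 := by
  refine opNorm_le_of_sum_norm_sq_le A zero_le_one fun v => ?_
  have key : ∀ i, ‖(A *ᵥ v) i‖ ^ 2 ≤ ∑ j, ‖A i j‖ ^ 2 * ‖v j‖ ^ 2 := by
    intro i
    by_cases h : ∃ j, A i j ≠ 0
    · obtain ⟨j, hj⟩ := h
      have : (A *ᵥ v) i = A i j * v j := by
        rw [mulVec, dotProduct, Finset.sum_eq_single j]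
        · intro k _ hk
          by_contra h0
          exact hk (hr i k j (left_ne_zero_of_mul h0) hj)
        · simp
      rw [this, norm_mul, mul_pow]
      exact Finset.single_le_sum (f := fun j => ‖A i j‖ ^ 2 * ‖v j‖ ^ 2)
        (fun j _ => by positivity) (Finset.mem_univ j)
    · push Not at h
      have : (A *ᵥ v) i = 0 := by simp [mulVec, dotProduct, h]
      rw [this]
      simp only [norm_zero, ne_eq, OfNat.ofNat_ne_zero, not_false_eq_true, zero_pow]
      positivity
  have key2 : ∀ j, ∑ i, ‖A i j‖ ^ 2 ≤ 1 := by
    intro j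
    by_cases h : ∃ i, A i j ≠ 0
    · obtain ⟨i, hi⟩ := h
      rw [Finset.sum_eq_single i]
      · exact pow_le_one₀ (norm_nonneg _) (hA i j)
      · intro k _ hk
        by_contra h0
        exact hk (hc k i j (by simpa using h0) hi)
      · simp
    · push Not at h
      simp [h]
  calc ∑ i, ‖(A *ᵥ v) i‖ ^ 2 ≤ ∑ i, ∑ j, ‖A i j‖ ^ 2 * ‖v j‖ ^ 2 := Finset.sum_le_sum fun i _ => key i
    _ = ∑ j, (∑ i, ‖A i j‖ ^ 2) * ‖v j‖ ^ 2 := by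
        rw [Finset.sum_comm]; simp only [Finset.sum_mul]
    _ ≤ ∑ j, 1 * ‖v j‖ ^ 2 :=
        Finset.sum_le_sum fun j _ => mul_le_mul_of_nonneg_right (key2 j) (by positivity)
    _ = 1 ^ 2 * ∑ j, ‖v j‖ ^ 2 := by simp

/-- The exponential is unitary, and the C*-identity reduces its norm to that of `1`. Only an
inequality is claimed since the index type may be empty. -/
theorem opNorm_exp_I_smul_le_one {A : Matrix n n ℂ} (hA : A.IsHermitian) (t : ℝ) :
    ‖NormedSpace.exp ((t : ℂ) • (Complex.I • A))‖ ≤ 1 := by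
  have h1 : (NormedSpace.exp ((t : ℂ) • (Complex.I • A)))ᴴ *
      NormedSpace.exp ((t : ℂ) • (Complex.I • A)) = 1 := by
    rw [← Matrix.exp_conjTranspose]
    have : ((t : ℂ) • (Complex.I • A))ᴴ = -((t : ℂ) • (Complex.I • A)) := by
      simp [conjTranspose_smul, hA.eq]
    rw [this, Matrix.exp_neg, Matrix.nonsing_inv_mul]
    exact (Matrix.isUnit_iff_isUnit_det _).1 (Matrix.isUnit_exp _)
  have h2 := l2_opNorm_conjTranspose_mul_self (NormedSpace.exp ((t : ℂ) • (Complex.I • A)))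
  rw [h1] at h2
  have h3 : ‖(1 : Matrix n n ℂ)‖ ≤ 1 := opNorm_le_of_sum_norm_sq_le _ zero_le_one fun v => by simp
  nlinarith [norm_nonneg (NormedSpace.exp ((t : ℂ) • (Complex.I • A)))]

end OperatorNorm

/-! ### Entropy against the operator norm and the trace norm. -/

section Entropy

variable {m n : Type} [Fintype m] [Fintype n] [DecidableEq m] [DecidableEq n]

theorem vonNeumannEntropy_congr {ρ σ : Matrix n n ℂ} (hρ : ρ.IsHermitian) (hσ : σ.IsHermitian)
    (h : ρ = σ) : vonNeumannEntropy hρ = vonNeumannEntropy hσ := by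
  subst h; rfl

theorem sum_eigenvalues_mul_conjTranspose {M : Matrix n m ℂ} (hρ : (M * Mᴴ).IsHermitian)
    (htr : (M * Mᴴ).trace = 1) : ∑ k, hρ.eigenvalues k = 1 := by
  have := hρ.trace_eq_sum_eigenvalues
  rw [htr] at this
  have h2 := congrArg Complex.re this
  simpa using h2.symm

open ComplexOrder in
theorem eigenvalues_mul_conjTranspose_nonneg {M : Matrix n m ℂ} (hρ : (M * Mᴴ).IsHermitian)
    (k : n) : 0 ≤ hρ.eigenvalues k :=
  (Matrix.posSemidef_self_mul_conjTranspose M).eigenvalues_nonneg k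

/-- The entropy dominates the min-entropy: every eigenvalue of `M * Mᴴ` is at most `‖M‖ ^ 2`, and
the eigenvalues have total weight one. -/
theorem neg_logb_le_vonNeumannEntropy {M : Matrix n m ℂ} (hρ : (M * Mᴴ).IsHermitian)
    (htr : (M * Mᴴ).trace = 1) {b : ℝ} (hb : ‖M‖ ^ 2 ≤ b) :
    -Real.logb 2 b ≤ vonNeumannEntropy hρ := by
  have hpos : ∀ k, 0 ≤ hρ.eigenvalues k :=
    eigenvalues_mul_conjTranspose_nonneg hρ
  have hle : ∀ k, hρ.eigenvalues k ≤ b := by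
    intro k
    have h1 := hρ.mulVec_eigenvectorBasis k
    have h2 := sum_norm_sq_mulVec_le (M * Mᴴ) (hρ.eigenvectorBasis k)
    rw [h1] at h2
    have h3 : ∑ j, ‖(hρ.eigenvectorBasis k).ofLp j‖ ^ 2 = 1 := by
      rw [← EuclideanSpace.norm_sq_eq, hρ.eigenvectorBasis.norm_eq_one]; simp
    simp only [Pi.smul_apply, norm_smul, mul_pow, ← Finset.mul_sum, h3, mul_one] at h2
    have h4 : hρ.eigenvalues k ≤ ‖M * Mᴴ‖ := by
      have := le_of_sq_le_sq h2 (norm_nonneg _)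
      simpa [abs_of_nonneg (hpos k)] using this
    refine h4.trans (le_trans ?_ hb)
    have := l2_opNorm_mul M Mᴴ
    rwa [l2_opNorm_conjTranspose, ← sq] at this
  have hsum := sum_eigenvalues_mul_conjTranspose hρ htr
  rw [vonNeumannEntropy, neg_le_neg_iff]
  calc ∑ k, hρ.eigenvalues k * Real.logb 2 (hρ.eigenvalues k)
      ≤ ∑ k, hρ.eigenvalues k * Real.logb 2 b := by
        refine Finset.sum_le_sum fun k _ => ?_
        rcases (hpos k).eq_or_lt with h | h
        · simp [← h]
        · exact mul_le_mul_of_nonneg_left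
            (Real.logb_le_logb_of_le (by norm_num) h (hle k)) (hpos k)
    _ = Real.logb 2 b := by rw [← Finset.sum_mul, hsum, one_mul]

/-- The von Neumann entropy is at most the Rényi entropy of order `1/2`. -/
theorem vonNeumannEntropy_le_logb_sum_sqrt {M : Matrix n m ℂ} (hρ : (M * Mᴴ).IsHermitian)
    (htr : (M * Mᴴ).trace = 1) :
    0 < ∑ k, √(hρ.eigenvalues k) ∧
    vonNeumannEntropy hρ ≤ 2 * Real.logb 2 (∑ k, √(hρ.eigenvalues k)) := by
  have hpos : ∀ k, 0 ≤ hρ.eigenvalues k :=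
    eigenvalues_mul_conjTranspose_nonneg hρ
  have hsum := sum_eigenvalues_mul_conjTranspose hρ htr
  set l := hρ.eigenvalues with hl
  set Z := ∑ k, √(l k) with hZ
  have hZpos : 0 < Z := by
    refine lt_of_le_of_ne (Finset.sum_nonneg fun k _ => Real.sqrt_nonneg _) fun h => ?_
    rw [hZ, eq_comm, Finset.sum_eq_zero_iff_of_nonneg (fun k _ => Real.sqrt_nonneg _)] at h
    have : ∀ k, l k = 0 := fun k => by
      have := h k (Finset.mem_univ k)
      rwa [Real.sqrt_eq_zero (hpos k)] at this
    simp [this] at hsum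
  refine ⟨hZpos, ?_⟩
  have hlog2 : 0 < Real.log 2 := Real.log_pos (by norm_num)
  -- Pointwise form of Jensen's inequality: log y ≤ y - 1 at y = 1 / (√l Z), multiplied by 2 l. The
  -- correction terms √l / Z - l sum to zero.
  have key : ∀ k, -(l k * Real.log (l k)) ≤ 2 * (l k * Real.log Z + (√(l k) / Z - l k)) := by
    intro k
    rcases (hpos k).eq_or_lt with h | h
    · simp [← h]
    · have hs : 0 < √(l k) := Real.sqrt_pos.2 h
      have h1 := Real.log_le_sub_one_of_pos (x := 1 / (√(l k) * Z)) (by positivity)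
      rw [one_div, Real.log_inv, Real.log_mul hs.ne' hZpos.ne', Real.log_sqrt h.le] at h1
      have h2 := mul_le_mul_of_nonneg_left h1 h.le
      have h3 : l k * (√(l k) * Z)⁻¹ = √(l k) / Z := by
        nth_rewrite 1 [← Real.mul_self_sqrt h.le]
        field_simp
      nlinarith
  have hfin : -∑ k, l k * Real.log (l k) ≤ 2 * Real.log Z := by
    calc -∑ k, l k * Real.log (l k) = ∑ k, -(l k * Real.log (l k)) := by rw [Finset.sum_neg_distrib]
      _ ≤ ∑ k, 2 * (l k * Real.log Z + (√(l k) / Z - l k)) := Finset.sum_le_sum fun k _ => key k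
      _ = 2 * Real.log Z := by
        rw [← Finset.mul_sum, Finset.sum_add_distrib, Finset.sum_sub_distrib, ← Finset.sum_mul,
          ← Finset.sum_div, hsum, ← hZ, div_self hZpos.ne']
        ring
  have e1 : vonNeumannEntropy hρ = (-∑ k, l k * Real.log (l k)) / Real.log 2 := by
    rw [vonNeumannEntropy, neg_div, Finset.sum_div]
    simp only [Real.logb, mul_div_assoc, hl]
  rw [e1, Real.logb, ← mul_div_assoc]
  exact div_le_div_of_nonneg_right hfin hlog2.le

/-- Polar decomposition: the adjoint of the partial isometry of `M` attains the trace norm of `M`.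
-/
theorem exists_contraction_trace_eq_sum_sqrt {M : Matrix n m ℂ} (hρ : (M * Mᴴ).IsHermitian) :
    ∃ W : Matrix m n ℂ, ‖W‖ ≤ 1 ∧ (M * W).trace = ((∑ k, √(hρ.eigenvalues k) : ℝ) : ℂ) := by
  have hpos : ∀ k, 0 ≤ hρ.eigenvalues k :=
    eigenvalues_mul_conjTranspose_nonneg hρ
  obtain ⟨E, hE⟩ : ∃ E : Matrix n n ℂ, E = (hρ.eigenvectorUnitary : Matrix n n ℂ) := ⟨_, rfl⟩
  have hEE : Eᴴ * E = 1 := by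
    rw [← star_eq_conjTranspose, hE]; exact Unitary.coe_star_mul_self hρ.eigenvectorUnitary
  have hspec : M * Mᴴ = E * diagonal (fun k => (hρ.eigenvalues k : ℂ)) * Eᴴ := by
    have := hρ.spectral_theorem
    rw [hE]
    simpa [Unitary.conjStarAlgAut_apply, ← star_eq_conjTranspose, Function.comp_def] using this
  obtain ⟨l, hl⟩ : ∃ l : n → ℝ, l = hρ.eigenvalues := ⟨_, rfl⟩
  rw [← hl] at hspec hpos ⊢
  clear hE hl
  -- The inverse of zero is zero, so `s` is the pseudo-inverse of the square root and kernel
  -- directions drop out.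
  set s : n → ℂ := fun k => ((√(l k))⁻¹ : ℝ) with hs
  refine ⟨Mᴴ * E * diagonal s * Eᴴ, ?_, ?_⟩
  · have h1 : (Mᴴ * E * diagonal s * Eᴴ)ᴴ * (Mᴴ * E * diagonal s * Eᴴ)
        = E * diagonal (fun k => s k * (l k : ℂ) * s k) * Eᴴ := by
      have hss : (diagonal s)ᴴ = diagonal s := by
        rw [diagonal_conjTranspose]; congr 1; ext k; simp [hs]
      calc _ = E * diagonal s * Eᴴ * (M * Mᴴ) * E * diagonal s * Eᴴ := by
            simp only [conjTranspose_mul, conjTranspose_conjTranspose, hss, Matrix.mul_assoc]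
        _ = E * diagonal s * (Eᴴ * E) * diagonal (fun k => (l k : ℂ)) *
              (Eᴴ * E) * diagonal s * Eᴴ := by
            rw [hspec]; simp only [Matrix.mul_assoc]
        _ = E * (diagonal s * diagonal (fun k => (l k : ℂ)) * diagonal s) * Eᴴ := by
            rw [hEE]; simp only [Matrix.mul_assoc, Matrix.mul_one]
        _ = _ := by rw [diagonal_mul_diagonal, diagonal_mul_diagonal]
    have hEn : ‖E‖ ≤ 1 := by
      have := l2_opNorm_conjTranspose_mul_self E
      rw [hEE] at this
      have h3 : ‖(1 : Matrix n n ℂ)‖ ≤ 1 :=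
        opNorm_le_of_sum_norm_sq_le _ zero_le_one fun v => by simp
      nlinarith [norm_nonneg E]
    have hd : ‖diagonal (fun k => s k * (l k : ℂ) * s k)‖ ≤ 1 := by
      rw [l2_opNorm_diagonal, pi_norm_le_iff_of_nonneg zero_le_one]
      intro k
      rcases (hpos k).eq_or_lt with h | h
      · simp [← h]
      · have h0 : √(l k) ≠ 0 := (Real.sqrt_pos.2 h).ne'
        have : (√(l k))⁻¹ * l k * (√(l k))⁻¹ = 1 := by
          nth_rewrite 2 [← Real.mul_self_sqrt h.le]
          field_simp
        have h2 : s k * (l k : ℂ) * s k = 1 := by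
          simp only [hs]; exact_mod_cast this
        rw [h2]; simp
    have h2 := l2_opNorm_conjTranspose_mul_self (Mᴴ * E * diagonal s * Eᴴ)
    rw [h1] at h2
    have h3 : ‖E * diagonal (fun k => s k * (l k : ℂ) * s k) * Eᴴ‖ ≤ 1 := by
      refine (l2_opNorm_mul _ _).trans ?_
      rw [l2_opNorm_conjTranspose]
      refine mul_le_one₀ ((l2_opNorm_mul _ _).trans ?_) (norm_nonneg _) hEn
      exact mul_le_one₀ hEn (norm_nonneg _) hd
    nlinarith [norm_nonneg (Mᴴ * E * diagonal s * Eᴴ)]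
  · calc (M * (Mᴴ * E * diagonal s * Eᴴ)).trace
        = (E * diagonal (fun k => (l k : ℂ)) * (Eᴴ * E) * diagonal s * Eᴴ).trace := by
          congr 1
          calc _ = (M * Mᴴ) * E * diagonal s * Eᴴ := by simp only [Matrix.mul_assoc]
            _ = _ := by rw [hspec]; simp only [Matrix.mul_assoc]
      _ = (diagonal (fun k => (l k : ℂ)) * diagonal s).trace := by
          rw [hEE, Matrix.mul_one, Matrix.mul_assoc, Matrix.mul_assoc, trace_mul_comm,
            Matrix.mul_assoc, Matrix.mul_assoc, hEE, Matrix.mul_one]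
      _ = _ := by
          rw [diagonal_mul_diagonal, trace_diagonal, Complex.ofReal_sum]
          refine Finset.sum_congr rfl fun k _ => ?_
          simp only [hs]
          have : l k * (√(l k))⁻¹ = √(l k) := by
            rw [← div_eq_mul_inv, Real.div_sqrt]
          exact_mod_cast this

end Entropy

/-! ### Derivatives of matrix products and exponentials. -/

section Calculus

variable {l m n : Type*} [Fintype l] [Fintype m] [Fintype n] [DecidableEq l] [DecidableEq m]
  [DecidableEq n]

/-- Matrix multiplication as a continuous bilinear map for the operator norm. -/
noncomputable def mulCLM : Matrix l m ℂ →L[ℝ] Matrix m n ℂ →L[ℝ] Matrix l n ℂ :=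
  LinearMap.mkContinuous₂
    (LinearMap.mk₂ ℝ (fun (A : Matrix l m ℂ) (B : Matrix m n ℂ) => A * B) Matrix.add_mul
      (fun c A B => Matrix.smul_mul c A B) Matrix.mul_add (fun c A B => Matrix.mul_smul A c B)) 1
    (fun A B => by simpa using l2_opNorm_mul A B)

/-- Needed for rectangular factors: `reshape` produces matrices between different index types. -/
theorem hasDerivAt_matrix_mul {A : ℝ → Matrix l m ℂ} {B : ℝ → Matrix m n ℂ} {A' : Matrix l m ℂ}
    {B' : Matrix m n ℂ} {t : ℝ} (hA : HasDerivAt A A' t) (hB : HasDerivAt B B' t) :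
    HasDerivAt (fun s => A s * B s) (A' * B t + A t * B') t := by
  have := (mulCLM (l := l) (m := m) (n := n)).hasDerivAt_of_bilinear (fun _ => hA) (fun _ => hB)
  rw [add_comm]
  exact this

theorem hasDerivAt_exp_ofReal_smul (A : Matrix n n ℂ) (t : ℝ) :
    HasDerivAt (fun s : ℝ => NormedSpace.exp ((s : ℂ) • A))
      (A * NormedSpace.exp ((t : ℂ) • A)) t := by
  have := (hasDerivAt_exp_smul_const' (𝕂 := ℂ) A (t : ℂ)).scomp t Complex.ofRealCLM.hasDerivAt
  rw [Complex.ofRealCLM_apply, Complex.ofReal_one, one_smul] at this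
  exact this

end Calculus

/-! ### State vectors as matrices across the cut. -/

section Reshape

variable {L : Type} [Fintype L] [DecidableEq L] {d : L → ℕ}

/-- A vector of the whole system as a matrix from the complement of `I` to `I`. -/
def reshape (I : Finset L) : (Config d → ℂ) →ₗ[ℂ] Matrix (ConfigIn d I) (ConfigOut d I) ℂ where
  toFun ψ := fun a o => ψ ((split d I).symm (a, o))
  map_add' _ _ := rfl
  map_smul' _ _ := rfl

theorem reshape_apply (I : Finset L) (ψ : Config d → ℂ) (a : ConfigIn d I) (o : ConfigOut d I) :
    reshape I ψ a o = ψ ((split d I).symm (a, o)) := rfl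

theorem reducedState_pureState (I : Finset L) (ψ : Config d → ℂ) :
    reducedState I (pureState ψ) = reshape I ψ * (reshape I ψ)ᴴ := by
  ext a b
  simp [reducedState, pureState, vecMulVec_apply, Matrix.mul_apply, reshape_apply]

theorem sum_config_eq_sum_split {M : Type*} [AddCommMonoid M] (I : Finset L) (f : Config d → M) :
    ∑ σ, f σ = ∑ a : ConfigIn d I, ∑ o : ConfigOut d I, f ((split d I).symm (a, o)) := by
  rw [← Fintype.sum_prod_type', ← (split d I).symm.sum_comp]

theorem trace_reshape_mul_conjTranspose (I : Finset L) (ψ : Config d → ℂ) :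
    (reshape I ψ * (reshape I ψ)ᴴ).trace = ((∑ σ, ‖ψ σ‖ ^ 2 : ℝ) : ℂ) := by
  rw [sum_config_eq_sum_split I, Complex.ofReal_sum]
  refine Finset.sum_congr rfl fun a _ => ?_
  rw [diag_apply, Matrix.mul_apply, Complex.ofReal_sum]
  refine Finset.sum_congr rfl fun o _ => ?_
  rw [conjTranspose_apply, reshape_apply, Complex.star_def, Complex.mul_conj']
  push_cast
  rfl

theorem entanglementEntropy_eq (I : Finset L) (ψ : Config d → ℂ) :
    entanglementEntropy I ψ =
      vonNeumannEntropy (isHermitian_mul_conjTranspose_self (reshape I ψ)) :=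
  vonNeumannEntropy_congr _ _ (reducedState_pureState I ψ)

theorem neg_logb_le_entanglementEntropy {I : Finset L} {ψ : Config d → ℂ}
    (hψ : ∑ σ, ‖ψ σ‖ ^ 2 = 1) {b : ℝ} (hb : ‖reshape I ψ‖ ^ 2 ≤ b) :
    -Real.logb 2 b ≤ entanglementEntropy I ψ := by
  rw [entanglementEntropy_eq]
  refine neg_logb_le_vonNeumannEntropy _ ?_ hb
  rw [trace_reshape_mul_conjTranspose, hψ, Complex.ofReal_one]

/-- Duality of trace norm and operator norm: the contraction that attains the trace norm of `reshape
I ψ` is itself the reshaped form of some `w`, so `Z` bounds that trace norm. -/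
theorem entanglementEntropy_le_of_overlap_le {I : Finset L} {ψ : Config d → ℂ}
    (hψ : ∑ σ, ‖ψ σ‖ ^ 2 = 1) {Z : ℝ}
    (hZ : ∀ w : Config d → ℂ, ‖reshape I w‖ ≤ 1 → ‖star w ⬝ᵥ ψ‖ ≤ Z) :
    entanglementEntropy I ψ ≤ 2 * Real.logb 2 Z := by
  rw [entanglementEntropy_eq]
  have hρ := isHermitian_mul_conjTranspose_self (reshape I ψ)
  obtain ⟨hpos, hle⟩ := vonNeumannEntropy_le_logb_sum_sqrt hρ
    (by rw [trace_reshape_mul_conjTranspose, hψ, Complex.ofReal_one])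
  refine hle.trans ?_
  obtain ⟨W, hW, htr⟩ := exists_contraction_trace_eq_sum_sqrt hρ
  have h1 := hZ (fun σ => star (W (split d I σ).2 (split d I σ).1)) (by
    have : reshape I (fun σ => star (W (split d I σ).2 (split d I σ).1)) = Wᴴ := by
      ext a o
      simp [reshape_apply]
    rwa [this, l2_opNorm_conjTranspose])
  have h2 : star (fun σ => star (W (split d I σ).2 (split d I σ).1)) ⬝ᵥ ψ
      = (reshape I ψ * W).trace := by
    rw [dotProduct, sum_config_eq_sum_split I, trace]
    refine Finset.sum_congr rfl fun a _ => ?_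
    rw [diag_apply, Matrix.mul_apply]
    refine Finset.sum_congr rfl fun o _ => ?_
    simp [reshape_apply, mul_comm]
  rw [h2, htr, Complex.norm_real, Real.norm_of_nonneg hpos.le] at h1
  gcongr
  norm_num

/-- Interaction picture. Undoing the evolutions generated by `K` and `K'` costs no norm and leaves a
derivative containing only the coupling across the cut, to which Grönwall applies. -/
theorem reshape_evolution_norm_le {I : Finset L} {H : Matrix (Config d) (Config d) ℂ}
    {K : Matrix (ConfigIn d I) (ConfigIn d I) ℂ} {K' : Matrix (ConfigOut d I) (ConfigOut d I) ℂ}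
    (hK : K.IsHermitian) (hK' : K'.IsHermitian) {c : ℝ}
    (hc : ∀ ψ, ‖reshape I (H *ᵥ ψ) - (K * reshape I ψ + reshape I ψ * K')‖ ≤ c * ‖reshape I ψ‖)
    (ψ : Config d → ℂ) {t : ℝ} (ht : 0 ≤ t) :
    ‖reshape I (NormedSpace.exp ((t : ℂ) • (Complex.I • H)) *ᵥ ψ)‖
      ≤ Real.exp (c * t) * ‖reshape I ψ‖ := by
  set F : ℝ → Matrix (ConfigIn d I) (ConfigOut d I) ℂ := fun s =>
    reshape I (NormedSpace.exp ((s : ℂ) • (Complex.I • H)) *ᵥ ψ) with hF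
  let Φ : Matrix (Config d) (Config d) ℂ →ₗ[ℝ] Matrix (ConfigIn d I) (ConfigOut d I) ℂ :=
    { toFun := fun A => reshape I (A *ᵥ ψ)
      map_add' := fun A B => by rw [add_mulVec, map_add]
      map_smul' := fun c A => by
        rw [smul_mulVec]; rfl }
  have hFd : ∀ s : ℝ, HasDerivAt F (Complex.I • reshape I (H *ᵥ
      (NormedSpace.exp ((s : ℂ) • (Complex.I • H)) *ᵥ ψ))) s := by
    intro s
    have h1 := (hasDerivAt_exp_ofReal_smul (Complex.I • H) s)
    have h2 := (LinearMap.toContinuousLinearMap Φ).hasFDerivAt.comp_hasDerivAt s h1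
    have e : reshape I ((Complex.I • H * NormedSpace.exp ((s : ℂ) • (Complex.I • H))) *ᵥ ψ)
        = Complex.I • reshape I (H *ᵥ (NormedSpace.exp ((s : ℂ) • (Complex.I • H)) *ᵥ ψ)) := by
      rw [← mulVec_mulVec, smul_mulVec, map_smul]
    rw [← e]
    exact h2
  have hneg : ∀ {n : Type} [Fintype n] [DecidableEq n] (A : Matrix n n ℂ) (s : ℝ),
      NormedSpace.exp ((s : ℂ) • -(Complex.I • A)) * NormedSpace.exp ((s : ℂ) • (Complex.I • A))
        = 1 := by
    intro n _ _ A s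
    rw [smul_neg, Matrix.exp_neg, Matrix.nonsing_inv_mul]
    exact (Matrix.isUnit_iff_isUnit_det _).1 (Matrix.isUnit_exp _)
  have hnegn : ∀ {n : Type} [Fintype n] [DecidableEq n] {A : Matrix n n ℂ} (_ : A.IsHermitian)
      (s : ℝ), ‖NormedSpace.exp ((s : ℂ) • -(Complex.I • A))‖ ≤ 1 := by
    intro n _ _ A hA s
    have := opNorm_exp_I_smul_le_one hA.neg s
    rwa [smul_neg Complex.I] at this
  set U : ℝ → Matrix (ConfigIn d I) (ConfigIn d I) ℂ := fun s =>
    NormedSpace.exp ((s : ℂ) • -(Complex.I • K)) with hU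
  set V : ℝ → Matrix (ConfigOut d I) (ConfigOut d I) ℂ := fun s =>
    NormedSpace.exp ((s : ℂ) • -(Complex.I • K')) with hV
  set G := fun s => U s * F s * V s with hG
  have hGd : ∀ s : ℝ, HasDerivAt G (U s * (Complex.I • (reshape I (H *ᵥ
      (NormedSpace.exp ((s : ℂ) • (Complex.I • H)) *ᵥ ψ)) - (K * F s + F s * K'))) * V s) s := by
    intro s
    have h1 := hasDerivAt_matrix_mul (hasDerivAt_matrix_mul
      (hasDerivAt_exp_ofReal_smul (-(Complex.I • K)) s) (hFd s))
      (hasDerivAt_exp_ofReal_smul (-(Complex.I • K')) s)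
    -- The derivatives of `U` and `V` cancel exactly the parts `K * F s` and `F s * K'` of the
    -- derivative of `F`.
    refine h1.congr_deriv ?_
    have hcomm : -(Complex.I • K) * U s = U s * -(Complex.I • K) := by
      have : Commute (-(Complex.I • K)) ((s : ℂ) • -(Complex.I • K)) :=
        (Commute.refl _).smul_right _
      exact this.exp_right
    change (-(Complex.I • K) * U s * F s + U s * _) * V s + U s * F s * (-(Complex.I • K') * V s) = _
    rw [hcomm]
    simp only [Matrix.mul_add, Matrix.add_mul, Matrix.mul_sub, Matrix.sub_mul, Matrix.neg_mul,
      Matrix.mul_neg, Matrix.smul_mul, Matrix.mul_smul, smul_sub, smul_add, Matrix.mul_assoc]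
    abel
  have hUn : ∀ s, ‖U s‖ ≤ 1 := fun s => hnegn hK s
  have hVn : ∀ s, ‖V s‖ ≤ 1 := fun s => hnegn hK' s
  have hsand : ∀ {A : Matrix (ConfigIn d I) (ConfigIn d I) ℂ}
      {B : Matrix (ConfigOut d I) (ConfigOut d I) ℂ} (X : Matrix (ConfigIn d I) (ConfigOut d I) ℂ),
      ‖A‖ ≤ 1 → ‖B‖ ≤ 1 → ‖A * X * B‖ ≤ ‖X‖ := by
    intro A B X hA hB
    calc ‖A * X * B‖ ≤ ‖A * X‖ * ‖B‖ := l2_opNorm_mul _ _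
      _ ≤ ‖A * X‖ * 1 := by gcongr
      _ ≤ ‖A‖ * ‖X‖ := by rw [mul_one]; exact l2_opNorm_mul _ _
      _ ≤ 1 * ‖X‖ := by gcongr
      _ = ‖X‖ := one_mul _
  have hFG : ∀ s, ‖F s‖ ≤ ‖G s‖ := by
    intro s
    have e1 : NormedSpace.exp ((s : ℂ) • (Complex.I • K)) * G s
        * NormedSpace.exp ((s : ℂ) • (Complex.I • K')) = F s := by
      have a1 : NormedSpace.exp ((s : ℂ) • (Complex.I • K)) * U s = 1 := by
        rw [mul_eq_one_comm]; exact hneg K s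
      calc _ = (NormedSpace.exp ((s : ℂ) • (Complex.I • K)) * U s) * F s *
            (V s * NormedSpace.exp ((s : ℂ) • (Complex.I • K'))) := by
            simp only [hG, Matrix.mul_assoc]
        _ = _ := by rw [a1, hneg K' s, Matrix.one_mul, Matrix.mul_one]
    rw [← e1]
    exact hsand _ (opNorm_exp_I_smul_le_one hK s) (opNorm_exp_I_smul_le_one hK' s)
  -- A negative `c` is compatible with `hc` only if every reshaped matrix vanishes, as happens for
  -- empty index types.
  have hc0 : 0 ≤ c ∨ ∀ ψ : Config d → ℂ, ‖reshape I ψ‖ = 0 := by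
    by_contra! h
    obtain ⟨h1, ψ, h2⟩ := h
    have := (norm_nonneg _).trans (hc ψ)
    nlinarith [(norm_nonneg (reshape I ψ)).lt_of_ne' h2]
  have h0 : G 0 = reshape I ψ := by
    simp [hG, hU, hV, hF]
  have key := norm_le_gronwallBound_of_norm_deriv_right_le (f := G) (a := 0) (b := t) (K := c)
    (ε := 0) (δ := ‖reshape I ψ‖)
    (fun s _ => (hGd s).continuousAt.continuousWithinAt) (fun s _ => (hGd s).hasDerivWithinAt)
    (by rw [h0]) (fun s _ => by
      refine (hsand _ (hUn s) (hVn s)).trans ?_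
      rw [norm_smul, Complex.norm_I, one_mul, add_zero]
      rcases hc0 with h | h
      · exact (hc _).trans (mul_le_mul_of_nonneg_left (hFG s) h)
      · refine (hc _).trans ?_
        have e1 : ‖F s‖ = 0 := h _
        have e2 : G s = 0 := by simp [hG, norm_eq_zero.1 e1]
        rw [h, e2]; simp) t ⟨ht, le_rfl⟩
  rw [gronwallBound_ε0, sub_zero, mul_comm] at key
  exact (hFG t).trans key

end Reshape

/-! ### Action of a local term on a reshaped vector. -/

section LocalTerms

variable {L : Type} [Fintype L] [DecidableEq L] {d : L → ℕ}

theorem split_symm_of_mem {I : Finset L} (a : ConfigIn d I) (o : ConfigOut d I) {j : L}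
    (h : j ∈ I) : (split d I).symm (a, o) j = a ⟨j, h⟩ := dif_pos h

theorem split_symm_of_notMem {I : Finset L} (a : ConfigIn d I) (o : ConfigOut d I) {j : L}
    (h : j ∉ I) : (split d I).symm (a, o) j = o ⟨j, h⟩ := dif_neg h

theorem supportedOn_iff {X : Finset L} {A : Matrix (Config d) (Config d) ℂ} :
    SupportedOn X A ↔ ∃ B : Matrix (ConfigIn d X) (ConfigIn d X) ℂ, ∀ x y,
      A x y = if ∀ j, j ∉ X → x j = y j then B (fun j => x j) (fun j => y j) else 0 := by
  have key : ∀ (B : Matrix (ConfigIn d X) (ConfigIn d X) ℂ) (x y : Config d),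
      (Matrix.kronecker B (1 : Matrix (ConfigOut d X) (ConfigOut d X) ℂ)).submatrix
        (split d X) (split d X) x y
        = if ∀ j, j ∉ X → x j = y j then B (fun j => x j) (fun j => y j) else 0 := by
    intro B x y
    have h1 : (split d X x).2 = (split d X y).2 ↔ ∀ j, j ∉ X → x j = y j :=
      ⟨fun h j hj => congrFun h ⟨j, hj⟩, fun h => funext fun j => h j.1 j.2⟩
    change B _ _ * (1 : Matrix (ConfigOut d X) (ConfigOut d X) ℂ) _ _ = _
    rw [one_apply]
    simp only [h1, mul_ite, mul_one, mul_zero]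
    rfl
  constructor
  · rintro ⟨B, rfl⟩
    exact ⟨B, key B⟩
  · rintro ⟨B, hB⟩
    refine ⟨B, ?_⟩
    ext x y
    rw [hB, key]

theorem reshape_mulVec_apply (I : Finset L) (A : Matrix (Config d) (Config d) ℂ)
    (ψ : Config d → ℂ) (a : ConfigIn d I) (o : ConfigOut d I) :
    reshape I (A *ᵥ ψ) a o = ∑ a', ∑ o',
      A ((split d I).symm (a, o)) ((split d I).symm (a', o')) * reshape I ψ a' o' := by
  rw [reshape_apply, mulVec, dotProduct, sum_config_eq_sum_split I]
  rfl

theorem exists_reshape_mulVec_of_subset {I X : Finset L} (hX : X ⊆ I)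
    {A : Matrix (Config d) (Config d) ℂ} (hA : A.IsHermitian) (hs : SupportedOn X A) :
    ∃ K : Matrix (ConfigIn d I) (ConfigIn d I) ℂ, K.IsHermitian ∧
      ∀ ψ, reshape I (A *ᵥ ψ) = K * reshape I ψ := by
  rcases isEmpty_or_nonempty (ConfigOut d I) with he | ⟨⟨o₀⟩⟩
  · exact ⟨0, isHermitian_zero, fun ψ => by ext a o; exact he.elim o⟩
  obtain ⟨B, hB⟩ := supportedOn_iff.1 hs
  -- The choice of `o₀` is immaterial: a term supported inside `I` has the same matrix elements for
  -- every outside configuration.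
  refine ⟨Matrix.of fun a a' => A ((split d I).symm (a, o₀)) ((split d I).symm (a', o₀)),
    Matrix.IsHermitian.ext fun a a' => hA.apply _ _, fun ψ => ?_⟩
  ext a o
  rw [reshape_mulVec_apply, Matrix.mul_apply]
  simp only [of_apply]
  refine Finset.sum_congr rfl fun a' _ => ?_
  rw [Finset.sum_eq_single o]
  · congr 1
    rw [hB, hB]
    have h1 : ∀ o₁, (∀ j, j ∉ X → (split d I).symm (a, o₁) j = (split d I).symm (a', o₁) j) ↔
        ∀ j (h : j ∈ I), j ∉ X → a ⟨j, h⟩ = a' ⟨j, h⟩ := by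
      refine fun o₁ => ⟨fun h j hj hx => ?_, fun h j hx => ?_⟩
      · have := h j hx
        rwa [split_symm_of_mem _ _ hj, split_symm_of_mem _ _ hj] at this
      · by_cases hj : j ∈ I
        · rw [split_symm_of_mem _ _ hj, split_symm_of_mem _ _ hj]
          exact h j hj hx
        · rw [split_symm_of_notMem _ _ hj, split_symm_of_notMem _ _ hj]
    have h2 : ∀ a o₁ o₂, (fun j : {j // j ∈ X} => (split d I).symm (a, o₁) j) =
        fun j : {j // j ∈ X} => (split d I).symm (a, o₂) j := by
      intro a o₁ o₂
      ext1 j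
      rw [split_symm_of_mem _ _ (hX j.2), split_symm_of_mem _ _ (hX j.2)]
    simp only [h1, h2 a o o₀, h2 a' o o₀]
  · intro o' _ ho
    rw [hB, if_neg, zero_mul]
    intro h
    refine ho (funext fun j => ?_)
    have := h j (fun hx => j.2 (hX hx))
    rwa [split_symm_of_notMem _ _ j.2, split_symm_of_notMem _ _ j.2, eq_comm] at this
  · simp

theorem exists_reshape_mulVec_of_disjoint {I X : Finset L} (hX : Disjoint X I)
    {A : Matrix (Config d) (Config d) ℂ} (hA : A.IsHermitian) (hs : SupportedOn X A) :
    ∃ K : Matrix (ConfigOut d I) (ConfigOut d I) ℂ, K.IsHermitian ∧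
      ∀ ψ, reshape I (A *ᵥ ψ) = reshape I ψ * K := by
  rcases isEmpty_or_nonempty (ConfigIn d I) with he | ⟨⟨a₀⟩⟩
  · exact ⟨0, isHermitian_zero, fun ψ => by ext a o; exact he.elim a⟩
  obtain ⟨B, hB⟩ := supportedOn_iff.1 hs
  have hX' : ∀ j ∈ X, j ∉ I := fun j hj => Finset.disjoint_left.1 hX hj
  -- The indices are exchanged because an operator on the complement multiplies the reshaped vector
  -- from the right by its transpose.
  refine ⟨Matrix.of fun o' o => A ((split d I).symm (a₀, o)) ((split d I).symm (a₀, o')),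
    Matrix.IsHermitian.ext fun a a' => hA.apply _ _, fun ψ => ?_⟩
  ext a o
  rw [reshape_mulVec_apply, Matrix.mul_apply, Finset.sum_eq_single a]
  simp only [of_apply]
  · refine Finset.sum_congr rfl fun o' _ => ?_
    rw [mul_comm]
    congr 1
    rw [hB, hB]
    have h1 : ∀ a₁, (∀ j, j ∉ X → (split d I).symm (a₁, o) j = (split d I).symm (a₁, o') j) ↔
        ∀ j (h : j ∉ I), j ∉ X → o ⟨j, h⟩ = o' ⟨j, h⟩ := by
      refine fun o₁ => ⟨fun h j hj hx => ?_, fun h j hx => ?_⟩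
      · have := h j hx
        rwa [split_symm_of_notMem _ _ hj, split_symm_of_notMem _ _ hj] at this
      · by_cases hj : j ∈ I
        · rw [split_symm_of_mem _ _ hj, split_symm_of_mem _ _ hj]
        · rw [split_symm_of_notMem _ _ hj, split_symm_of_notMem _ _ hj]
          exact h j hj hx
    have h2 : ∀ a₁ a₂ o, (fun j : {j // j ∈ X} => (split d I).symm (a₁, o) j) =
        fun j : {j // j ∈ X} => (split d I).symm (a₂, o) j := by
      intro a₁ a₂ o
      ext1 j
      rw [split_symm_of_notMem _ _ (hX' j j.2), split_symm_of_notMem _ _ (hX' j j.2)]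
    simp only [h1, h2 a a₀]
  · intro a' _ ha
    refine Finset.sum_eq_zero fun o' _ => ?_
    rw [hB, if_neg, zero_mul]
    intro h
    refine ha (funext fun j => ?_)
    have := h j (fun hx => hX' j hx j.2)
    rwa [split_symm_of_mem _ _ j.2, split_symm_of_mem _ _ j.2, eq_comm] at this
  · simp

/-- `a` is `β` on `X`, `a'` is `γ` on `X`, and they agree elsewhere. -/
def MatchesOn (p : L → Prop) (X : Finset L) (β γ : ConfigIn d X)
    (a a' : ∀ j : {j // p j}, Fin (d j)) : Prop :=
  (∀ j (h : j.1 ∈ X), a j = β ⟨j, h⟩) ∧ (∀ j (h : j.1 ∈ X), a' j = γ ⟨j, h⟩) ∧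
    (∀ j, j.1 ∉ X → a j = a' j)

open Classical in
/-- The part on the sites with `p` of the matrix unit `|β⟩⟨γ|` on `X`. -/
noncomputable def unitOn (p : L → Prop) (X : Finset L) (β γ : ConfigIn d X) :
    Matrix (∀ j : {j // p j}, Fin (d j)) (∀ j : {j // p j}, Fin (d j)) ℂ :=
  fun a a' => if MatchesOn p X β γ a a' then 1 else 0

theorem opNorm_unitOn_le_one (p : L → Prop) [Fintype {j // p j}] (X : Finset L)
    (β γ : ConfigIn d X) : ‖unitOn p X β γ‖ ≤ 1 := by
  have hne : ∀ {a a'}, unitOn p X β γ a a' ≠ 0 → MatchesOn p X β γ a a' := by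
    intro a a' h
    by_contra hc
    exact h (if_neg hc)
  refine opNorm_le_one_of_partial_injection _ (fun a a' => ?_) (fun a b b' h h' => ?_)
    (fun a a' b h h' => ?_)
  · unfold unitOn; split_ifs <;> simp
  · ext1 j
    by_cases hj : j.1 ∈ X
    · rw [(hne h).2.1 j hj, (hne h').2.1 j hj]
    · rw [← (hne h).2.2 j hj, ← (hne h').2.2 j hj]
  · ext1 j
    by_cases hj : j.1 ∈ X
    · rw [(hne h).1 j hj, (hne h').1 j hj]
    · rw [(hne h).2.2 j hj, (hne h').2.2 j hj]

/-- A matrix unit on `X`, extended by the identity, factors over the cut even if `X` straddles it.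
In the outer factor `β` and `γ` trade places since it acts from the right. -/
theorem unitOn_mul_unitOn (I X : Finset L) (β γ : ConfigIn d X) (a a' : ConfigIn d I)
    (o o' : ConfigOut d I) :
    unitOn (· ∈ I) X β γ a a' * unitOn (· ∉ I) X γ β o' o =
      if (β = fun j : {j // j ∈ X} => (split d I).symm (a, o) j) ∧
        (γ = fun j : {j // j ∈ X} => (split d I).symm (a', o') j) ∧
        (∀ j, j ∉ X → (split d I).symm (a, o) j = (split d I).symm (a', o') j)
      then 1 else 0 := by
  classical
  unfold unitOn
  rw [ite_zero_mul_ite_zero, mul_one]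
  refine if_congr ?_ rfl rfl
  constructor
  · rintro ⟨⟨h1, h2, h3⟩, h5, h4, h6⟩
    refine ⟨funext fun j => ?_, funext fun j => ?_, fun j hj => ?_⟩
    · by_cases hI : j.1 ∈ I
      · rw [split_symm_of_mem _ _ hI, h1 ⟨j, hI⟩ j.2]
      · rw [split_symm_of_notMem _ _ hI, h4 ⟨j, hI⟩ j.2]
    · by_cases hI : j.1 ∈ I
      · rw [split_symm_of_mem _ _ hI, h2 ⟨j, hI⟩ j.2]
      · rw [split_symm_of_notMem _ _ hI, h5 ⟨j, hI⟩ j.2]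
    · by_cases hI : j ∈ I
      · rw [split_symm_of_mem _ _ hI, split_symm_of_mem _ _ hI, h3 ⟨j, hI⟩ hj]
      · rw [split_symm_of_notMem _ _ hI, split_symm_of_notMem _ _ hI, h6 ⟨j, hI⟩ hj]
  · rintro ⟨rfl, rfl, h⟩
    refine ⟨⟨fun j hj => ?_, fun j hj => ?_, fun j hj => ?_⟩,
      fun j hj => ?_, fun j hj => ?_, fun j hj => ?_⟩
    · exact (split_symm_of_mem _ _ j.2).symm
    · exact (split_symm_of_mem _ _ j.2).symm
    · have := h j hj
      rwa [split_symm_of_mem _ _ j.2, split_symm_of_mem _ _ j.2] at this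
    · exact (split_symm_of_notMem _ _ j.2).symm
    · exact (split_symm_of_notMem _ _ j.2).symm
    · have := h j hj
      rw [split_symm_of_notMem _ _ j.2, split_symm_of_notMem _ _ j.2] at this
      exact this.symm

theorem reshape_mulVec_eq_sum_unitOn (I X : Finset L) {A : Matrix (Config d) (Config d) ℂ}
    {B : Matrix (ConfigIn d X) (ConfigIn d X) ℂ}
    (hB : ∀ x y, A x y =
      if ∀ j, j ∉ X → x j = y j then B (fun j => x j) (fun j => y j) else 0)
    (ψ : Config d → ℂ) :
    reshape I (A *ᵥ ψ) = ∑ p : ConfigIn d X × ConfigIn d X, B p.1 p.2 •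
      (unitOn (· ∈ I) X p.1 p.2 * reshape I ψ * unitOn (· ∉ I) X p.2 p.1) := by
  ext a o
  have hrw : ∀ r : ConfigIn d I × ConfigOut d I,
      A ((split d I).symm (a, o)) ((split d I).symm (r.1, r.2)) =
      ∑ p : ConfigIn d X × ConfigIn d X, B p.1 p.2 *
        (unitOn (· ∈ I) X p.1 p.2 a r.1 * unitOn (· ∉ I) X p.2 p.1 r.2 o) := by
    intro r
    simp only [unitOn_mul_unitOn, hB]
    rw [Finset.sum_eq_single ((fun j : {j // j ∈ X} => (split d I).symm (a, o) j),
      (fun j : {j // j ∈ X} => (split d I).symm (r.1, r.2) j))]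
    · simp
    · intro p _ hp
      rw [if_neg, mul_zero]
      rintro ⟨h1, h2, -⟩
      exact hp (Prod.ext h1 h2)
    · simp
  rw [reshape_mulVec_apply, ← Fintype.sum_prod_type' (f := fun a' o' =>
    A ((split d I).symm (a, o)) ((split d I).symm (a', o')) * reshape I ψ a' o'),
    Matrix.sum_apply]
  simp only [hrw, Finset.sum_mul]
  rw [Finset.sum_comm]
  refine Finset.sum_congr rfl fun p _ => ?_
  rw [Matrix.smul_apply, Matrix.mul_apply, smul_eq_mul]
  simp only [Matrix.mul_apply, Finset.sum_mul]
  rw [Finset.sum_comm, ← Fintype.sum_prod_type' (f := fun a' o' =>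
    unitOn (· ∈ I) X p.1 p.2 a a' * reshape I ψ a' o' * unitOn (· ∉ I) X p.2 p.1 o' o),
    Finset.mul_sum]
  exact Finset.sum_congr rfl fun r _ => by ring

/-- Expanding the term in matrix units on `X` gives one summand per pair of configurations of `X`.
Each unit is a contraction on either side of the cut, and its coefficient is an entry of `A`, hence
at most `‖A‖`. -/
theorem opNorm_reshape_mulVec_le [Nonempty (Config d)] (I : Finset L) {X : Finset L}
    {A : Matrix (Config d) (Config d) ℂ} (hs : SupportedOn X A) (ψ : Config d → ℂ) :
    ‖reshape I (A *ᵥ ψ)‖ ≤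
      (Fintype.card (ConfigIn d X) : ℝ) ^ 2 * ‖A‖ * ‖reshape I ψ‖ := by
  obtain ⟨B, hB⟩ := supportedOn_iff.1 hs
  have h1 : ∀ β γ, ‖B β γ‖ ≤ ‖A‖ := by
    intro β γ
    -- Some configuration of the sites outside `X` is needed to find the entries of `B` among those
    -- of `A`.
    obtain ⟨x₀⟩ := ‹Nonempty (Config d)›
    have := norm_entry_le_opNorm A ((split d X).symm (β, fun j => x₀ j))
      ((split d X).symm (γ, fun j => x₀ j))
    have e : ∀ β : ConfigIn d X, (fun j : {j // j ∈ X} =>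
        (split d X).symm (β, fun j => x₀ j) j) = β :=
      fun β => funext fun j => split_symm_of_mem _ _ j.2
    rwa [hB, if_pos, e, e] at this
    intro j hj
    rw [split_symm_of_notMem _ _ hj, split_symm_of_notMem _ _ hj]
  have hb : ∀ p : ConfigIn d X × ConfigIn d X, ‖B p.1 p.2 •
      (unitOn (· ∈ I) X p.1 p.2 * reshape I ψ * unitOn (· ∉ I) X p.2 p.1)‖
      ≤ ‖A‖ * ‖reshape I ψ‖ := by
    intro p
    have hP := opNorm_unitOn_le_one (· ∈ I) X p.1 p.2
    have hQ := opNorm_unitOn_le_one (· ∉ I) X p.2 p.1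
    rw [norm_smul]
    refine mul_le_mul (h1 _ _) ?_ (norm_nonneg _) (norm_nonneg _)
    refine (l2_opNorm_mul _ _).trans ?_
    refine (mul_le_of_le_one_right (norm_nonneg _) hQ).trans ?_
    exact (l2_opNorm_mul _ _).trans (mul_le_of_le_one_left (norm_nonneg _) hP)
  rw [reshape_mulVec_eq_sum_unitOn I X hB]
  refine (norm_sum_le _ _).trans ((Finset.sum_le_sum fun p _ => hb p).trans ?_)
  simp only [Finset.sum_const, Finset.card_univ, nsmul_eq_mul, Fintype.card_prod, Nat.cast_mul]
  exact le_of_eq (by ring)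

end LocalTerms

/-! ### Unitary evolution, product states and entropy growth. -/

section Evolution

variable {L : Type} [Fintype L] [DecidableEq L] {d : L → ℕ}

theorem evolve_eq (H : Matrix (Config d) (Config d) ℂ) (t : ℝ) (ψ : Config d → ℂ) :
    evolve H t ψ = NormedSpace.exp (((-t : ℝ) : ℂ) • (Complex.I • H)) *ᵥ ψ := by
  rw [evolve, smul_smul]
  congr 3
  push_cast
  ring

theorem exp_neg_mul_exp {n : Type*} [Fintype n] [DecidableEq n] (A : Matrix n n ℂ) (t : ℝ) :
    NormedSpace.exp (((-t : ℝ) : ℂ) • A) * NormedSpace.exp ((t : ℂ) • A) = 1 := by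
  rw [Complex.ofReal_neg, neg_smul, Matrix.exp_neg, Matrix.nonsing_inv_mul]
  exact (Matrix.isUnit_iff_isUnit_det _).1 (Matrix.isUnit_exp _)

theorem sum_norm_sq_exp_mulVec {n : Type*} [Fintype n] [DecidableEq n] {H : Matrix n n ℂ}
    (hH : H.IsHermitian) (t : ℝ) (ψ : n → ℂ) :
    ∑ σ, ‖(NormedSpace.exp ((t : ℂ) • (Complex.I • H)) *ᵥ ψ) σ‖ ^ 2 = ∑ σ, ‖ψ σ‖ ^ 2 := by
  have hle : ∀ (t : ℝ) (ψ : n → ℂ),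
      ∑ σ, ‖(NormedSpace.exp ((t : ℂ) • (Complex.I • H)) *ᵥ ψ) σ‖ ^ 2 ≤ ∑ σ, ‖ψ σ‖ ^ 2 := by
    intro t ψ
    have h1 := opNorm_exp_I_smul_le_one hH t
    refine (sum_norm_sq_mulVec_le _ ψ).trans ?_
    exact mul_le_of_le_one_left (Finset.sum_nonneg fun _ _ => by positivity)
      (pow_le_one₀ (norm_nonneg _) h1)
  refine le_antisymm (hle t ψ) ?_
  have e : NormedSpace.exp (((-t : ℝ) : ℂ) • (Complex.I • H)) *ᵥ
      (NormedSpace.exp ((t : ℂ) • (Complex.I • H)) *ᵥ ψ) = ψ := by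
    rw [mulVec_mulVec, exp_neg_mul_exp, one_mulVec]
  calc ∑ σ, ‖ψ σ‖ ^ 2 = ∑ σ, ‖(NormedSpace.exp (((-t : ℝ) : ℂ) • (Complex.I • H)) *ᵥ
        (NormedSpace.exp ((t : ℂ) • (Complex.I • H)) *ᵥ ψ)) σ‖ ^ 2 := by rw [e]
    _ ≤ _ := hle (-t) _

theorem sum_norm_sq_evolve {H : Matrix (Config d) (Config d) ℂ} (hH : H.IsHermitian) (t : ℝ)
    (ψ : Config d → ℂ) : ∑ σ, ‖evolve H t ψ σ‖ ^ 2 = ∑ σ, ‖ψ σ‖ ^ 2 := by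
  rw [evolve_eq, sum_norm_sq_exp_mulVec hH]

theorem star_dotProduct_evolve {H : Matrix (Config d) (Config d) ℂ} (hH : H.IsHermitian) (t : ℝ)
    (w ψ : Config d → ℂ) :
    star w ⬝ᵥ evolve H t ψ = star (NormedSpace.exp ((t : ℂ) • (Complex.I • H)) *ᵥ w) ⬝ᵥ ψ := by
  rw [star_mulVec, ← dotProduct_mulVec, ← Matrix.exp_conjTranspose, evolve_eq]
  congr 3
  simp [conjTranspose_smul, hH.eq]

theorem sum_norm_sq_prod {ι : Type*} [Fintype ι] [DecidableEq ι] {κ : ι → Type*}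
    [∀ i, Fintype (κ i)] (φ : ∀ i, κ i → ℂ) (h : ∀ i, ∑ a, ‖φ i a‖ ^ 2 = 1) :
    ∑ σ : ∀ i, κ i, ‖∏ i, φ i (σ i)‖ ^ 2 = 1 := by
  simp only [norm_prod, ← Finset.prod_pow]
  rw [← Fintype.prod_sum (fun i a => ‖φ i a‖ ^ 2)]
  simp [h]

theorem IsProductState.sum_norm_sq {ψ : Config d → ℂ} (h : IsProductState ψ) :
    ∑ σ, ‖ψ σ‖ ^ 2 = 1 := by
  obtain ⟨φ, h1, h2⟩ := h
  simp only [h2]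
  exact sum_norm_sq_prod φ h1

/-- A product vector reshapes to the rank-one matrix of two unit vectors `u` and `v`, so the overlap
is a matrix element of `reshape I w` between unit vectors. -/
theorem IsProductState.norm_star_dotProduct_le {ψ : Config d → ℂ} (h : IsProductState ψ)
    (I : Finset L) (w : Config d → ℂ) : ‖star w ⬝ᵥ ψ‖ ≤ ‖reshape I w‖ := by
  obtain ⟨φ, h1, h2⟩ := h
  set u : ConfigIn d I → ℂ := fun a => ∏ j, φ j.1 (a j) with hu
  set v : ConfigOut d I → ℂ := fun o => ∏ j, φ j.1 (o j) with hv
  have hun : ∑ a, ‖u a‖ ^ 2 = 1 := sum_norm_sq_prod (fun j : {j // j ∈ I} => φ j.1) fun j => h1 _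
  have hvn : ∑ a, ‖v a‖ ^ 2 = 1 := sum_norm_sq_prod (fun j : {j // j ∉ I} => φ j.1) fun j => h1 _
  have hψ : ∀ a o, ψ ((split d I).symm (a, o)) = u a * v o := by
    intro a o
    rw [h2, ← Finset.prod_mul_prod_compl I, Finset.prod_subtype I (p := (· ∈ I)) (fun _ => Iff.rfl),
      Finset.prod_subtype Iᶜ (p := (· ∉ I)) (fun _ => Finset.mem_compl), hu, hv]
    refine congrArg₂ (· * ·) (Finset.prod_congr rfl fun j _ => ?_)
      (Finset.prod_congr rfl fun j _ => ?_)
    · rw [split_symm_of_mem _ _ j.2]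
    · rw [split_symm_of_notMem _ _ j.2]
  have e : star w ⬝ᵥ ψ = ∑ a, star ((reshape I w *ᵥ star v) a) * u a := by
    rw [dotProduct, sum_config_eq_sum_split I]
    refine Finset.sum_congr rfl fun a _ => ?_
    rw [mulVec, dotProduct, star_sum, Finset.sum_mul]
    refine Finset.sum_congr rfl fun o _ => ?_
    rw [hψ, reshape_apply]
    simp only [Pi.star_apply, star_mul', star_star]
    ring
  rw [e]
  refine le_of_sq_le_sq ?_ (norm_nonneg _)
  have hF := sum_norm_sq_mulVec_le (reshape I w) (star v)
  simp only [Pi.star_apply, norm_star, hvn, mul_one] at hF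
  calc ‖∑ a, star ((reshape I w *ᵥ star v) a) * u a‖ ^ 2
      ≤ (∑ a, ‖(reshape I w *ᵥ star v) a‖ * ‖u a‖) ^ 2 := by
        gcongr
        refine (norm_sum_le _ _).trans (le_of_eq ?_)
        simp
    _ ≤ (∑ a, ‖(reshape I w *ᵥ star v) a‖ ^ 2) * ∑ a, ‖u a‖ ^ 2 :=
        Finset.sum_mul_sq_le_sq_mul_sq _ _ _
    _ ≤ ‖reshape I w‖ ^ 2 := by rw [hun, mul_one]; exact hF

/-- The evolution is moved onto the test vector `w`, whose operator norm grows at most by exp(c t);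
this bounds the trace norm of the evolved state. -/
theorem IsProductState.entanglementEntropy_evolve_le {ψ : Config d → ℂ} (h : IsProductState ψ)
    {H : Matrix (Config d) (Config d) ℂ} (hH : H.IsHermitian) {I : Finset L}
    {K : Matrix (ConfigIn d I) (ConfigIn d I) ℂ} {K' : Matrix (ConfigOut d I) (ConfigOut d I) ℂ}
    (hK : K.IsHermitian) (hK' : K'.IsHermitian) {c : ℝ}
    (hc : ∀ ψ, ‖reshape I (H *ᵥ ψ) - (K * reshape I ψ + reshape I ψ * K')‖ ≤ c * ‖reshape I ψ‖)
    {t : ℝ} (ht : 0 ≤ t) :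
    entanglementEntropy I (evolve H t ψ) ≤ 2 * (c * t / Real.log 2) := by
  have := entanglementEntropy_le_of_overlap_le (I := I) (ψ := evolve H t ψ)
    (by rw [sum_norm_sq_evolve hH, h.sum_norm_sq]) (Z := Real.exp (c * t)) (fun w hw => by
      rw [star_dotProduct_evolve hH]
      refine (h.norm_star_dotProduct_le I _).trans ?_
      refine (reshape_evolution_norm_le hK hK' hc w ht).trans ?_
      exact mul_le_of_le_one_right (Real.exp_pos _).le hw)
  rwa [Real.logb, Real.log_exp] at this

end Evolution

/-! ### Counting interaction terms across the boundary. -/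

section AreaLaw

variable {L : Type} [Fintype L] [DecidableEq L]

/-- The vertices that can be reached from `v` in at most `n` steps. -/
def walkBall (G : SimpleGraph L) [DecidableRel G.Adj] : ℕ → L → Finset L
  | 0, v => {v}
  | n + 1, v => insert v ((G.neighborFinset v).biUnion (walkBall G n))

theorem mem_walkBall {G : SimpleGraph L} [DecidableRel G.Adj] {u v : L} (p : G.Walk u v) :
    ∀ {n : ℕ}, p.length ≤ n → v ∈ walkBall G n u := by
  induction p with
  | nil =>
    intro n _
    cases n <;> simp [walkBall]
  | cons h p ih =>
    intro n hn
    cases n with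
    | zero => simp at hn
    | succ n =>
      rw [walkBall, Finset.mem_insert, Finset.mem_biUnion]
      right
      exact ⟨_, by simpa using h, ih (by simpa using hn)⟩

theorem card_walkBall_le {G : SimpleGraph L} [DecidableRel G.Adj] {Δ : ℕ}
    (hΔ : ∀ v, G.degree v ≤ Δ) : ∀ (n : ℕ) (v : L), (walkBall G n v).card ≤ (Δ + 1) ^ n
  | 0, v => by simp [walkBall]
  | n + 1, v => by
    rw [walkBall]
    refine (Finset.card_insert_le _ _).trans ?_
    have h1 : ((G.neighborFinset v).biUnion (walkBall G n)).card ≤ Δ * (Δ + 1) ^ n := by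
      refine (Finset.card_biUnion_le_card_mul _ _ _ fun u _ => card_walkBall_le hΔ n u).trans ?_
      exact Nat.mul_le_mul_right _ (by simpa using hΔ v)
    have h2 : 1 ≤ (Δ + 1) ^ n := Nat.one_le_pow _ _ (by omega)
    calc _ ≤ Δ * (Δ + 1) ^ n + (Δ + 1) ^ n := by omega
      _ = _ := by ring

/-- A shortest walk from `i` to `j` must leave `I`; the site from which it steps out lies on the
boundary and on that walk. -/
theorem exists_boundary_edist_le {G : SimpleGraph L} {I : Finset L} {i j : L} {r : ℕ}
    (hi : i ∈ I) (hj : j ∉ I) (h : G.edist i j ≤ r) :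
    ∃ b, (b ∈ I ∧ ∃ k, k ∉ I ∧ G.Adj b k) ∧ G.edist b i ≤ r := by
  obtain ⟨p, hp⟩ := SimpleGraph.exists_walk_of_edist_ne_top
    (ne_top_of_le_ne_top (ENat.natCast_ne_top r) h)
  obtain ⟨e, he, h1, h2⟩ := p.exists_boundary_dart (I : Set L) hi hj
  refine ⟨e.fst, ⟨h1, e.snd, h2, e.adj⟩, ?_⟩
  have hs := p.dart_fst_mem_support_of_mem_darts he
  rw [SimpleGraph.edist_comm]
  refine (SimpleGraph.Walk.edist_le (p.takeUntil _ hs)).trans ?_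
  refine le_trans ?_ (hp.trans_le h)
  exact_mod_cast p.length_takeUntil_le_length hs

open Classical in
/-- The sets of sites near the boundary of `I`. -/
noncomputable def boundarySets (G : SimpleGraph L) [DecidableRel G.Adj] (r : ℕ) (I : Finset L) :
    Finset (Finset L) :=
  (Finset.univ.filter fun b => b ∈ I ∧ ∃ k, k ∉ I ∧ G.Adj b k).biUnion fun b =>
    (walkBall G (r + r) b).powerset

theorem card_boundarySets_le {G : SimpleGraph L} [DecidableRel G.Adj] {Δ : ℕ}
    (hΔ : ∀ v, G.degree v ≤ Δ) (r : ℕ) (I : Finset L) :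
    (boundarySets G r I).card ≤ boundaryArea G I * 2 ^ ((Δ + 1) ^ (r + r)) := by
  classical
  have h1 : boundaryArea G I =
      (Finset.univ.filter fun b => b ∈ I ∧ ∃ k, k ∉ I ∧ G.Adj b k).card := by
    rw [boundaryArea, ← Set.ncard_coe_finset]
    congr 1
    ext; simp
  rw [h1, boundarySets]
  convert Finset.card_biUnion_le_card_mul _ _ _ fun b _ => ?_
  rw [Finset.card_powerset]
  exact Nat.pow_le_pow_right (by norm_num) (card_walkBall_le hΔ _ _)

theorem card_le_of_mem_boundarySets {G : SimpleGraph L} [DecidableRel G.Adj] {Δ : ℕ}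
    (hΔ : ∀ v, G.degree v ≤ Δ) {r : ℕ} {I X : Finset L} (hX : X ∈ boundarySets G r I) :
    X.card ≤ (Δ + 1) ^ (r + r) := by
  simp only [boundarySets, Finset.mem_biUnion, Finset.mem_powerset] at hX
  obtain ⟨b, -, hb⟩ := hX
  exact (Finset.card_le_card hb).trans (card_walkBall_le hΔ _ _)

/-- The radius `r + r` has two parts: a set across the cut contains a site within `r` of some
boundary site, and all its other sites are within `r` of that one. -/
theorem mem_boundarySets {G : SimpleGraph L} [DecidableRel G.Adj] {r : ℕ} {I X : Finset L}
    (hX : ∀ i ∈ X, ∀ j ∈ X, G.edist i j ≤ (r : ℕ∞)) (h1 : ¬ X ⊆ I) (h2 : ¬ Disjoint X I) :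
    X ∈ boundarySets G r I := by
  obtain ⟨j, hjX, hjI⟩ := Finset.not_subset.1 h1
  obtain ⟨i, hiX, hiI⟩ := Finset.not_disjoint_iff.1 h2
  obtain ⟨b, hb, hbi⟩ := exists_boundary_edist_le hiI hjI (hX i hiX j hjX)
  simp only [boundarySets, Finset.mem_biUnion, Finset.mem_powerset]
  refine ⟨b, by simpa using hb, fun x hx => ?_⟩
  have h : G.edist b x ≤ ((r + r : ℕ) : ℕ∞) := by
    push_cast
    exact G.edist_triangle.trans (add_le_add hbi (hX i hiX x hx))
  obtain ⟨p, hp⟩ := SimpleGraph.exists_walk_of_edist_ne_top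
    (ne_top_of_le_ne_top (ENat.natCast_ne_top _) h)
  exact mem_walkBall p (by exact_mod_cast hp.trans_le h)

/-- The base `q + 1` is positive also for `q = 0`, so the power can later be increased along with
the exponent. -/
theorem card_configIn_le {d : L → ℕ} {q : ℕ} (hd : ∀ j, d j ≤ q) (X : Finset L) :
    Fintype.card (ConfigIn d X) ≤ (q + 1) ^ X.card := by
  rw [Fintype.card_pi]
  simp only [Fintype.card_fin]
  refine (Finset.prod_le_pow_card _ _ (q + 1) fun j _ => (hd _).trans (Nat.le_succ _)).trans ?_
  simp

theorem IsLocalHamiltonian.isHermitian {d : L → ℕ} {G : SimpleGraph L} {r : ℕ} {J : ℝ}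
    {H : Matrix (Config d) (Config d) ℂ} (h : IsLocalHamiltonian G r J H) : H.IsHermitian := by
  obtain ⟨h, h1, -, -, -, rfl⟩ := h
  rw [IsHermitian, conjTranspose_sum]
  exact Finset.sum_congr rfl fun X _ => (h1 X).eq

/-- Terms inside `I` are collected in `K` and terms disjoint from `I` in `K'`. Only nonzero terms
across the cut remain, and they live on `boundarySets`. -/
theorem IsLocalHamiltonian.exists_reshape_mulVec_sub_le {d : L → ℕ} [Nonempty (Config d)]
    {G : SimpleGraph L} [DecidableRel G.Adj] {Δ q r : ℕ} {J : ℝ}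
    (hΔ : ∀ v, G.degree v ≤ Δ) (hd : ∀ j, d j ≤ q)
    {H : Matrix (Config d) (Config d) ℂ} (h : IsLocalHamiltonian G r J H) (I : Finset L) :
    ∃ (K : Matrix (ConfigIn d I) (ConfigIn d I) ℂ) (K' : Matrix (ConfigOut d I) (ConfigOut d I) ℂ),
      K.IsHermitian ∧ K'.IsHermitian ∧ ∀ ψ,
        ‖reshape I (H *ᵥ ψ) - (K * reshape I ψ + reshape I ψ * K')‖ ≤
          (boundarySets G r I).card * (((q + 1 : ℝ) ^ ((Δ + 1) ^ (r + r))) ^ 2 * |J|) *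
            ‖reshape I ψ‖ := by
  obtain ⟨h, h1, h2, h3, h4, rfl⟩ := h
  set D := ((q + 1 : ℝ) ^ ((Δ + 1) ^ (r + r))) ^ 2 * |J| with hD
  have key : ∀ X, ∃ (K : Matrix (ConfigIn d I) (ConfigIn d I) ℂ)
      (K' : Matrix (ConfigOut d I) (ConfigOut d I) ℂ), K.IsHermitian ∧ K'.IsHermitian ∧ ∀ ψ,
        ‖reshape I (h X *ᵥ ψ) - (K * reshape I ψ + reshape I ψ * K')‖ ≤
          (if X ∈ boundarySets G r I then D else 0) * ‖reshape I ψ‖ := by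
    intro X
    have hnn : ∀ ψ : Config d → ℂ,
        0 ≤ (if X ∈ boundarySets G r I then D else 0) * ‖reshape I ψ‖ := by
      intro ψ
      split_ifs <;> positivity
    -- The empty set satisfies both alternatives; the order of the case distinction puts it into
    -- `K`.
    by_cases c1 : X ⊆ I
    · obtain ⟨K, hK, hψ⟩ := exists_reshape_mulVec_of_subset c1 (h1 X) (h2 X)
      refine ⟨K, 0, hK, isHermitian_zero, fun ψ => ?_⟩
      rw [hψ, Matrix.mul_zero, add_zero, sub_self, norm_zero]
      exact hnn ψ
    by_cases c2 : Disjoint X I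
    · obtain ⟨K, hK, hψ⟩ := exists_reshape_mulVec_of_disjoint c2 (h1 X) (h2 X)
      refine ⟨0, K, isHermitian_zero, hK, fun ψ => ?_⟩
      rw [hψ, Matrix.zero_mul, zero_add, sub_self, norm_zero]
      exact hnn ψ
    refine ⟨0, 0, isHermitian_zero, isHermitian_zero, fun ψ => ?_⟩
    rw [Matrix.mul_zero, Matrix.zero_mul, add_zero, sub_zero]
    by_cases c3 : h X = 0
    · rw [c3, zero_mulVec, map_zero, norm_zero]
      exact hnn ψ
    have c4 := mem_boundarySets (h3 X c3) c1 c2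
    rw [if_pos c4]
    refine (opNorm_reshape_mulVec_le I (h2 X) ψ).trans ?_
    refine mul_le_mul_of_nonneg_right ?_ (norm_nonneg _)
    have e1 : ‖h X‖ ≤ |J| := (h4 X).trans (le_abs_self J)
    have e2 : (Fintype.card (ConfigIn d X) : ℝ) ≤ (q + 1 : ℝ) ^ ((Δ + 1) ^ (r + r)) := by
      have := (card_configIn_le hd X).trans
        (Nat.pow_le_pow_right (Nat.succ_pos q) (card_le_of_mem_boundarySets hΔ c4))
      exact_mod_cast this
    rw [hD]
    gcongr
  choose K K' hK hK' hb using key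
  refine ⟨∑ X, K X, ∑ X, K' X, ?_, ?_, fun ψ => ?_⟩
  · rw [IsHermitian, conjTranspose_sum]
    exact Finset.sum_congr rfl fun X _ => (hK X).eq
  · rw [IsHermitian, conjTranspose_sum]
    exact Finset.sum_congr rfl fun X _ => (hK' X).eq
  · rw [Matrix.sum_mulVec, map_sum, Matrix.sum_mul, Matrix.mul_sum, ← Finset.sum_add_distrib,
      ← Finset.sum_sub_distrib]
    refine (norm_sum_le _ _).trans ((Finset.sum_le_sum fun X _ => hb X ψ).trans (le_of_eq ?_))
    rw [← Finset.sum_mul, Finset.sum_ite_mem, Finset.univ_inter, Finset.sum_const, nsmul_eq_mul]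

theorem entanglementEntropy_evolve_le_boundaryArea (Δ q r : ℕ) (J t : ℝ) (ht : 0 < t) :
    ∃ c₀ c₁ : ℝ, 0 < c₀ ∧ 0 < c₁ ∧
      ∀ (L : Type) [Fintype L] [DecidableEq L] (G : SimpleGraph L) [DecidableRel G.Adj],
        (∀ v, G.degree v ≤ Δ) →
      ∀ (d : L → ℕ), (∀ j, d j ≤ q) →
      ∀ (H : Matrix (Config d) (Config d) ℂ) (ψ : Config d → ℂ),
        IsLocalHamiltonian G r J H → IsProductState ψ →
      ∀ I : Finset L,
        entanglementEntropy I (evolve H t ψ) ≤ c₀ * (boundaryArea G I : ℝ) + c₁ := by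
  have hlog2 : 0 < Real.log 2 := Real.log_pos (by norm_num)
  set D := ((q + 1 : ℝ) ^ ((Δ + 1) ^ (r + r))) ^ 2 * |J| with hD
  have hD0 : 0 ≤ D := by positivity
  set P : ℝ := 2 ^ ((Δ + 1) ^ (r + r)) with hP
  have hP0 : 0 ≤ P := by positivity
  -- The summand 1 makes the constant positive also when `J = 0`. The value of the additive constant
  -- is arbitrary.
  refine ⟨2 * (P * D * t / Real.log 2) + 1, 1, by positivity, one_pos, ?_⟩
  intro L _ _ G _ hΔ d hd H ψ hH hψ I
  have hne : Nonempty (Config d) := by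
    by_contra hne
    rw [not_nonempty_iff] at hne
    have := hψ.sum_norm_sq
    simp at this
  obtain ⟨K, K', hK, hK', hb⟩ := hH.exists_reshape_mulVec_sub_le hΔ hd I
  refine (hψ.entanglementEntropy_evolve_le hH.isHermitian hK hK' hb ht.le).trans ?_
  have hcard : ((boundarySets G r I).card : ℝ) ≤ boundaryArea G I * P := by
    rw [hP]; exact_mod_cast card_boundarySets_le hΔ r I
  have hs : (0 : ℝ) ≤ boundaryArea G I := Nat.cast_nonneg _
  calc 2 * ((boundarySets G r I).card * D * t / Real.log 2)
      ≤ 2 * (boundaryArea G I * P * D * t / Real.log 2) := by gcongr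
    _ = 2 * (P * D * t / Real.log 2) * boundaryArea G I := by ring
    _ ≤ _ := by nlinarith

/-- The neighbours lie in the image of the 2D signed coordinate steps. For small `n` these may
coincide, which only lowers the degree. -/
theorem degree_cubicLattice_le (D n : ℕ) [NeZero n] [DecidableRel (cubicLattice D n).Adj]
    (v : Fin D → ZMod n) : (cubicLattice D n).degree v ≤ 2 * D := by
  classical
  have h1 : (cubicLattice D n).neighborFinset v ⊆
      (Finset.univ : Finset (Bool × Fin D)).image fun p =>
        Function.update v p.2 (if p.1 then v p.2 + 1 else v p.2 - 1) := by
    intro w hw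
    rw [SimpleGraph.mem_neighborFinset] at hw
    obtain ⟨-, k, hk, hl⟩ := hw
    rw [Finset.mem_image]
    rcases hk with hk | hk
    · refine ⟨(true, k), Finset.mem_univ _, ?_⟩
      ext l
      by_cases h : l = k
      · subst h; simp [hk]
      · simp [h, hl l h]
    · refine ⟨(false, k), Finset.mem_univ _, ?_⟩
      ext l
      by_cases h : l = k
      · subst h; simp [hk]
      · simp [h, hl l h]
  rw [← SimpleGraph.card_neighborFinset_eq_degree]
  refine (Finset.card_le_card h1).trans (Finset.card_image_le.trans ?_)
  simp

end AreaLaw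

/-! ### Fermionic operators from spins. -/

section JordanWigner

variable {ι : Type} [Fintype ι] [DecidableEq ι] (r : ι → ℕ)

/-- The Jordan–Wigner sign: the parity of the number of particles on sites of rank below `j`. -/
noncomputable def jwSign (j : ι) (x : ι → Fin 2) : ℂ :=
  ∏ i, if r i < r j ∧ x i = 1 then -1 else 1

/-- `x` has occupation `b` at `j`, `y` has the opposite one, and they agree elsewhere. -/
def FlipAt (b : Fin 2) (j : ι) (x y : ι → Fin 2) : Prop :=
  x j = b ∧ y j = 1 - b ∧ ∀ i, i ≠ j → x i = y i

open Classical in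
/-- The fermionic creation (`b = 1`) and annihilation (`b = 0`) operators. -/
noncomputable def fermi (b : Fin 2) (j : ι) : Matrix (ι → Fin 2) (ι → Fin 2) ℂ :=
  Matrix.of fun x y => if FlipAt b j x y then jwSign r j x else 0

variable {r}

theorem jwSign_update_of_not_lt {i j : ι} (h : ¬ r i < r j) (x : ι → Fin 2) (c : Fin 2) :
    jwSign r j (Function.update x i c) = jwSign r j x := by
  refine Finset.prod_congr rfl fun k _ => ?_
  by_cases hk : k = i
  · subst hk; simp [h]
  · rw [Function.update_of_ne hk]

theorem jwSign_update_of_lt {i j : ι} (h : r i < r j) (x : ι → Fin 2) :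
    jwSign r j (Function.update x i (1 - x i)) = -jwSign r j x := by
  rw [jwSign, jwSign, ← Finset.mul_prod_erase _ _ (Finset.mem_univ i),
    ← Finset.mul_prod_erase _ _ (Finset.mem_univ i), ← neg_mul]
  congr 1
  · rcases Fin.exists_fin_two.1 ⟨x i, rfl⟩ with h0 | h0 <;> simp [h, h0]
  · refine Finset.prod_congr rfl fun k hk => ?_
    rw [Function.update_of_ne (Finset.ne_of_mem_erase hk)]

theorem jwSign_mul_self (j : ι) (x : ι → Fin 2) : jwSign r j x * jwSign r j x = 1 := by
  rw [jwSign, ← Finset.prod_mul_distrib]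
  refine Finset.prod_eq_one fun i _ => ?_
  split_ifs <;> simp

theorem star_jwSign (j : ι) (x : ι → Fin 2) : star (jwSign r j x) = jwSign r j x := by
  rw [jwSign, star_prod]
  refine Finset.prod_congr rfl fun i _ => ?_
  split_ifs <;> simp

theorem flipAt_iff {b : Fin 2} {j : ι} {x y : ι → Fin 2} :
    FlipAt b j x y ↔ x j = b ∧ y = Function.update x j (1 - b) := by
  constructor
  · rintro ⟨h1, h2, h3⟩
    refine ⟨h1, funext fun i => ?_⟩
    by_cases h : i = j
    · subst h; simp [h2]
    · simp [h, h3 i h]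
  · rintro ⟨h1, rfl⟩
    refine ⟨h1, by simp, fun i hi => by simp [hi]⟩

theorem fermi_mulVec (b : Fin 2) (j : ι) (ψ : (ι → Fin 2) → ℂ) (x : ι → Fin 2) :
    (fermi r b j *ᵥ ψ) x =
      if x j = b then jwSign r j x * ψ (Function.update x j (1 - b)) else 0 := by
  rw [mulVec, dotProduct]
  split_ifs with h
  · rw [Finset.sum_eq_single (Function.update x j (1 - b))]
    · rw [fermi, of_apply, if_pos (flipAt_iff.2 ⟨h, rfl⟩)]
    · intro y _ hy
      rw [fermi, of_apply, if_neg (fun hf => hy (flipAt_iff.1 hf).2), zero_mul]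
    · simp
  · refine Finset.sum_eq_zero fun y _ => ?_
    rw [fermi, of_apply, if_neg (fun hf => h hf.1), zero_mul]

theorem one_sub_one_sub (b : Fin 2) : 1 - (1 - b) = b := by
  revert b; decide

theorem fermi_conjTranspose (b : Fin 2) (j : ι) : (fermi r b j)ᴴ = fermi r (1 - b) j := by
  ext x y
  rw [conjTranspose_apply, fermi, fermi, of_apply, of_apply]
  have h : FlipAt b j y x ↔ FlipAt (1 - b) j x y := by
    constructor
    · rintro ⟨h1, h2, h3⟩
      exact ⟨h2, by rw [h1, one_sub_one_sub], fun i hi => (h3 i hi).symm⟩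
    · rintro ⟨h1, h2, h3⟩
      exact ⟨by rw [h2, one_sub_one_sub], h1, fun i hi => (h3 i hi).symm⟩
  by_cases hf : FlipAt b j y x
  · rw [if_pos hf, if_pos (h.1 hf), star_jwSign, (flipAt_iff.1 hf).2,
      jwSign_update_of_not_lt (lt_irrefl _)]
  · rw [if_neg hf, if_neg (fun h' => hf (h.2 h')), star_zero]

theorem matrix_ext_mulVec {m n : Type*} [Fintype n] [DecidableEq n] {A B : Matrix m n ℂ}
    (h : ∀ v, A *ᵥ v = B *ᵥ v) : A = B :=
  Matrix.ext_of_mulVec_single fun _ => h _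

/-- The two flips commute as maps of configurations. The flip at lower rank reverses the sign string
of the higher site, while the other string is unaffected, whence a single minus sign. -/
theorem fermi_anticomm_of_lt {i j : ι} (h : r i < r j) (b c : Fin 2) :
    fermi r b i * fermi r c j + fermi r c j * fermi r b i = 0 := by
  have hij : i ≠ j := fun e => by simp [e] at h
  refine matrix_ext_mulVec fun ψ => funext fun x => ?_
  rw [add_mulVec, Pi.add_apply, ← mulVec_mulVec, ← mulVec_mulVec, zero_mulVec, Pi.zero_apply]
  simp only [fermi_mulVec, Function.update_of_ne hij, Function.update_of_ne hij.symm]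
  by_cases h1 : x i = b
  · by_cases h2 : x j = c
    · have e := jwSign_update_of_lt h x
      rw [h1] at e
      rw [if_pos h1, if_pos h2, if_pos h1, if_pos h2, e, jwSign_update_of_not_lt (not_lt.2 h.le),
        Function.update_comm hij]
      ring
    · simp [h2]
  · simp [h1]

theorem fermi_mul_fermi_self (b : Fin 2) (j : ι) : fermi r b j * fermi r b j = 0 := by
  refine matrix_ext_mulVec fun ψ => funext fun x => ?_
  rw [← mulVec_mulVec, fermi_mulVec, fermi_mulVec, zero_mulVec, Pi.zero_apply]
  have : ¬ (1 - b = b) := by revert b; decide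
  simp [this]

theorem fermi_mul_add_mul_self (j : ι) :
    fermi r 0 j * fermi r 1 j + fermi r 1 j * fermi r 0 j = 1 := by
  refine matrix_ext_mulVec fun ψ => funext fun x => ?_
  rw [add_mulVec, Pi.add_apply, ← mulVec_mulVec, ← mulVec_mulVec, one_mulVec]
  simp only [fermi_mulVec, Function.update_self, jwSign_update_of_not_lt (lt_irrefl (r j)),
    Function.update_idem]
  have hs := jwSign_mul_self (r := r) j x
  rcases Fin.exists_fin_two.1 ⟨x j, rfl⟩ with h | h
  · have e : Function.update x j 0 = x := by rw [← h]; exact Function.update_eq_self _ _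
    simp [h, e, ← mul_assoc, hs]
  · have e : Function.update x j 1 = x := by rw [← h]; exact Function.update_eq_self _ _
    simp [h, e, ← mul_assoc, hs]

theorem fermi_anticomm (hr : Function.Injective r) {i j : ι} (h : i ≠ j) (b c : Fin 2) :
    fermi r b i * fermi r c j + fermi r c j * fermi r b i = 0 := by
  rcases lt_or_gt_of_ne (hr.ne h) with h1 | h1
  · exact fermi_anticomm_of_lt h1 b c
  · rw [add_comm]; exact fermi_anticomm_of_lt h1 c b

variable (r)

/-- The creation operator of the orbital `v`. -/
noncomputable def create : (ι → ℂ) →ₗ[ℂ] Matrix (ι → Fin 2) (ι → Fin 2) ℂ where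
  toFun v := ∑ j, v j • fermi r 1 j
  map_add' v w := by simp [add_smul, Finset.sum_add_distrib]
  map_smul' c v := by simp [Finset.smul_sum, smul_smul]

variable {r}

theorem create_apply (v : ι → ℂ) : create r v = ∑ j, v j • fermi r 1 j := rfl

theorem create_conjTranspose (v : ι → ℂ) :
    (create r v)ᴴ = ∑ j, star (v j) • fermi r 0 j := by
  simp [create_apply, conjTranspose_sum, conjTranspose_smul, fermi_conjTranspose]

/-- Canonical anticommutation relations: by bilinearity only equal sites survive, each contributing
the identity. -/
theorem create_anticomm_conjTranspose (hr : Function.Injective r) (v w : ι → ℂ) :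
    (create r v)ᴴ * create r w + create r w * (create r v)ᴴ = (star v ⬝ᵥ w) • 1 := by
  rw [create_conjTranspose, create_apply, Finset.sum_mul_sum, Finset.sum_mul_sum,
    Finset.sum_comm (f := fun i j => w i • fermi r 1 i * star (v j) • fermi r 0 j),
    ← Finset.sum_add_distrib, dotProduct, Finset.sum_smul]
  refine Finset.sum_congr rfl fun i _ => ?_
  rw [← Finset.sum_add_distrib, Finset.sum_eq_single i]
  · rw [smul_mul_smul_comm, smul_mul_smul_comm, mul_comm (w i), ← smul_add,
      fermi_mul_add_mul_self, Pi.star_apply]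
  · intro j _ hj
    rw [smul_mul_smul_comm, smul_mul_smul_comm, mul_comm (w j), ← smul_add,
      fermi_anticomm hr hj.symm, smul_zero]
  · simp

theorem create_mul_create_add (hr : Function.Injective r) (v w : ι → ℂ) :
    create r v * create r w + create r w * create r v = 0 := by
  rw [create_apply, create_apply, Finset.sum_mul_sum, Finset.sum_mul_sum,
    Finset.sum_comm (f := fun i j => w i • fermi r 1 i * v j • fermi r 1 j),
    ← Finset.sum_add_distrib]
  refine Finset.sum_eq_zero fun i _ => ?_
  rw [← Finset.sum_add_distrib]
  refine Finset.sum_eq_zero fun j _ => ?_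
  rw [smul_mul_smul_comm, smul_mul_smul_comm, mul_comm (w j), ← smul_add]
  by_cases h : i = j
  · rw [h, fermi_mul_fermi_self, add_zero, smul_zero]
  · rw [fermi_anticomm hr h, smul_zero]

theorem create_mul_self (hr : Function.Injective r) (v : ι → ℂ) :
    create r v * create r v = 0 := by
  have h := create_mul_create_add hr v v
  rwa [← two_smul ℂ, smul_eq_zero_iff_right two_ne_zero] at h

/-- The anticommutator of `create r v` with its adjoint is ‖v‖² times the identity. Taken in the
state `φ`, it says that the squared norms of the two images of `φ` add up to ‖v‖² ‖φ‖². -/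
theorem opNorm_create_sq_le (hr : Function.Injective r) (v : ι → ℂ) :
    ‖create r v‖ ^ 2 ≤ ∑ j, ‖v j‖ ^ 2 := by
  have hv : star v ⬝ᵥ v = ((∑ j, ‖v j‖ ^ 2 : ℝ) : ℂ) := by
    rw [dotProduct, Complex.ofReal_sum]
    refine Finset.sum_congr rfl fun j _ => ?_
    rw [Pi.star_apply, Complex.star_def, Complex.conj_mul']
    push_cast; rfl
  have hns : ∀ (A : Matrix (ι → Fin 2) (ι → Fin 2) ℂ) (φ : (ι → Fin 2) → ℂ),
      ((∑ x, ‖(A *ᵥ φ) x‖ ^ 2 : ℝ) : ℂ) = star φ ⬝ᵥ ((Aᴴ * A) *ᵥ φ) := by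
    intro A φ
    rw [← mulVec_mulVec, dotProduct_mulVec, ← star_mulVec, dotProduct, Complex.ofReal_sum]
    refine Finset.sum_congr rfl fun j _ => ?_
    rw [Pi.star_apply, Complex.star_def, Complex.conj_mul']
    push_cast; rfl
  have h0 : 0 ≤ ∑ j, ‖v j‖ ^ 2 := Finset.sum_nonneg fun _ _ => by positivity
  have key : ‖create r v‖ ≤ √(∑ j, ‖v j‖ ^ 2) := by
    refine opNorm_le_of_sum_norm_sq_le _ (Real.sqrt_nonneg _) fun φ => ?_
    rw [Real.sq_sqrt h0]
    have e1 := hns (create r v) φ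
    have e2 := hns (create r v)ᴴ φ
    have e3 := hns 1 φ
    rw [conjTranspose_one, Matrix.one_mul, one_mulVec] at e3
    rw [conjTranspose_conjTranspose] at e2
    have e4 : ∑ x, ‖(create r v *ᵥ φ) x‖ ^ 2 + ∑ x, ‖((create r v)ᴴ *ᵥ φ) x‖ ^ 2
        = (∑ j, ‖v j‖ ^ 2) * ∑ x, ‖φ x‖ ^ 2 := by
      have : ((∑ x, ‖(create r v *ᵥ φ) x‖ ^ 2 + ∑ x, ‖((create r v)ᴴ *ᵥ φ) x‖ ^ 2 : ℝ) : ℂ)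
        = (((∑ j, ‖v j‖ ^ 2) * ∑ x, ‖φ x‖ ^ 2 : ℝ) : ℂ) := by
        rw [Complex.ofReal_add, Complex.ofReal_mul, e1, e2, e3, ← dotProduct_add, ← add_mulVec,
          create_anticomm_conjTranspose hr, hv, smul_mulVec, one_mulVec, dotProduct_smul, smul_eq_mul]
      exact_mod_cast this
    have e5 : 0 ≤ ∑ x, ‖((create r v)ᴴ *ᵥ φ) x‖ ^ 2 := Finset.sum_nonneg fun _ _ => by positivity
    linarith
  calc ‖create r v‖ ^ 2 ≤ √(∑ j, ‖v j‖ ^ 2) ^ 2 := by gcongr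
    _ = _ := Real.sq_sqrt h0

/-- The matrices `fermi` are real, so transposition is the adjoint up to conjugating the
coefficients. Transposes arise because outside operators act from the right. -/
theorem create_transpose (v : ι → ℂ) : (create r v)ᵀ = (create r (star v))ᴴ := by
  rw [create_conjTranspose, create_apply, transpose_sum]
  refine Finset.sum_congr rfl fun j _ => ?_
  have h : (fermi r 1 j)ᵀ = (fermi r 1 j)ᴴ := by
    ext x y
    rw [transpose_apply, conjTranspose_apply, fermi, of_apply]
    split_ifs
    · rw [star_jwSign]
    · rw [star_zero]
  rw [transpose_smul, h, fermi_conjTranspose]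
  simp

variable (ι) in
/-- The state without particles. -/
def vacuum : (ι → Fin 2) → ℂ := Pi.single 0 1

theorem fermi_zero_mulVec_vacuum (j : ι) : fermi r 0 j *ᵥ vacuum ι = 0 := by
  funext x
  rw [fermi_mulVec, vacuum, Pi.single_eq_of_ne, mul_zero, ite_self, Pi.zero_apply]
  intro h
  have := congrFun h j
  simp at this

theorem create_conjTranspose_mulVec_vacuum (v : ι → ℂ) :
    (create r v)ᴴ *ᵥ vacuum ι = 0 := by
  rw [create_conjTranspose, sum_mulVec]
  refine Finset.sum_eq_zero fun j _ => ?_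
  rw [smul_mulVec, fermi_zero_mulVec_vacuum, smul_zero]

end JordanWigner

/-! ### Fermionic operators across the cut. -/

section Bipartition

variable {L : Type} [Fintype L] [DecidableEq L] {r : L → ℕ} {I : Finset L}

/-- The parity of the number of particles, as a diagonal matrix. -/
noncomputable def parity (ι : Type) [Fintype ι] [DecidableEq ι] :
    Matrix (ι → Fin 2) (ι → Fin 2) ℂ :=
  diagonal fun x => ∏ i, if x i = 1 then -1 else 1

theorem parity_conjTranspose (ι : Type) [Fintype ι] [DecidableEq ι] :
    (parity ι)ᴴ = parity ι := by
  rw [parity, diagonal_conjTranspose]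
  congr 1
  funext x
  rw [Pi.star_apply, star_prod]
  refine Finset.prod_congr rfl fun i _ => ?_
  split_ifs <;> simp

theorem parity_mul_self (ι : Type) [Fintype ι] [DecidableEq ι] : parity ι * parity ι = 1 := by
  rw [parity, diagonal_mul_diagonal, ← diagonal_one]
  congr 1
  funext x
  rw [← Finset.prod_mul_distrib]
  refine Finset.prod_eq_one fun i _ => ?_
  split_ifs <;> simp

theorem opNorm_parity_le_one (ι : Type) [Fintype ι] [DecidableEq ι] : ‖parity ι‖ ≤ 1 := by
  have h := l2_opNorm_conjTranspose_mul_self (parity ι)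
  rw [parity_conjTranspose, parity_mul_self] at h
  have h3 : ‖(1 : Matrix (ι → Fin 2) (ι → Fin 2) ℂ)‖ ≤ 1 :=
    opNorm_le_of_sum_norm_sq_le _ zero_le_one fun v => by simp
  nlinarith [norm_nonneg (parity ι)]

theorem parity_mul_fermi {ι : Type} [Fintype ι] [DecidableEq ι] (r : ι → ℕ) (b : Fin 2) (j : ι) :
    parity ι * fermi r b j = -(fermi r b j * parity ι) := by
  ext x y
  rw [parity, diagonal_mul, neg_apply, mul_diagonal, fermi, of_apply]
  by_cases h : FlipAt b j x y
  · rw [if_pos h]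
    have e : (∏ i, if y i = 1 then (-1 : ℂ) else 1) = -∏ i, if x i = 1 then (-1 : ℂ) else 1 := by
      rw [← Finset.mul_prod_erase _ _ (Finset.mem_univ j),
        ← Finset.mul_prod_erase _ _ (Finset.mem_univ j), ← neg_mul]
      congr 1
      · rw [h.1, h.2.1]
        rcases Fin.exists_fin_two.1 ⟨b, rfl⟩ with h0 | h0 <;> simp [h0]
      · refine Finset.prod_congr rfl fun k hk => ?_
        rw [h.2.2 k (Finset.ne_of_mem_erase hk)]
    rw [e]
    ring
  · simp [if_neg h]

theorem parity_mul_create_conjTranspose {ι : Type} [Fintype ι] [DecidableEq ι] (r : ι → ℕ)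
    (v : ι → ℂ) : parity ι * (create r v)ᴴ = -((create r v)ᴴ * parity ι) := by
  rw [create_conjTranspose, Finset.mul_sum, Finset.sum_mul, ← Finset.sum_neg_distrib]
  refine Finset.sum_congr rfl fun j _ => ?_
  rw [Matrix.mul_smul, Matrix.smul_mul, parity_mul_fermi, smul_neg]

theorem flipAt_split_of_mem {b : Fin 2} {j : L} (hj : j ∈ I) (a a' : ConfigIn (fun _ : L => 2) I)
    (o o' : ConfigOut (fun _ : L => 2) I) :
    FlipAt b j ((split (fun _ : L => 2) I).symm (a, o)) ((split (fun _ : L => 2) I).symm (a', o')) ↔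
      FlipAt b (⟨j, hj⟩ : {j // j ∈ I}) a a' ∧ o = o' := by
  constructor
  · rintro ⟨h1, h2, h3⟩
    rw [split_symm_of_mem _ _ hj] at h1 h2
    refine ⟨⟨h1, h2, fun i hi => ?_⟩, funext fun i => ?_⟩
    · have := h3 i.1 (fun h => hi (Subtype.ext h))
      rwa [split_symm_of_mem _ _ i.2, split_symm_of_mem _ _ i.2] at this
    · have := h3 i.1 (fun h => i.2 (h ▸ hj))
      rwa [split_symm_of_notMem _ _ i.2, split_symm_of_notMem _ _ i.2] at this
  · rintro ⟨⟨h1, h2, h3⟩, rfl⟩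
    refine ⟨?_, ?_, fun i hi => ?_⟩
    · rw [split_symm_of_mem _ _ hj]; exact h1
    · rw [split_symm_of_mem _ _ hj]; exact h2
    · by_cases h : i ∈ I
      · rw [split_symm_of_mem _ _ h, split_symm_of_mem _ _ h]
        exact h3 ⟨i, h⟩ (fun e => hi (congrArg Subtype.val e))
      · rw [split_symm_of_notMem _ _ h, split_symm_of_notMem _ _ h]

theorem flipAt_split_of_notMem {b : Fin 2} {j : L} (hj : j ∉ I)
    (a a' : ConfigIn (fun _ : L => 2) I) (o o' : ConfigOut (fun _ : L => 2) I) :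
    FlipAt b j ((split (fun _ : L => 2) I).symm (a, o)) ((split (fun _ : L => 2) I).symm (a', o')) ↔
      FlipAt b (⟨j, hj⟩ : {j // j ∉ I}) o o' ∧ a = a' := by
  constructor
  · rintro ⟨h1, h2, h3⟩
    rw [split_symm_of_notMem _ _ hj] at h1 h2
    refine ⟨⟨h1, h2, fun i hi => ?_⟩, funext fun i => ?_⟩
    · have := h3 i.1 (fun h => hi (Subtype.ext h))
      rwa [split_symm_of_notMem _ _ i.2, split_symm_of_notMem _ _ i.2] at this
    · have := h3 i.1 (fun h => hj (h ▸ i.2))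
      rwa [split_symm_of_mem _ _ i.2, split_symm_of_mem _ _ i.2] at this
  · rintro ⟨⟨h1, h2, h3⟩, rfl⟩
    refine ⟨?_, ?_, fun i hi => ?_⟩
    · rw [split_symm_of_notMem _ _ hj]; exact h1
    · rw [split_symm_of_notMem _ _ hj]; exact h2
    · by_cases h : i ∈ I
      · rw [split_symm_of_mem _ _ h, split_symm_of_mem _ _ h]
      · rw [split_symm_of_notMem _ _ h, split_symm_of_notMem _ _ h]
        exact h3 ⟨i, h⟩ (fun e => hi (congrArg Subtype.val e))

theorem jwSign_split (j : L) (a : ConfigIn (fun _ : L => 2) I)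
    (o : ConfigOut (fun _ : L => 2) I) :
    jwSign r j ((split (fun _ : L => 2) I).symm (a, o)) =
      (∏ i : {j // j ∈ I}, if r i.1 < r j ∧ a i = 1 then -1 else 1) *
        ∏ i : {j // j ∉ I}, if r i.1 < r j ∧ o i = 1 then -1 else 1 := by
  rw [jwSign, ← Finset.prod_mul_prod_compl I,
    Finset.prod_subtype I (p := (· ∈ I)) (fun _ => Iff.rfl),
    Finset.prod_subtype Iᶜ (p := (· ∉ I)) (fun _ => Finset.mem_compl)]
  refine congrArg₂ (· * ·) (Finset.prod_congr rfl fun j _ => ?_)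
    (Finset.prod_congr rfl fun j _ => ?_)
  · rw [split_symm_of_mem _ _ j.2]
  · rw [split_symm_of_notMem _ _ j.2]

theorem reshape_fermi_mulVec_of_mem (hI : ∀ i ∈ I, ∀ j, j ∉ I → r i < r j) (b : Fin 2) {j : L}
    (hj : j ∈ I) (ψ : Config (fun _ : L => 2) → ℂ) :
    reshape I (fermi r b j *ᵥ ψ) =
      fermi (fun i : {j // j ∈ I} => r i.1) b ⟨j, hj⟩ * reshape I ψ := by
  ext a o
  rw [reshape_mulVec_apply, Matrix.mul_apply]
  refine Finset.sum_congr rfl fun a' _ => ?_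
  rw [Finset.sum_eq_single o]
  · congr 1
    rw [fermi, fermi, of_apply, of_apply]
    have h1 := flipAt_split_of_mem (b := b) hj a a' o o
    have h2 : jwSign r j ((split (fun _ : L => 2) I).symm (a, o)) =
        jwSign (fun i : {j // j ∈ I} => r i.1) ⟨j, hj⟩ a := by
      rw [jwSign_split, jwSign]
      refine (congrArg _ (Finset.prod_eq_one fun i _ => ?_)).trans (mul_one _)
      rw [if_neg]
      exact fun h => lt_asymm h.1 (hI j hj i.1 i.2)
    by_cases h : FlipAt b (⟨j, hj⟩ : {j // j ∈ I}) a a'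
    · rw [if_pos (h1.2 ⟨h, rfl⟩), if_pos h, h2]
    · rw [if_neg (fun h' => h (h1.1 h').1), if_neg h]
  · intro o' _ ho
    rw [fermi, of_apply, if_neg, zero_mul]
    exact fun h => ho ((flipAt_split_of_mem hj a a' o o').1 h).2.symm
  · simp

/-- All of `I` ranks below `j`, so the sign string of `j` contains the full parity of `I`, followed
by the string within the complement. -/
theorem reshape_fermi_mulVec_of_notMem (hI : ∀ i ∈ I, ∀ j, j ∉ I → r i < r j) (b : Fin 2) {j : L}
    (hj : j ∉ I) (ψ : Config (fun _ : L => 2) → ℂ) :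
    reshape I (fermi r b j *ᵥ ψ) = parity {j // j ∈ I} * reshape I ψ *
      (fermi (fun i : {j // j ∉ I} => r i.1) b ⟨j, hj⟩)ᵀ := by
  ext a o
  rw [reshape_mulVec_apply, Matrix.mul_apply, Finset.sum_eq_single a]
  · refine Finset.sum_congr rfl fun o' _ => ?_
    rw [parity, diagonal_mul, transpose_apply, fermi, fermi, of_apply, of_apply]
    have h1 := flipAt_split_of_notMem (b := b) hj a a o o'
    have h2 : jwSign r j ((split (fun _ : L => 2) I).symm (a, o)) =
        (∏ i, if a i = 1 then -1 else 1) *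
          jwSign (fun i : {j // j ∉ I} => r i.1) ⟨j, hj⟩ o := by
      rw [jwSign_split, jwSign]
      refine congrArg (· * _) (Finset.prod_congr rfl fun i _ => ?_)
      simp only [hI i.1 i.2 j hj, true_and]
    by_cases h : FlipAt b (⟨j, hj⟩ : {j // j ∉ I}) o o'
    · rw [if_pos (h1.2 ⟨h, rfl⟩), if_pos h, h2]
      ring
    · rw [if_neg (fun h' => h (h1.1 h').1), if_neg h]
      ring
  · intro a' _ ha
    refine Finset.sum_eq_zero fun o' _ => ?_
    rw [fermi, of_apply, if_neg, zero_mul]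
    exact fun h => ha ((flipAt_split_of_notMem hj a a' o o').1 h).2.symm
  · simp

theorem sum_eq_sum_subtype_add {M : Type*} [AddCommMonoid M] (I : Finset L) (f : L → M) :
    ∑ j, f j = ∑ j : {j // j ∈ I}, f j.1 + ∑ j : {j // j ∉ I}, f j.1 := by
  rw [← Finset.sum_add_sum_compl I, Finset.sum_subtype I (p := (· ∈ I)) (fun _ => Iff.rfl),
    Finset.sum_subtype Iᶜ (p := (· ∉ I)) (fun _ => Finset.mem_compl)]

theorem reshape_sum_fermi_mulVec (hI : ∀ i ∈ I, ∀ j, j ∉ I → r i < r j) (b : Fin 2) (v : L → ℂ)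
    (ψ : Config (fun _ : L => 2) → ℂ) :
    reshape I ((∑ j, v j • fermi r b j) *ᵥ ψ) =
      (∑ j : {j // j ∈ I}, v j.1 • fermi (fun i : {j // j ∈ I} => r i.1) b j) * reshape I ψ +
      parity {j // j ∈ I} * reshape I ψ *
        (∑ j : {j // j ∉ I}, v j.1 • fermi (fun i : {j // j ∉ I} => r i.1) b j)ᵀ := by
  rw [sum_mulVec, map_sum, sum_eq_sum_subtype_add I, Matrix.sum_mul, transpose_sum, Matrix.mul_sum]
  refine congrArg₂ (· + ·) (Finset.sum_congr rfl fun j _ => ?_) (Finset.sum_congr rfl fun j _ => ?_)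
  · rw [smul_mulVec, map_smul, reshape_fermi_mulVec_of_mem hI b j.2, Matrix.smul_mul]
  · rw [smul_mulVec, map_smul, reshape_fermi_mulVec_of_notMem hI b j.2, transpose_smul,
      Matrix.mul_smul]

theorem reshape_create_mulVec (hI : ∀ i ∈ I, ∀ j, j ∉ I → r i < r j) (v : L → ℂ)
    (ψ : Config (fun _ : L => 2) → ℂ) :
    reshape I (create r v *ᵥ ψ) =
      create (fun i : {j // j ∈ I} => r i.1) (fun j => v j.1) * reshape I ψ +
      parity {j // j ∈ I} * reshape I ψ *
        (create (fun i : {j // j ∉ I} => r i.1) (fun j => v j.1))ᵀ :=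
  reshape_sum_fermi_mulVec hI 1 v ψ

theorem reshape_create_conjTranspose_mulVec (hI : ∀ i ∈ I, ∀ j, j ∉ I → r i < r j) (v : L → ℂ)
    (ψ : Config (fun _ : L => 2) → ℂ) :
    reshape I ((create r v)ᴴ *ᵥ ψ) =
      (create (fun i : {j // j ∈ I} => r i.1) (fun j => v j.1))ᴴ * reshape I ψ +
      parity {j // j ∈ I} * reshape I ψ *
        ((create (fun i : {j // j ∉ I} => r i.1) (fun j => v j.1))ᴴ)ᵀ := by
  rw [create_conjTranspose, create_conjTranspose, create_conjTranspose]
  exact reshape_sum_fermi_mulVec hI 0 (fun j => star (v j)) ψ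

/-- With orthogonal ranges and orthogonal coranges, `Xᴴ * X` and `Yᴴ * Y` annihilate each other, so
powers of their sum split. The triangle inequality then loses only a factor 2, which is negligible
for high powers, while the norm of a self-adjoint matrix passes through the powers 2 ^ k exactly. -/
theorem opNorm_add_le_of_orthogonal {m n : Type*} [Fintype m] [Fintype n] [DecidableEq m]
    [DecidableEq n] {X Y : Matrix m n ℂ} {c : ℝ} (h1 : Xᴴ * Y = 0) (h2 : X * Yᴴ = 0)
    (hX : ‖X‖ ≤ c) (hY : ‖Y‖ ≤ c) : ‖X + Y‖ ≤ c := by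
  have h3 : Yᴴ * X = 0 := by
    have := congrArg conjTranspose h1
    simpa using this
  have h4 : (X + Y)ᴴ * (X + Y) = Xᴴ * X + Yᴴ * Y := by
    rw [conjTranspose_add, Matrix.add_mul, Matrix.mul_add, Matrix.mul_add, h1, h3, add_zero,
      zero_add]
  have h5 : (Xᴴ * X) * (Yᴴ * Y) = 0 := by
    rw [Matrix.mul_assoc, ← Matrix.mul_assoc X, h2, Matrix.zero_mul, Matrix.mul_zero]
  have h6 : (Yᴴ * Y) * (Xᴴ * X) = 0 := by
    have := congrArg conjTranspose h5
    simpa [Matrix.mul_assoc] using this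
  have hc : 0 ≤ c := (norm_nonneg _).trans hX
  have hpow : ∀ k : ℕ, (Xᴴ * X + Yᴴ * Y) ^ (k + 1) = (Xᴴ * X) ^ (k + 1) + (Yᴴ * Y) ^ (k + 1) := by
    intro k
    induction k with
    | zero => simp
    | succ k ih =>
      rw [pow_succ, ih, add_mul, mul_add, mul_add, pow_succ (Xᴴ * X) k, pow_succ (Yᴴ * Y) k,
        mul_assoc _ (Xᴴ * X) (Yᴴ * Y), h5, mul_assoc _ (Yᴴ * Y) (Xᴴ * X), h6]
      simp [pow_succ]
  have hsq : ∀ Z : Matrix m n ℂ, ‖Zᴴ * Z‖ = ‖Z‖ ^ 2 := fun Z => by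
    rw [l2_opNorm_conjTranspose_mul_self, sq]
  have hself : IsSelfAdjoint (Xᴴ * X + Yᴴ * Y) := by
    rw [← h4]; exact (isHermitian_conjTranspose_mul_self _)
  have hb : ∀ k : ℕ, (‖X + Y‖ ^ 2) ^ (2 ^ k) ≤ 2 * (c ^ 2) ^ (2 ^ k) := by
    intro k
    have hn : ‖(Xᴴ * X + Yᴴ * Y) ^ (2 ^ k)‖ = (‖X + Y‖ ^ 2) ^ (2 ^ k) := by
      rw [← hsq, h4]
      have := hself.nnnorm_pow_two_pow k
      exact congrArg NNReal.toReal this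
    obtain ⟨l, hl⟩ : ∃ l, 2 ^ k = l + 1 := ⟨2 ^ k - 1, by have := Nat.one_le_two_pow (n := k); omega⟩
    rw [← hn, hl, hpow]
    have hz : ∀ Z : Matrix m n ℂ, ‖Z‖ ≤ c → ‖(Zᴴ * Z) ^ (l + 1)‖ ≤ (c ^ 2) ^ (l + 1) := by
      intro Z hZ
      refine (norm_pow_le' _ (Nat.succ_pos l)).trans ?_
      rw [hsq]
      gcongr
    refine (norm_add_le _ _).trans ?_
    linarith [hz X hX, hz Y hY]
  by_contra! hlt
  have hpos : 0 < ‖X + Y‖ := hc.trans_lt hlt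
  have hsqlt : c ^ 2 < ‖X + Y‖ ^ 2 := by gcongr
  rcases hc.eq_or_lt with h0 | h0
  · have := hb 0
    rw [← h0] at this
    norm_num at this
    rw [← h0] at hlt
    exact hpos.ne' (by rw [this, norm_zero])
  · have h1 : 1 < ‖X + Y‖ ^ 2 / c ^ 2 := by rw [one_lt_div (by positivity)]; exact hsqlt
    obtain ⟨k, hk⟩ := pow_unbounded_of_one_lt 2 h1
    have h7 : (‖X + Y‖ ^ 2 / c ^ 2) ^ (2 ^ k) ≤ 2 := by
      rw [div_pow, div_le_iff₀ (by positivity)]; exact hb k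
    have h8 : (‖X + Y‖ ^ 2 / c ^ 2) ^ k ≤ (‖X + Y‖ ^ 2 / c ^ 2) ^ (2 ^ k) :=
      pow_le_pow_right₀ h1.le Nat.lt_two_pow_self.le
    linarith

/-- Adding a particle in an orbital whose parts in `I` and outside `I` are both empty. -/
theorem opNorm_reshape_create_mulVec_le (hr : Function.Injective r)
    (hI : ∀ i ∈ I, ∀ j, j ∉ I → r i < r j) (v : L → ℂ) (ψ : Config (fun _ : L => 2) → ℂ)
    (h1 : (create r (fun j => if j ∈ I then v j else 0))ᴴ *ᵥ ψ = 0)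
    (h2 : (create r (fun j => if j ∈ I then 0 else v j))ᴴ *ᵥ ψ = 0) {c : ℝ} (hc : 0 ≤ c)
    (hin : ∑ j ∈ I, ‖v j‖ ^ 2 ≤ c ^ 2) (hout : ∑ j ∈ Iᶜ, ‖v j‖ ^ 2 ≤ c ^ 2) :
    ‖reshape I (create r v *ᵥ ψ)‖ ≤ c * ‖reshape I ψ‖ := by
  have hrI : Function.Injective (fun i : {j // j ∈ I} => r i.1) :=
    hr.comp Subtype.val_injective
  have hrO : Function.Injective (fun i : {j // j ∉ I} => r i.1) :=
    hr.comp Subtype.val_injective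
  set A := create (fun i : {j // j ∈ I} => r i.1) (fun j => v j.1) with hA
  set B := create (fun i : {j // j ∉ I} => r i.1) (fun j => v j.1) with hB
  set M := reshape I ψ with hM
  set Z := parity {j // j ∈ I} with hZ
  -- Restricting the orbital to `I` kills the outer summand, so the hypothesis becomes an equation
  -- on the inner side; `hMB` is the mirror image.
  have hAM : Aᴴ * M = 0 := by
    have e := reshape_create_conjTranspose_mulVec hI (fun j => if j ∈ I then v j else 0) ψ
    rw [h1, map_zero] at e
    have e1 : (fun j : {j // j ∈ I} => if j.1 ∈ I then v j.1 else 0) = fun j => v j.1 :=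
      funext fun j => if_pos j.2
    have e2 : (fun j : {j // j ∉ I} => if j.1 ∈ I then v j.1 else 0) = 0 :=
      funext fun j => if_neg j.2
    rw [e1, e2, map_zero, conjTranspose_zero, transpose_zero, Matrix.mul_zero, add_zero] at e
    exact e.symm
  have hMB : M * Bᴴᵀ = 0 := by
    have e := reshape_create_conjTranspose_mulVec hI (fun j => if j ∈ I then 0 else v j) ψ
    rw [h2, map_zero] at e
    have e1 : (fun j : {j // j ∈ I} => if j.1 ∈ I then 0 else v j.1) = 0 :=
      funext fun j => if_pos j.2
    have e2 : (fun j : {j // j ∉ I} => if j.1 ∈ I then 0 else v j.1) = fun j => v j.1 :=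
      funext fun j => if_neg j.2
    rw [e1, e2, map_zero, conjTranspose_zero, Matrix.zero_mul, zero_add] at e
    have e3 := congrArg (Z * ·) e.symm
    simp only [Matrix.mul_zero] at e3
    rwa [← Matrix.mul_assoc, ← Matrix.mul_assoc, parity_mul_self, Matrix.one_mul] at e3
  rw [reshape_create_mulVec hI]
  refine opNorm_add_le_of_orthogonal ?_ ?_ ?_ ?_
  · have e : Aᴴ * Z = -(Z * Aᴴ) := by rw [parity_mul_create_conjTranspose, neg_neg]
    calc (A * M)ᴴ * (Z * M * Bᵀ) = Mᴴ * (Aᴴ * Z) * M * Bᵀ := by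
          rw [conjTranspose_mul]; simp only [Matrix.mul_assoc]
      _ = -(Mᴴ * Z * (Aᴴ * M) * Bᵀ) := by
          rw [e]; simp only [Matrix.mul_assoc, Matrix.neg_mul, Matrix.mul_neg]
      _ = 0 := by rw [hAM, Matrix.mul_zero, Matrix.zero_mul, neg_zero]
  · have e : Bᵀᴴ = Bᴴᵀ := rfl
    calc A * M * (Z * M * Bᵀ)ᴴ = A * (M * Bᴴᵀ) * (Z * M)ᴴ := by
          rw [conjTranspose_mul, e]; simp only [Matrix.mul_assoc]
      _ = 0 := by rw [hMB, Matrix.mul_zero, Matrix.zero_mul]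
  · have hAn : ‖A‖ ≤ c := by
      refine le_of_sq_le_sq ((opNorm_create_sq_le hrI _).trans ?_) hc
      rwa [← Finset.sum_subtype I (p := (· ∈ I)) (fun _ => Iff.rfl) (fun j => ‖v j‖ ^ 2)]
    refine (l2_opNorm_mul _ _).trans ?_
    gcongr
  · have hBn : ‖Bᵀ‖ ≤ c := by
      rw [hB, create_transpose, l2_opNorm_conjTranspose]
      refine le_of_sq_le_sq ((opNorm_create_sq_le hrO _).trans ?_) hc
      simp only [Pi.star_apply, norm_star]
      rwa [← Finset.sum_subtype Iᶜ (p := (· ∉ I)) (fun _ => Finset.mem_compl)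
        (fun j => ‖v j‖ ^ 2)]
    refine (l2_opNorm_mul _ _).trans ?_
    rw [mul_comm]
    refine mul_le_mul hBn ?_ (norm_nonneg _) hc
    refine (l2_opNorm_mul _ _).trans ?_
    exact mul_le_of_le_one_left (norm_nonneg _) (opNorm_parity_le_one _)

end Bipartition

/-! ### Slater determinants and their free evolution. -/

section Slater

variable {ι : Type} [Fintype ι] [DecidableEq ι] {r : ι → ℕ}

/-- The state with particles in the orbitals `v 0, …, v (n - 1)`. -/
noncomputable def slater (hr : Function.Injective r) (n : ℕ) :
    (ι → ℂ) [⋀^Fin n]→ₗ[ℂ] ((ι → Fin 2) → ℂ) :=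
  ((LinearMap.flip (mulVecBilin ℂ ℂ) (vacuum ι)).comp
    (ExteriorAlgebra.lift ℂ ⟨create r, create_mul_self hr⟩).toLinearMap).compAlternatingMap
      (ExteriorAlgebra.ιMulti ℂ n)

theorem slater_zero (hr : Function.Injective r) (v : Fin 0 → ι → ℂ) :
    slater hr 0 v = vacuum ι := by
  change (ExteriorAlgebra.lift ℂ ⟨create r, create_mul_self hr⟩ (ExteriorAlgebra.ιMulti ℂ 0 v))
    *ᵥ vacuum ι = _
  rw [ExteriorAlgebra.ιMulti_zero_apply, map_one, one_mulVec]

theorem slater_succ (hr : Function.Injective r) (n : ℕ) (v : Fin (n + 1) → ι → ℂ) :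
    slater hr (n + 1) v = create r (v 0) *ᵥ slater hr n (fun k => v k.succ) := by
  change (ExteriorAlgebra.lift ℂ ⟨create r, create_mul_self hr⟩
    (ExteriorAlgebra.ιMulti ℂ (n + 1) v)) *ᵥ vacuum ι = create r (v 0) *ᵥ
      ((ExteriorAlgebra.lift ℂ ⟨create r, create_mul_self hr⟩
        (ExteriorAlgebra.ιMulti ℂ n fun k => v k.succ)) *ᵥ vacuum ι)
  rw [ExteriorAlgebra.ιMulti_succ_apply, map_mul, ExteriorAlgebra.lift_ι_apply, mulVec_mulVec]
  rfl

/-- The orbitals enter through the exterior algebra, so the state is alternating in them and a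
change of orbitals within their span gives a determinant. -/
theorem slater_linearCombination (hr : Function.Injective r) {n : ℕ} (u : Fin n → ι → ℂ)
    (W : Matrix (Fin n) (Fin n) ℂ) :
    slater hr n (fun k => ∑ l, W k l • u l) = W.det • slater hr n u := by
  funext x
  let T : (Fin n → ℂ) →ₗ[ℂ] (ι → ℂ) := Fintype.linearCombination ℂ u
  let g : (Fin n → ℂ) [⋀^Fin n]→ₗ[ℂ] ℂ :=
    (LinearMap.proj x).compAlternatingMap ((slater hr n).compLinearMap T)
  have h : g W = g (Pi.basisFun ℂ (Fin n)) * (Pi.basisFun ℂ (Fin n)).det W :=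
    congrArg (fun f => f W) (g.eq_smul_basis_det (Pi.basisFun ℂ (Fin n)))
  have h1 : g W = slater hr n (fun k => ∑ l, W k l • u l) x := rfl
  have h2 : g (Pi.basisFun ℂ (Fin n)) = slater hr n u x := by
    have : (fun k => T (Pi.basisFun ℂ (Fin n) k)) = u := by
      funext k
      simp [T, Fintype.linearCombination_apply, Pi.single_apply]
    change slater hr n (fun k => T (Pi.basisFun ℂ (Fin n) k)) x = _
    rw [this]
  have h3 : (Pi.basisFun ℂ (Fin n)).det W = W.det := by
    rw [Pi.basisFun_det]; rfl
  rw [h1, h2, h3] at h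
  rw [h, Pi.smul_apply, smul_eq_mul, mul_comm]

/-- The annihilator anticommutes with the creators of all orbitals orthogonal to it and so reaches
the vacuum. -/
theorem create_conjTranspose_mulVec_slater (hr : Function.Injective r) (w : ι → ℂ) {n : ℕ}
    (v : Fin n → ι → ℂ) (h : ∀ k, star w ⬝ᵥ v k = 0) :
    (create r w)ᴴ *ᵥ slater hr n v = 0 := by
  induction n with
  | zero => rw [slater_zero, create_conjTranspose_mulVec_vacuum]
  | succ n ih =>
    have e := create_anticomm_conjTranspose hr w (v 0)
    rw [h 0, zero_smul, add_eq_zero_iff_eq_neg] at e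
    rw [slater_succ, mulVec_mulVec, e, neg_mulVec, ← mulVec_mulVec, ih _ fun k => h k.succ,
      mulVec_zero, neg_zero]

theorem opNorm_reshape_vacuum_le {L : Type} [Fintype L] [DecidableEq L] (I : Finset L) :
    ‖reshape (d := fun _ : L => 2) I (vacuum L)‖ ≤ 1 := by
  have key : ∀ a o, reshape (d := fun _ : L => 2) I (vacuum L) a o ≠ 0 →
      (split (fun _ : L => 2) I).symm (a, o) = 0 := by
    intro a o h
    by_contra hc
    exact h (Pi.single_eq_of_ne (M := fun _ : L → Fin 2 => ℂ) (i := 0) hc 1)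
  refine opNorm_le_one_of_partial_injection _ (fun a o => ?_) (fun a o o' h h' => ?_)
    (fun a a' o h h' => ?_)
  · rw [reshape_apply, vacuum]
    by_cases h : (split (fun _ : L => 2) I).symm (a, o) = 0
    · rw [h, Pi.single_eq_same, norm_one]
    · rw [Pi.single_eq_of_ne (M := fun _ : L → Fin 2 => ℂ) (i := 0) h, norm_zero]; exact zero_le_one
  · have := (split (fun _ : L => 2) I).symm.injective ((key _ _ h).trans (key _ _ h').symm)
    exact (Prod.ext_iff.1 this).2
  · have := (split (fun _ : L => 2) I).symm.injective ((key _ _ h).trans (key _ _ h').symm)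
    exact (Prod.ext_iff.1 this).1

/-- Peeling off one orbital at a time: orthogonality on each side separately means that the state of
the remaining orbitals is annihilated by both halves of the one peeled off, so each orbital
contributes one factor. -/
theorem opNorm_reshape_slater_le {L : Type} [Fintype L] [DecidableEq L] {r : L → ℕ}
    (hr : Function.Injective r) {I : Finset L} (hI : ∀ i ∈ I, ∀ j, j ∉ I → r i < r j) {n : ℕ}
    (v : Fin n → L → ℂ) (h1 : ∀ k l, k ≠ l → ∑ j ∈ I, star (v k j) * v l j = 0)
    (h2 : ∀ k l, k ≠ l → ∑ j ∈ Iᶜ, star (v k j) * v l j = 0) (c : Fin n → ℝ) (hc : ∀ k, 0 ≤ c k)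
    (hin : ∀ k, ∑ j ∈ I, ‖v k j‖ ^ 2 ≤ c k ^ 2) (hout : ∀ k, ∑ j ∈ Iᶜ, ‖v k j‖ ^ 2 ≤ c k ^ 2) :
    ‖reshape (d := fun _ : L => 2) I (slater hr n v)‖ ≤ ∏ k, c k := by
  induction n with
  | zero =>
    rw [slater_zero, Finset.univ_eq_empty, Finset.prod_empty]
    exact opNorm_reshape_vacuum_le I
  | succ n ih =>
    rw [slater_succ, Fin.prod_univ_succ]
    refine (opNorm_reshape_create_mulVec_le hr hI _ _ ?_ ?_ (hc 0) (hin 0) (hout 0)).trans ?_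
    · refine create_conjTranspose_mulVec_slater hr _ _ fun k => ?_
      refine Eq.trans ?_ (h1 0 k.succ (Fin.succ_ne_zero k).symm)
      simp [dotProduct, apply_ite star, ite_mul]
    · refine create_conjTranspose_mulVec_slater hr _ _ fun k => ?_
      refine Eq.trans ?_ (h2 0 k.succ (Fin.succ_ne_zero k).symm)
      rw [dotProduct, ← Finset.sum_add_sum_compl I, Finset.sum_eq_zero, zero_add]
      · refine Finset.sum_congr rfl fun j hj => ?_
        rw [Pi.star_apply, if_neg (Finset.mem_compl.1 hj)]
      · intro j hj
        rw [Pi.star_apply, if_pos hj, star_zero, zero_mul]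
    · exact mul_le_mul_of_nonneg_left (ih _ (fun k l hkl => h1 _ _ (by simpa using hkl))
        (fun k l hkl => h2 _ _ (by simpa using hkl)) _ (fun k => hc _) (fun k => hin _)
        (fun k => hout _)) (hc 0)

variable (r) in
/-- The second quantization of the one-particle operator `h`. -/
noncomputable def secondQuantize (h : Matrix ι ι ℂ) : Matrix (ι → Fin 2) (ι → Fin 2) ℂ :=
  ∑ i, ∑ j, h i j • (fermi r 1 i * fermi r 0 j)

theorem fermi_one_eq_create (i : ι) : fermi r 1 i = create r (Pi.single i 1) := by
  simp [create_apply, Pi.single_apply]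

theorem fermi_zero_eq_create_conjTranspose (i : ι) :
    fermi r 0 i = (create r (Pi.single i 1))ᴴ := by
  rw [← fermi_one_eq_create, fermi_conjTranspose, sub_self]

/-- The commutator of the second quantization with a creator is the creator of `h *ᵥ v`; this makes
the many-particle evolution a one-particle problem. -/
theorem secondQuantize_mul_create (hr : Function.Injective r) (h : Matrix ι ι ℂ) (v : ι → ℂ) :
    secondQuantize r h * create r v = create r v * secondQuantize r h + create r (h *ᵥ v) := by
  have e1 : ∀ i j, fermi r 1 i * fermi r 0 j * create r v =
      create r v * (fermi r 1 i * fermi r 0 j) + v j • fermi r 1 i := by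
    intro i j
    have a1 := create_anticomm_conjTranspose hr (Pi.single j 1) v
    have a2 := create_mul_create_add hr (Pi.single i 1) v
    rw [← fermi_zero_eq_create_conjTranspose, ← Pi.single_star, star_one, single_one_dotProduct] at a1
    rw [← fermi_one_eq_create, add_eq_zero_iff_eq_neg] at a2
    rw [mul_assoc, eq_sub_of_add_eq a1, mul_sub, ← mul_assoc, a2, mul_smul_comm, mul_one]
    simp only [neg_mul, mul_assoc]
    abel
  rw [secondQuantize, Finset.sum_mul, Finset.mul_sum, create_apply, ← create_apply,
    create_apply (h *ᵥ v), ← Finset.sum_add_distrib]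
  refine Finset.sum_congr rfl fun i _ => ?_
  rw [Finset.sum_mul, Finset.mul_sum, mulVec, dotProduct, Finset.sum_smul,
    ← Finset.sum_add_distrib]
  refine Finset.sum_congr rfl fun j _ => ?_
  rw [smul_mul_assoc, e1, smul_add, mul_smul_comm, smul_smul]

theorem secondQuantize_mulVec_vacuum (h : Matrix ι ι ℂ) :
    secondQuantize r h *ᵥ vacuum ι = 0 := by
  rw [secondQuantize, sum_mulVec]
  refine Finset.sum_eq_zero fun i _ => ?_
  rw [sum_mulVec]
  refine Finset.sum_eq_zero fun j _ => ?_
  rw [smul_mulVec, ← mulVec_mulVec, fermi_zero_mulVec_vacuum, mulVec_zero, smul_zero]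

theorem exp_mulVec_of_mulVec_eq_zero {n : Type*} [Fintype n] [DecidableEq n] {A : Matrix n n ℂ}
    {v : n → ℂ} (h : A *ᵥ v = 0) (t : ℝ) : NormedSpace.exp ((t : ℂ) • A) *ᵥ v = v := by
  set V : Matrix n Unit ℂ := replicateCol Unit v with hV
  have hAV : A * V = 0 := by
    rw [hV, ← replicateCol_mulVec, h]; rfl
  have hd : ∀ s : ℝ, HasDerivAt (fun s : ℝ => NormedSpace.exp ((s : ℂ) • A) * V) 0 s := by
    intro s
    have h1 := hasDerivAt_matrix_mul (hasDerivAt_exp_ofReal_smul A s) (hasDerivAt_const s V)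
    refine h1.congr_deriv ?_
    have hc : A * NormedSpace.exp ((s : ℂ) • A) = NormedSpace.exp ((s : ℂ) • A) * A :=
      ((Commute.refl A).smul_right (s : ℂ)).exp_right
    rw [hc, Matrix.mul_assoc, hAV, Matrix.mul_zero, add_zero]
  have hcst := is_const_of_deriv_eq_zero (fun s => (hd s).differentiableAt)
    (fun s => (hd s).deriv) t 0
  simp only [Complex.ofReal_zero, zero_smul, NormedSpace.exp_zero, Matrix.one_mul] at hcst
  funext i
  have := congrFun (congrFun hcst i) ()
  simpa [hV, ← replicateCol_mulVec] using this

/-- Conjugating by the many-particle evolution and evolving the orbital backwards compensate each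
other: the combination has zero derivative. -/
theorem exp_secondQuantize_mul_create (hr : Function.Injective r) (h : Matrix ι ι ℂ) (t : ℝ)
    (v : ι → ℂ) :
    NormedSpace.exp ((t : ℂ) • (Complex.I • secondQuantize r h)) * create r v =
      create r (NormedSpace.exp ((t : ℂ) • (Complex.I • h)) *ᵥ v) *
        NormedSpace.exp ((t : ℂ) • (Complex.I • secondQuantize r h)) := by
  set H := secondQuantize r h with hH
  let Φ : Matrix ι ι ℂ →ₗ[ℝ] Matrix (ι → Fin 2) (ι → Fin 2) ℂ :=
    { toFun := fun A => create r (A *ᵥ v)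
      map_add' := fun A B => by rw [add_mulVec, map_add]
      map_smul' := fun c A => by
        rw [smul_mulVec]
        exact map_smul (create r) (c : ℂ) (A *ᵥ v) }
  set X : ℝ → Matrix (ι → Fin 2) (ι → Fin 2) ℂ := fun s =>
    create r (NormedSpace.exp ((s : ℂ) • -(Complex.I • h)) *ᵥ v) with hX
  have hXd : ∀ s : ℝ, HasDerivAt X (-(Complex.I • create r (h *ᵥ
      (NormedSpace.exp ((s : ℂ) • -(Complex.I • h)) *ᵥ v)))) s := by
    intro s
    have h1 := hasDerivAt_exp_ofReal_smul (-(Complex.I • h)) s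
    have h2 := (LinearMap.toContinuousLinearMap Φ).hasFDerivAt.comp_hasDerivAt s h1
    have e : create r ((-(Complex.I • h) * NormedSpace.exp ((s : ℂ) • -(Complex.I • h))) *ᵥ v)
        = -(Complex.I • create r (h *ᵥ
          (NormedSpace.exp ((s : ℂ) • -(Complex.I • h)) *ᵥ v))) := by
      rw [← mulVec_mulVec, neg_mulVec, smul_mulVec, map_neg, map_smul]
    rw [← e]
    exact h2
  have hd : ∀ s : ℝ, HasDerivAt (fun s : ℝ => NormedSpace.exp ((s : ℂ) • (Complex.I • H)) * X s *
      NormedSpace.exp ((s : ℂ) • -(Complex.I • H))) 0 s := by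
    intro s
    have h1 := hasDerivAt_matrix_mul (hasDerivAt_matrix_mul
      (hasDerivAt_exp_ofReal_smul (Complex.I • H) s) (hXd s))
      (hasDerivAt_exp_ofReal_smul (-(Complex.I • H)) s)
    refine h1.congr_deriv ?_
    have hc : Complex.I • H * NormedSpace.exp ((s : ℂ) • (Complex.I • H)) =
        NormedSpace.exp ((s : ℂ) • (Complex.I • H)) * (Complex.I • H) :=
      ((Commute.refl (Complex.I • H)).smul_right (s : ℂ)).exp_right
    have hq : H * X s = X s * H + create r (h *ᵥ
        (NormedSpace.exp ((s : ℂ) • -(Complex.I • h)) *ᵥ v)) :=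
      secondQuantize_mul_create hr h _
    rw [hc, eq_sub_of_add_eq' hq.symm]
    simp only [Matrix.mul_assoc, Matrix.smul_mul, Matrix.mul_smul, Matrix.neg_mul, Matrix.mul_neg,
      Matrix.add_mul, Matrix.sub_mul, Matrix.mul_sub, smul_sub]
    abel
  -- Evaluation at `-t` rather than `t` places the forward exponential on the orbital.
  have hcst := is_const_of_deriv_eq_zero (fun s => (hd s).differentiableAt)
    (fun s => (hd s).deriv) (-t) 0
  simp only [hX, Complex.ofReal_zero, zero_smul, NormedSpace.exp_zero, Matrix.one_mul, one_mulVec,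
    Matrix.mul_one] at hcst
  have hinv := exp_neg_mul_exp (Complex.I • H) (-t)
  rw [neg_neg] at hinv
  have e1 : ∀ {m : Type} [Fintype m] [DecidableEq m] (A : Matrix m m ℂ),
      ((-t : ℝ) : ℂ) • -(Complex.I • A) = (t : ℂ) • (Complex.I • A) := by
    intro m _ _ A
    push_cast
    rw [neg_smul, smul_neg, neg_neg]
  rw [e1, e1] at hcst
  rw [← hcst, ← Matrix.mul_assoc, ← Matrix.mul_assoc, hinv, Matrix.one_mul]

theorem exp_secondQuantize_mulVec_slater (hr : Function.Injective r) (h : Matrix ι ι ℂ) (t : ℝ)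
    {n : ℕ} (v : Fin n → ι → ℂ) :
    NormedSpace.exp ((t : ℂ) • (Complex.I • secondQuantize r h)) *ᵥ slater hr n v =
      slater hr n (fun k => NormedSpace.exp ((t : ℂ) • (Complex.I • h)) *ᵥ v k) := by
  induction n with
  | zero =>
    rw [slater_zero, slater_zero, exp_mulVec_of_mulVec_eq_zero]
    rw [smul_mulVec, secondQuantize_mulVec_vacuum, smul_zero]
  | succ n ih =>
    rw [slater_succ, slater_succ, mulVec_mulVec, exp_secondQuantize_mul_create hr,
      ← mulVec_mulVec, ih]

/-- The creator of lowest rank acts last, so no occupied site is ever below the one being filled and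
all signs are 1. -/
theorem slater_single_eq (hr : Function.Injective r) {n : ℕ} (y : Fin n → ι)
    (hy : StrictMono (r ∘ y)) :
    slater hr n (fun k => Pi.single (y k) 1) =
      Pi.single (fun j => if ∃ k, y k = j then 1 else 0) 1 := by
  classical
  induction n with
  | zero =>
    rw [slater_zero, vacuum]
    congr 1
  | succ n ih =>
    rw [slater_succ, ih (fun k => y k.succ) (fun a b hab => hy (Fin.succ_lt_succ_iff.2 hab)),
      ← fermi_one_eq_create]
    funext x
    rw [fermi_mulVec, sub_self]
    have hne : ∀ k : Fin n, y k.succ ≠ y 0 := by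
      intro k hk
      have := hy (Fin.succ_pos k)
      simp [hk] at this
    have hS : (fun j => if ∃ k, y k = j then (1 : Fin 2) else 0) =
        Function.update (fun j => if ∃ k : Fin n, y k.succ = j then (1 : Fin 2) else 0) (y 0) 1 := by
      funext j
      by_cases hj : j = y 0
      · subst hj; simp
      · rw [Function.update_of_ne hj]
        simp only [Fin.exists_fin_succ, Ne.symm hj, false_or]
    by_cases hx : x = fun j => if ∃ k, y k = j then (1 : Fin 2) else 0
    · have hx0 : x (y 0) = 1 := by rw [hx]; simp
      have hup : Function.update x (y 0) 0 =
          fun j => if ∃ k : Fin n, y k.succ = j then (1 : Fin 2) else 0 := by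
        rw [hx, hS, Function.update_idem]
        refine Function.update_eq_self_iff.2 ?_
        rw [if_neg]
        rintro ⟨k, hk⟩
        exact hne k hk
      rw [if_pos hx0, hup, Pi.single_eq_same, mul_one, ← hx, Pi.single_eq_same]
      refine Finset.prod_eq_one fun i _ => if_neg ?_
      rintro ⟨hi, hxi⟩
      rw [hx] at hxi
      simp only [ite_eq_left_iff, zero_ne_one, imp_false, not_not] at hxi
      obtain ⟨k, rfl⟩ := hxi
      exact absurd hi (not_lt.2 (hy.monotone (Fin.zero_le k)))
    · rw [Pi.single_eq_of_ne hx]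
      split_ifs with h1
      · rw [Pi.single_eq_of_ne, mul_zero]
        intro hu
        refine hx ?_
        rw [hS, ← hu, Function.update_idem]
        exact (Function.update_eq_self_iff.2 h1.symm).symm
      · rfl

theorem isProductState_single {L : Type} [Fintype L] [DecidableEq L] {d : L → ℕ} (x : Config d) :
    IsProductState (Pi.single x 1 : Config d → ℂ) := by
  refine ⟨fun j => Pi.single (x j) 1, fun j => ?_, fun σ => ?_⟩
  · rw [Finset.sum_eq_single (x j)] <;> simp +contextual
  · by_cases h : σ = x
    · subst h; simp
    · obtain ⟨j, hj⟩ := Function.ne_iff.1 h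
      rw [Pi.single_eq_of_ne h, eq_comm]
      exact Finset.prod_eq_zero (Finset.mem_univ j) (Pi.single_eq_of_ne hj 1)

end Slater

/-! ### Entropy of a Slater determinant from its correlation matrix. -/

section SlaterEntropy

variable {L : Type} [Fintype L] [DecidableEq L] {r : L → ℕ}

theorem max_le_exp_neg (ν : ℝ) :
    max ν (1 - ν) ≤ Real.exp (-(ν * (1 - ν))) := by
  have := Real.add_one_le_exp (-(ν * (1 - ν)))
  refine le_trans (max_le ?_ ?_) this <;> nlinarith [sq_nonneg (1 - ν), sq_nonneg ν]

/-- Diagonalizing the overlap matrix of the orbitals on `I` makes them orthogonal on both sides of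
the cut, since the overlaps on the complement are `1 - G`. The product bound on the operator norm
then gives a lower bound through the min-entropy. -/
theorem sum_norm_sq_le_entanglementEntropy_slater (hr : Function.Injective r) {I : Finset L}
    (hI : ∀ i ∈ I, ∀ j, j ∉ I → r i < r j) {n : ℕ} (V : Matrix L (Fin n) ℂ) (hV : Vᴴ * V = 1)
    (hn : ∑ σ, ‖slater hr n (fun k x => V x k) σ‖ ^ 2 = 1) :
    ∑ x ∈ I, ∑ z ∈ Iᶜ, ‖(V * Vᴴ) x z‖ ^ 2 ≤
      entanglementEntropy (d := fun _ => 2) I (slater hr n (fun k x => V x k)) := by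
  classical
  set P : Matrix L L ℂ := diagonal fun x => if x ∈ I then 1 else 0 with hP
  have hPs : Pᴴ = P := by
    rw [hP, diagonal_conjTranspose]
    congr 1
    funext x
    rw [Pi.star_apply]
    split_ifs <;> simp
  have h1P : 1 - P = diagonal fun x => if x ∈ Iᶜ then (1 : ℂ) else 0 := by
    rw [hP, ← diagonal_one, diagonal_sub]
    congr 1
    funext x
    by_cases hx : x ∈ I <;> simp [hx]
  have hsand : ∀ (S : Finset L) (A : Matrix L (Fin n) ℂ) (k l : Fin n),
      (Aᴴ * (diagonal fun x => if x ∈ S then (1 : ℂ) else 0) * A) k l =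
        ∑ j ∈ S, star (A j k) * A j l := by
    intro S A k l
    rw [Matrix.mul_apply]
    simp [mul_diagonal, mul_ite, ite_mul, conjTranspose_apply]
  set G := Vᴴ * P * V with hG
  have hGh : G.IsHermitian := by
    rw [IsHermitian, hG, conjTranspose_mul, conjTranspose_mul, hPs, conjTranspose_conjTranspose,
      Matrix.mul_assoc]
  obtain ⟨E, ν, hE1, hspec⟩ : ∃ (E : Matrix (Fin n) (Fin n) ℂ) (ν : Fin n → ℝ),
      Eᴴ * E = 1 ∧ Eᴴ * G * E = diagonal fun k => (ν k : ℂ) := by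
    obtain ⟨E, hE⟩ : ∃ E : Matrix (Fin n) (Fin n) ℂ,
      E = (hGh.eigenvectorUnitary : Matrix (Fin n) (Fin n) ℂ) := ⟨_, rfl⟩
    have hu : Eᴴ * E = 1 := by
      rw [← star_eq_conjTranspose, hE]; exact Unitary.coe_star_mul_self hGh.eigenvectorUnitary
    refine ⟨E, hGh.eigenvalues, hu, ?_⟩
    have hs := hGh.spectral_theorem
    rw [Unitary.conjStarAlgAut_apply, ← hE, star_eq_conjTranspose] at hs
    calc Eᴴ * G * E = Eᴴ * (E * diagonal (RCLike.ofReal ∘ hGh.eigenvalues) * Eᴴ) * E := by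
          rw [← hs]
      _ = (Eᴴ * E) * diagonal (RCLike.ofReal ∘ hGh.eigenvalues) * (Eᴴ * E) := by
          simp only [Matrix.mul_assoc]
      _ = _ := by
          rw [hu, Matrix.one_mul, Matrix.mul_one]; rfl
  have hE2 : E * Eᴴ = 1 := mul_eq_one_comm.1 hE1
  have hspec2 : Eᴴ * (1 - G) * E = diagonal fun k => ((1 - ν k : ℝ) : ℂ) := by
    rw [Matrix.mul_sub, Matrix.sub_mul, Matrix.mul_one, hE1, hspec, ← diagonal_one, diagonal_sub]
    congr 1
    funext k
    push_cast
    rfl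
  have h1G : 1 - G = Vᴴ * (1 - P) * V := by
    rw [Matrix.mul_sub, Matrix.sub_mul, Matrix.mul_one, hV]
  have hin : ∀ k l, ∑ j ∈ I, star ((V * E) j k) * (V * E) j l =
      if k = l then (ν k : ℂ) else 0 := by
    intro k l
    have e : (V * E)ᴴ * P * (V * E) = diagonal fun k => (ν k : ℂ) := by
      rw [← hspec, hG, conjTranspose_mul]; simp only [Matrix.mul_assoc]
    rw [← hsand, ← hP, e, diagonal_apply]
  have hout : ∀ k l, ∑ j ∈ Iᶜ, star ((V * E) j k) * (V * E) j l =
      if k = l then ((1 - ν k : ℝ) : ℂ) else 0 := by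
    intro k l
    have e : (V * E)ᴴ * (1 - P) * (V * E) = diagonal fun k => ((1 - ν k : ℝ) : ℂ) := by
      rw [← hspec2, h1G, conjTranspose_mul]; simp only [Matrix.mul_assoc]
    rw [← hsand, ← h1P, e, diagonal_apply]
  have hns : ∀ (S : Finset L) (k : Fin n), ∑ j ∈ S, star ((V * E) j k) * (V * E) j k =
      ((∑ j ∈ S, ‖(V * E) j k‖ ^ 2 : ℝ) : ℂ) := by
    intro S k
    rw [Complex.ofReal_sum]
    refine Finset.sum_congr rfl fun j _ => ?_
    rw [Complex.star_def, Complex.conj_mul']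
    push_cast; rfl
  have hν : ∀ k, ∑ j ∈ I, ‖(V * E) j k‖ ^ 2 = ν k := by
    intro k
    have := (hns I k).symm.trans (hin k k)
    rw [if_pos rfl] at this
    exact_mod_cast this
  have hν' : ∀ k, ∑ j ∈ Iᶜ, ‖(V * E) j k‖ ^ 2 = 1 - ν k := by
    intro k
    have := (hns Iᶜ k).symm.trans (hout k k)
    rw [if_pos rfl] at this
    exact_mod_cast this
  have hν0 : ∀ k, 0 ≤ ν k := fun k => by
    rw [← hν]; exact Finset.sum_nonneg fun _ _ => by positivity
  have hν1 : ∀ k, 0 ≤ 1 - ν k := fun k => by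
    rw [← hν']; exact Finset.sum_nonneg fun _ _ => by positivity
  have hmax : ∀ k, 0 ≤ max (ν k) (1 - ν k) := fun k => le_max_of_le_left (hν0 k)
  have hbound := opNorm_reshape_slater_le hr hI (fun k x => (V * E) x k)
    (fun k l hkl => by
      have := hin k l
      rwa [if_neg hkl] at this)
    (fun k l hkl => by
      have := hout k l
      rwa [if_neg hkl] at this)
    (fun k => √(max (ν k) (1 - ν k))) (fun k => Real.sqrt_nonneg _)
    (fun k => by
      rw [Real.sq_sqrt (hmax k)]
      exact (hν k).le.trans (le_max_left _ _))
    (fun k => by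
      rw [Real.sq_sqrt (hmax k)]
      exact (hν' k).le.trans (le_max_right _ _))
  -- The rotation changes the state only by the determinant of a unitary, a phase.
  have hrot : slater hr n (fun k x => (V * E) x k) = Eᵀ.det • slater hr n (fun k x => V x k) := by
    refine Eq.trans ?_ (slater_linearCombination hr (fun k x => V x k) Eᵀ)
    congr 1
    funext k x
    rw [Matrix.mul_apply, Finset.sum_apply]
    refine Finset.sum_congr rfl fun l _ => ?_
    rw [Pi.smul_apply, smul_eq_mul, transpose_apply, mul_comm]
  have hdet : ‖Eᵀ.det‖ = 1 := by
    have := congrArg det hE1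
    rw [det_mul, det_conjTranspose, det_one, Complex.star_def, Complex.conj_mul'] at this
    have h2 : ‖E.det‖ ^ 2 = 1 := by exact_mod_cast this
    rw [det_transpose]
    nlinarith [norm_nonneg E.det]
  rw [hrot, map_smul, norm_smul, hdet, one_mul] at hbound
  set T := ∑ k, ν k * (1 - ν k) with hT
  have hT0 : 0 ≤ T := Finset.sum_nonneg fun k _ => mul_nonneg (hν0 k) (hν1 k)
  have hM : ‖reshape (d := fun _ : L => 2) I (slater hr n (fun k x => V x k))‖ ^ 2 ≤ Real.exp (-T) := by
    calc ‖reshape (d := fun _ : L => 2) I (slater hr n (fun k x => V x k))‖ ^ 2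
        ≤ (∏ k, √(max (ν k) (1 - ν k))) ^ 2 := by gcongr
      _ = ∏ k, max (ν k) (1 - ν k) := by
          rw [← Finset.prod_pow]
          exact Finset.prod_congr rfl fun k _ => Real.sq_sqrt (hmax k)
      _ ≤ ∏ k, Real.exp (-(ν k * (1 - ν k))) :=
          Finset.prod_le_prod (fun k _ => hmax k) fun k _ =>
            max_le_exp_neg (ν k)
      _ = Real.exp (-T) := by rw [← Real.exp_sum, Finset.sum_neg_distrib]
  have hS := neg_logb_le_entanglementEntropy (I := I) hn hM
  rw [Real.logb, Real.log_exp, neg_div, neg_neg] at hS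
  have hlog2 : 0 < Real.log 2 := Real.log_pos (by norm_num)
  have hlog2' : Real.log 2 ≤ 1 := by
    have := Real.log_two_lt_d9; linarith
  -- Passing to base 2 only helps because log 2 ≤ 1.
  have hTS : T ≤ T / Real.log 2 := by
    rw [le_div_iff₀ hlog2]
    exact mul_le_of_le_one_right hT0 hlog2'
  refine le_trans (le_of_eq ?_) (hTS.trans hS)
  have hC : (V * Vᴴ)ᴴ = V * Vᴴ := (isHermitian_mul_conjTranspose_self V).eq
  -- `T` is the trace of `G * (1 - G)`. By cyclicity this is the trace of P C (1 - P) C with C = `V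
  -- * Vᴴ`, the squared Hilbert–Schmidt norm of the block of C across the cut.
  have e1 : ((T : ℝ) : ℂ) = ((∑ x ∈ I, ∑ z ∈ Iᶜ, ‖(V * Vᴴ) x z‖ ^ 2 : ℝ) : ℂ) := by
    calc ((T : ℝ) : ℂ) = ((Eᴴ * G * E) * (Eᴴ * (1 - G) * E)).trace := by
          rw [hspec, hspec2, diagonal_mul_diagonal, trace_diagonal, hT, Complex.ofReal_sum]
          exact Finset.sum_congr rfl fun k _ => Complex.ofReal_mul _ _
      _ = (Eᴴ * (G * (E * Eᴴ) * (1 - G) * E)).trace := by simp only [Matrix.mul_assoc]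
      _ = (G * (1 - G)).trace := by
          rw [hE2, Matrix.mul_one, trace_mul_comm, Matrix.mul_assoc, hE2, Matrix.mul_one]
      _ = (Vᴴ * (P * (V * Vᴴ) * (1 - P) * V)).trace := by
          rw [h1G, hG]; simp only [Matrix.mul_assoc]
      _ = (P * (V * Vᴴ) * ((1 - P) * (V * Vᴴ))).trace := by
          rw [trace_mul_comm]; simp only [Matrix.mul_assoc]
      _ = _ := by
          rw [h1P, trace]
          simp only [diag_apply]
          have e2 : ∀ x, (P * (V * Vᴴ) * ((diagonal fun x => if x ∈ Iᶜ then (1 : ℂ) else 0) *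
              (V * Vᴴ))) x x = if x ∈ I then
                ((∑ z ∈ Iᶜ, ‖(V * Vᴴ) x z‖ ^ 2 : ℝ) : ℂ) else 0 := by
            intro x
            rw [Matrix.mul_apply]
            have e3 : ∀ z, (V * Vᴴ) z x = star ((V * Vᴴ) x z) := by
              intro z
              conv_lhs => rw [← hC]
              rfl
            simp only [hP, diagonal_mul, e3, Complex.star_def]
            by_cases hx : x ∈ I
            · rw [if_pos hx, if_pos hx, Complex.ofReal_sum, ← Finset.sum_subset
                (Finset.subset_univ Iᶜ)]
              · refine Finset.sum_congr rfl fun z hz => ?_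
                rw [if_pos hz, one_mul, one_mul, Complex.mul_conj']
                push_cast; rfl
              · intro z _ hz
                rw [if_neg hz, zero_mul, mul_zero]
            · rw [if_neg hx, if_neg hx]
              simp
          rw [Finset.sum_congr rfl fun x _ => e2 x, Complex.ofReal_sum, Finset.sum_ite_mem,
            Finset.univ_inter]
  exact_mod_cast e1.symm

end SlaterEntropy

/-! ### Nearest-neighbour hopping is a local spin Hamiltonian. -/

section Hopping

variable {L : Type} [Fintype L] [DecidableEq L] {r : L → ℕ}

theorem supportedOn_zero {d : L → ℕ} (X : Finset L) :
    SupportedOn X (0 : Matrix (Config d) (Config d) ℂ) :=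
  supportedOn_iff.2 ⟨0, fun x y => by simp⟩

theorem SupportedOn.add {d : L → ℕ} {X : Finset L} {A B : Matrix (Config d) (Config d) ℂ}
    (hA : SupportedOn X A) (hB : SupportedOn X B) : SupportedOn X (A + B) := by
  obtain ⟨A', hA⟩ := supportedOn_iff.1 hA
  obtain ⟨B', hB⟩ := supportedOn_iff.1 hB
  refine supportedOn_iff.2 ⟨A' + B', fun x y => ?_⟩
  rw [Matrix.add_apply, hA, hB, Matrix.add_apply]
  split_ifs <;> simp

theorem SupportedOn.sum {d : L → ℕ} {X : Finset L} {κ : Type*} (s : Finset κ)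
    {A : κ → Matrix (Config d) (Config d) ℂ} (hA : ∀ k ∈ s, SupportedOn X (A k)) :
    SupportedOn X (∑ k ∈ s, A k) :=
  Finset.sum_induction _ _ (fun _ _ => SupportedOn.add) (supportedOn_zero X) hA

theorem opNorm_fermi_le_one (hr : Function.Injective r) (b : Fin 2) (j : L) :
    ‖fermi r b j‖ ≤ 1 := by
  have h1 : ‖fermi r 1 j‖ ≤ 1 := by
    have := opNorm_create_sq_le hr (Pi.single j 1)
    rw [← fermi_one_eq_create, Finset.sum_eq_single j (by simp +contextual) (by simp)] at this
    rw [Pi.single_eq_same, norm_one] at this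
    exact le_of_sq_le_sq this zero_le_one
  rcases Fin.exists_fin_two.1 ⟨b, rfl⟩ with h | h
  · rw [h, ← sub_self 1, ← fermi_conjTranspose, l2_opNorm_conjTranspose]; exact h1
  · rw [h]; exact h1

theorem jwSign_eq_of_succ (hr : Function.Injective r) {i j : L} (h : r j = r i + 1)
    {x : L → Fin 2} (hx : x i = 0) : jwSign r j x = jwSign r i x := by
  refine Finset.prod_congr rfl fun k _ => if_congr ?_ rfl rfl
  rw [h]
  constructor
  · rintro ⟨h1, h2⟩
    refine ⟨lt_of_le_of_ne (Nat.lt_succ_iff.1 h1) fun e => ?_, h2⟩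
    rw [hr e, hx] at h2
    exact absurd h2 (by decide)
  · rintro ⟨h1, h2⟩
    exact ⟨h1.trans (Nat.lt_succ_self _), h2⟩

/-- For sites of consecutive rank the two sign strings coincide below the pair and cancel, which
leaves an operator on the two sites only. -/
theorem supportedOn_hop (hr : Function.Injective r) {i j : L} (h : r j = r i + 1 ∨ r i = r j + 1) :
    SupportedOn (d := fun _ => 2) {i, j} (fermi r 1 i * fermi r 0 j) := by
  have hij : i ≠ j := by
    rintro rfl
    omega
  have hi : i ∈ ({i, j} : Finset L) := by simp
  have hj : j ∈ ({i, j} : Finset L) := by simp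
  refine supportedOn_iff.2 ⟨fun a b => if a ⟨i, hi⟩ = 1 ∧ a ⟨j, hj⟩ = 0 ∧ b ⟨i, hi⟩ = 0 ∧
    b ⟨j, hj⟩ = 1 then 1 else 0, fun x y => ?_⟩
  have e1 : (fermi r 1 i * fermi r 0 j) x y =
      ((fermi r 1 i * fermi r 0 j) *ᵥ Pi.single y 1) x := by simp
  rw [e1, ← mulVec_mulVec, fermi_mulVec, fermi_mulVec, Function.update_of_ne hij.symm]
  simp only [sub_self, sub_zero]
  have hy : (∀ k, k ∉ ({i, j} : Finset L) → x k = y k) → y i = 0 → y j = 1 →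
      Function.update (Function.update x i 0) j 1 = y := by
    intro hk h0 h1
    funext k
    by_cases hkj : k = j
    · subst hkj; simp [h1]
    · rw [Function.update_of_ne hkj]
      by_cases hki : k = i
      · subst hki; simp [h0]
      · rw [Function.update_of_ne hki]
        exact hk k (by simp [hki, hkj])
  by_cases hx1 : x i = 1
  swap
  · simp [hx1]
  by_cases hx0 : x j = 0
  swap
  · simp [hx0]
  rw [if_pos hx1, if_pos hx0]
  have hsign : jwSign r i x * jwSign r j (Function.update x i 0) = 1 := by
    rcases h with h | h
    · rw [jwSign_eq_of_succ hr h (Function.update_self _ _ _),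
        jwSign_update_of_not_lt (lt_irrefl _), jwSign_mul_self]
    · rw [jwSign_eq_of_succ hr h hx0, jwSign_update_of_not_lt (by omega), jwSign_mul_self]
  rw [← mul_assoc, hsign, one_mul]
  by_cases he : Function.update (Function.update x i 0) j 1 = y
  · rw [he, Pi.single_eq_same, if_pos, if_pos]
    · refine ⟨hx1, hx0, ?_, ?_⟩
      · rw [← he, Function.update_of_ne hij, Function.update_self]
      · rw [← he, Function.update_self]
    · intro k hk
      simp only [Finset.mem_insert, Finset.mem_singleton, not_or] at hk
      rw [← he, Function.update_of_ne hk.2, Function.update_of_ne hk.1]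
  · rw [Pi.single_eq_of_ne he]
    split_ifs with h2 h3
    · exact absurd (hy h2 h3.2.2.1 h3.2.2.2) he
    · rfl
    · rfl

theorem isLocalHamiltonian_secondQuantize_adjMatrix (hr : Function.Injective r)
    (G : SimpleGraph L) [DecidableRel G.Adj]
    (hG : ∀ i j, G.Adj i j → r j = r i + 1 ∨ r i = r j + 1) :
    IsLocalHamiltonian (d := fun _ => 2) G 1 4 (secondQuantize r (G.adjMatrix ℂ)) := by
  set t : Finset L → L → L → Matrix (L → Fin 2) (L → Fin 2) ℂ := fun X i j =>
    if ({i, j} : Finset L) = X ∧ G.Adj i j then fermi r 1 i * fermi r 0 j else 0 with ht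
  refine ⟨fun X => ∑ i, ∑ j, t X i j, fun X => ?_, fun X => ?_, fun X hX => ?_, fun X => ?_, ?_⟩
  · change (∑ i, ∑ j, t X i j)ᴴ = ∑ i, ∑ j, t X i j
    conv_rhs => rw [Finset.sum_comm]
    rw [conjTranspose_sum]
    refine Finset.sum_congr rfl fun i _ => ?_
    rw [conjTranspose_sum]
    refine Finset.sum_congr rfl fun j _ => ?_
    simp only [ht, Finset.pair_comm j i, G.adj_comm j i]
    split_ifs
    · rw [conjTranspose_mul, fermi_conjTranspose, fermi_conjTranspose, sub_self, sub_zero]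
    · rw [conjTranspose_zero]
  · refine SupportedOn.sum _ fun i _ => SupportedOn.sum _ fun j _ => ?_
    simp only [ht]
    split_ifs with h
    · rw [← h.1]
      exact supportedOn_hop hr (hG i j h.2)
    · exact supportedOn_zero X
  · obtain ⟨i, -, hi⟩ := Finset.exists_ne_zero_of_sum_ne_zero hX
    obtain ⟨j, -, hj⟩ := Finset.exists_ne_zero_of_sum_ne_zero hi
    simp only [ht] at hj
    split_ifs at hj with h
    · obtain ⟨rfl, hadj⟩ := h
      have h1 : G.edist i j ≤ ((1 : ℕ) : ℕ∞) := by
        simpa using SimpleGraph.Walk.edist_le hadj.toWalk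
      have h2 : G.edist j i ≤ ((1 : ℕ) : ℕ∞) := by rwa [SimpleGraph.edist_comm]
      intro a ha b hb
      simp only [Finset.mem_insert, Finset.mem_singleton] at ha hb
      rcases ha with rfl | rfl <;> rcases hb with rfl | rfl
      · simp
      · exact h1
      · exact h2
      · simp
    · exact absurd rfl hj
  · change ‖∑ i, ∑ j, t X i j‖ ≤ 4
    -- The bound 4 counts ordered pairs from a set of at most two sites, each hop being a
    -- contraction; larger sets carry no term.
    by_cases hX : X.card ≤ 2
    · have hb : ∀ i j, ‖t X i j‖ ≤ if i ∈ X then (if j ∈ X then 1 else 0) else 0 := by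
        intro i j
        simp only [ht]
        split_ifs with h h1 h2 h3 h4
        · exact (l2_opNorm_mul _ _).trans (mul_le_one₀ (opNorm_fermi_le_one hr _ _)
            (norm_nonneg _) (opNorm_fermi_le_one hr _ _))
        · exact absurd (by rw [← h.1]; simp) h2
        · exact absurd (by rw [← h.1]; simp) h1
        all_goals simp
      refine (norm_sum_le _ _).trans ((Finset.sum_le_sum fun i _ => (norm_sum_le _ _).trans
        (Finset.sum_le_sum fun j _ => hb i j)).trans ?_)
      have : ∀ i, ∑ j, (if i ∈ X then (if j ∈ X then (1 : ℝ) else 0) else 0) =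
          if i ∈ X then (X.card : ℝ) else 0 := by
        intro i
        split_ifs <;> simp
      rw [Finset.sum_congr rfl fun i _ => this i, Finset.sum_ite_mem, Finset.univ_inter,
        Finset.sum_const, nsmul_eq_mul]
      have h2 : (X.card : ℝ) ≤ 2 := by exact_mod_cast hX
      nlinarith [(Nat.cast_nonneg X.card : (0 : ℝ) ≤ X.card)]
    · have hz : ∀ i j, t X i j = 0 := by
        intro i j
        simp only [ht]
        rw [if_neg]
        rintro ⟨rfl, -⟩
        exact hX Finset.card_le_two
      simp [hz]
  · change _ = ∑ X, ∑ i, ∑ j, t X i j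
    rw [Finset.sum_comm, secondQuantize]
    refine Finset.sum_congr rfl fun i _ => ?_
    rw [Finset.sum_comm]
    refine Finset.sum_congr rfl fun j _ => ?_
    simp only [ht, ite_and, SimpleGraph.adjMatrix_apply, ite_smul, one_smul, zero_smul]
    simp

end Hopping

/-! ### Ballistic spreading of a particle on a cycle. -/

section Ring

open ZMod

variable {R : ℕ} [NeZero R]

/-- Fourier multiplier on the cycle `ZMod R`. -/
noncomputable def fourierKernel (g : ZMod R → ℂ) (n : ZMod R) : ℂ :=
  (R : ℂ)⁻¹ * ∑ l, g l * stdAddChar (l * n)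

theorem sum_fourierKernel_mul_conj_mul (g : ZMod R → ℂ) (a : ZMod R) :
    ∑ n, fourierKernel g n * star (fourierKernel g n) * stdAddChar (a * n) =
      (R : ℂ)⁻¹ * ∑ l, g l * star (g (l + a)) := by
  have hR : (R : ℂ) ≠ 0 := by exact_mod_cast NeZero.ne R
  have h1 : ∀ n : ZMod R, fourierKernel g n * star (fourierKernel g n) * stdAddChar (a * n) =
      ∑ l, ∑ l', (R : ℂ)⁻¹ * (R : ℂ)⁻¹ * (g l * star (g l')) * stdAddChar (n * (l + a - l')) := by
    intro n
    simp only [fourierKernel, star_mul', star_sum, Complex.star_def, map_inv₀, map_natCast]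
    rw [mul_mul_mul_comm, Finset.sum_mul_sum, Finset.mul_sum, Finset.sum_mul]
    refine Finset.sum_congr rfl fun l _ => ?_
    rw [Finset.mul_sum, Finset.sum_mul]
    refine Finset.sum_congr rfl fun l' _ => ?_
    rw [← AddChar.map_neg_eq_conj, show n * (l + a - l') = l * n + -(l' * n) + a * n by ring,
      AddChar.map_add_eq_mul, AddChar.map_add_eq_mul]
    ring
  rw [Finset.sum_congr rfl fun n _ => h1 n, Finset.sum_comm, Finset.mul_sum]
  refine Finset.sum_congr rfl fun l _ => ?_
  rw [Finset.sum_comm, Finset.sum_eq_single (l + a)]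
  · simp only [sub_self, mul_zero, AddChar.map_zero_eq_one, mul_one, Finset.sum_const,
      Finset.card_univ, ZMod.card, nsmul_eq_mul]
    field_simp
  · intro l' _ hl'
    rw [← Finset.mul_sum, AddChar.sum_mulShift _ (isPrimitive_stdAddChar R),
      if_neg (sub_ne_zero.2 hl'.symm)]
    simp
  · simp

/-- Energy of the momentum `l` for hopping on the cycle `ZMod R`. -/
noncomputable def dispersion (l : ZMod R) : ℝ := 2 * (stdAddChar l).re

theorem dispersion_neg (l : ZMod R) : dispersion (-l) = dispersion l := by
  simp [dispersion, AddChar.map_neg_eq_conj]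

theorem ofReal_dispersion (l : ZMod R) :
    ((dispersion l : ℝ) : ℂ) = stdAddChar l + stdAddChar (-l) := by
  rw [AddChar.map_neg_eq_conj, Complex.add_conj]
  simp [dispersion]

/-- Propagator at time `τ` for hopping on the cycle `ZMod R`. -/
noncomputable def propagator (τ : ℝ) (n : ZMod R) : ℂ :=
  fourierKernel (fun l => Complex.exp ((τ * dispersion l : ℝ) * Complex.I)) n

theorem propagator_neg (τ : ℝ) (n : ZMod R) : propagator τ (-n) = propagator τ n := by
  unfold propagator fourierKernel
  congr 1
  refine Fintype.sum_equiv (Equiv.neg _) _ _ fun l => ?_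
  simp [dispersion_neg]

/-- The characteristic function of the displacement distribution is the autocorrelation of the
phases in momentum space, which turns into an average over energy differences. -/
theorem sum_norm_sq_propagator_mul (τ : ℝ) (a : ZMod R) :
    ∑ n, ‖propagator τ n‖ ^ 2 * (stdAddChar (a * n)).re =
      (R : ℝ)⁻¹ * ∑ l : ZMod R, Real.cos (τ * (dispersion l - dispersion (l + a))) := by
  have h := congrArg Complex.re (sum_fourierKernel_mul_conj_mul
    (fun l : ZMod R => Complex.exp ((τ * dispersion l : ℝ) * Complex.I)) a)
  have e1 : ∀ n : ZMod R, fourierKernel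
      (fun l : ZMod R => Complex.exp ((τ * dispersion l : ℝ) * Complex.I)) n = propagator τ n :=
    fun n => rfl
  simp only [e1, Complex.star_def, Complex.mul_conj, Complex.normSq_eq_norm_sq,
    Complex.re_sum, Complex.re_ofReal_mul] at h
  rw [h, ← Complex.ofReal_natCast, ← Complex.ofReal_inv, Complex.re_ofReal_mul, Complex.re_sum]
  congr 1
  refine Finset.sum_congr rfl fun l _ => ?_
  rw [← Complex.exp_conj, ← Complex.exp_add, ← Complex.exp_ofReal_mul_I_re]
  congr 2
  simp only [map_mul, Complex.conj_ofReal, Complex.conj_I]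
  push_cast
  ring

theorem sum_norm_sq_propagator (τ : ℝ) : ∑ n : ZMod R, ‖propagator τ n‖ ^ 2 = 1 := by
  have hR : (R : ℝ) ≠ 0 := by exact_mod_cast NeZero.ne R
  have h := sum_norm_sq_propagator_mul (R := R) τ 0
  simpa [hR] using h

theorem sum_norm_sq_propagator_mul_one_sub (τ : ℝ) (a : ZMod R) :
    ∑ n, ‖propagator τ n‖ ^ 2 * (1 - (stdAddChar (a * n)).re) =
      (R : ℝ)⁻¹ * ∑ l : ZMod R, (1 - Real.cos (τ * (dispersion l - dispersion (l + a)))) := by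
  have hR : (R : ℝ) ≠ 0 := by exact_mod_cast NeZero.ne R
  simp only [mul_one_sub, Finset.sum_sub_distrib]
  rw [sum_norm_sq_propagator, sum_norm_sq_propagator_mul, mul_sub]
  simp [hR]

theorem dispersion_sub (l a : ZMod R) :
    dispersion l - dispersion (l + a) = 2 * ((1 - stdAddChar a) * stdAddChar l).re := by
  rw [dispersion, dispersion, AddChar.map_add_eq_mul, sub_mul, one_mul, Complex.sub_re,
    mul_comm (stdAddChar l)]
  ring

theorem abs_dispersion_sub_le (l a : ZMod R) :
    |dispersion l - dispersion (l + a)| ≤ 2 * ‖1 - stdAddChar a‖ := by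
  rw [dispersion_sub, abs_mul, abs_two]
  refine mul_le_mul_of_nonneg_left ((Complex.abs_re_le_norm _).trans ?_) zero_le_two
  rw [norm_mul, AddChar.norm_apply, mul_one]

/-- The square of a real part is a constant plus a term oscillating like the character at 2l. The
latter sums to zero because 2 ≠ 0 in `ZMod R` for R > 2. -/
theorem sum_dispersion_sub_sq (hR : 2 < R) (a : ZMod R) :
    ∑ l : ZMod R, (dispersion l - dispersion (l + a)) ^ 2 = R * (2 * ‖1 - stdAddChar a‖ ^ 2) := by
  have h1 : ∀ l : ZMod R, (dispersion l - dispersion (l + a)) ^ 2 =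
      2 * ‖1 - stdAddChar a‖ ^ 2 + 2 * ((1 - stdAddChar a) ^ 2 * stdAddChar (l * 2)).re := by
    intro l
    have e : (1 - stdAddChar a) ^ 2 * stdAddChar (l * 2) =
        ((1 - stdAddChar a) * stdAddChar l) * ((1 - stdAddChar a) * stdAddChar l) := by
      rw [mul_two, AddChar.map_add_eq_mul]; ring
    have e2 : ‖1 - stdAddChar a‖ ^ 2 = ‖(1 - stdAddChar a) * stdAddChar l‖ ^ 2 := by
      rw [norm_mul, AddChar.norm_apply, mul_one]
    rw [dispersion_sub, e, e2, ← Complex.normSq_eq_norm_sq, Complex.normSq_apply]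
    generalize (1 - stdAddChar a) * stdAddChar l = z
    rw [Complex.mul_re]
    ring
  have h2 : (2 : ZMod R) ≠ 0 := by
    intro h
    have : ((2 : ℕ) : ZMod R) = 0 := by exact_mod_cast h
    rw [ZMod.natCast_eq_zero_iff] at this
    exact absurd (Nat.le_of_dvd two_pos this) (by omega)
  have h3 : ∑ l : ZMod R, 2 * ((1 - stdAddChar a) ^ 2 * stdAddChar (l * 2)).re = 0 := by
    rw [← Finset.mul_sum, ← Complex.re_sum, ← Finset.mul_sum,
      AddChar.sum_mulShift _ (isPrimitive_stdAddChar R), if_neg h2]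
    simp
  rw [Finset.sum_congr rfl fun l _ => h1 l, Finset.sum_add_distrib, h3]
  simp

theorem sum_norm_sq_propagator_mul_one_sub_le (hR : 2 < R) (τ : ℝ) (a : ZMod R) :
    ∑ n, ‖propagator τ n‖ ^ 2 * (1 - (stdAddChar (a * n)).re) ≤
      τ ^ 2 * ‖1 - stdAddChar a‖ ^ 2 := by
  have hR0 : (R : ℝ) ≠ 0 := by exact_mod_cast NeZero.ne R
  rw [sum_norm_sq_propagator_mul_one_sub]
  calc (R : ℝ)⁻¹ * ∑ l : ZMod R, (1 - Real.cos (τ * (dispersion l - dispersion (l + a))))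
      ≤ (R : ℝ)⁻¹ * ∑ l : ZMod R, τ ^ 2 / 2 * (dispersion l - dispersion (l + a)) ^ 2 := by
        refine mul_le_mul_of_nonneg_left (Finset.sum_le_sum fun l _ => ?_) (by positivity)
        have := Real.one_sub_sq_div_two_le_cos (x := τ * (dispersion l - dispersion (l + a)))
        nlinarith
    _ = _ := by
        rw [← Finset.mul_sum, sum_dispersion_sub_sq hR]
        field_simp

/-- Uses 1 - cos x ≥ 2 x² / π² for |x| ≤ π; the hypothesis `h` keeps every phase difference in this
range. -/
theorem le_sum_norm_sq_propagator_mul_one_sub (hR : 2 < R) {τ : ℝ} (hτ : 0 ≤ τ) (a : ZMod R)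
    (h : 2 * ‖1 - stdAddChar a‖ * τ ≤ Real.pi) :
    4 / Real.pi ^ 2 * (τ ^ 2 * ‖1 - stdAddChar a‖ ^ 2) ≤
      ∑ n, ‖propagator τ n‖ ^ 2 * (1 - (stdAddChar (a * n)).re) := by
  have hR0 : (R : ℝ) ≠ 0 := by exact_mod_cast NeZero.ne R
  rw [sum_norm_sq_propagator_mul_one_sub]
  calc 4 / Real.pi ^ 2 * (τ ^ 2 * ‖1 - stdAddChar a‖ ^ 2)
      = (R : ℝ)⁻¹ * ∑ l : ZMod R,
          2 / Real.pi ^ 2 * τ ^ 2 * (dispersion l - dispersion (l + a)) ^ 2 := by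
        rw [← Finset.mul_sum, sum_dispersion_sub_sq hR]
        field_simp
        ring
    _ ≤ _ := by
        refine mul_le_mul_of_nonneg_left (Finset.sum_le_sum fun l _ => ?_) (by positivity)
        have := Real.cos_le_one_sub_mul_cos_sq (x := τ * (dispersion l - dispersion (l + a))) (by
          rw [abs_mul, abs_of_nonneg hτ, mul_comm]
          exact (mul_le_mul_of_nonneg_right (abs_dispersion_sub_le l a) hτ).trans h)
        linarith [mul_pow τ (dispersion l - dispersion (l + a)) 2 ▸ this]

theorem stdAddChar_eq_exp_valMinAbs (n : ZMod R) :
    stdAddChar n = Complex.exp ((2 * Real.pi * n.valMinAbs / R : ℝ) * Complex.I) := by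
  conv_lhs => rw [← ZMod.coe_valMinAbs n]
  rw [stdAddChar_coe]
  congr 1
  push_cast
  ring

theorem norm_sq_one_sub_stdAddChar (n : ZMod R) :
    ‖1 - stdAddChar n‖ ^ 2 = 2 * (1 - (stdAddChar n).re) := by
  have h : ‖stdAddChar n‖ ^ 2 = 1 := by rw [AddChar.norm_apply, one_pow]
  rw [← Complex.normSq_eq_norm_sq, Complex.normSq_apply] at *
  simp only [Complex.sub_re, Complex.one_re, Complex.sub_im, Complex.one_im]
  linarith

theorem one_sub_stdAddChar_re_ge (n : ZMod R) :
    8 * (n.valMinAbs.natAbs : ℝ) ^ 2 / R ^ 2 ≤ 1 - (stdAddChar n).re := by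
  have hR0 : (0 : ℝ) < R := by exact_mod_cast NeZero.pos R
  have hv : 2 * |(n.valMinAbs : ℝ)| ≤ R := by
    have h := ZMod.natAbs_valMinAbs_le n
    rw [← Int.cast_abs, Int.abs_eq_natAbs]
    norm_cast
    omega
  rw [stdAddChar_eq_exp_valMinAbs, Complex.exp_ofReal_mul_I_re]
  have := Real.cos_le_one_sub_mul_cos_sq (x := 2 * Real.pi * n.valMinAbs / R) (by
    rw [abs_div, abs_mul, abs_of_pos Real.two_pi_pos, abs_of_pos hR0, div_le_iff₀ hR0]
    nlinarith [Real.pi_pos])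
  have e : 2 / Real.pi ^ 2 * (2 * Real.pi * n.valMinAbs / R) ^ 2 =
      8 * (n.valMinAbs.natAbs : ℝ) ^ 2 / R ^ 2 := by
    rw [Nat.cast_natAbs, Int.cast_abs, sq_abs]
    field_simp
    ring
  linarith

theorem one_sub_stdAddChar_re_le (n : ZMod R) :
    1 - (stdAddChar n).re ≤ 2 * Real.pi ^ 2 * (n.valMinAbs.natAbs : ℝ) ^ 2 / R ^ 2 := by
  rw [stdAddChar_eq_exp_valMinAbs, Complex.exp_ofReal_mul_I_re]
  have := Real.one_sub_sq_div_two_le_cos (x := 2 * Real.pi * n.valMinAbs / R)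
  have e : (2 * Real.pi * n.valMinAbs / R) ^ 2 / 2 =
      2 * Real.pi ^ 2 * (n.valMinAbs.natAbs : ℝ) ^ 2 / R ^ 2 := by
    rw [Nat.cast_natAbs, Int.cast_abs, sq_abs]
    ring
  linarith

theorem norm_one_sub_pow_le {z : ℂ} (hz : ‖z‖ = 1) (k : ℕ) : ‖1 - z ^ k‖ ≤ k * ‖1 - z‖ := by
  induction k with
  | zero => simp
  | succ k ih =>
    have e : 1 - z ^ (k + 1) = (1 - z ^ k) + z ^ k * (1 - z) := by ring
    rw [e]
    refine (norm_add_le _ _).trans ?_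
    rw [norm_mul, norm_pow, hz, one_pow, one_mul]
    push_cast
    linarith

theorem eq_natAbs_valMinAbs_or (n : ZMod R) :
    n = (n.valMinAbs.natAbs : ZMod R) ∨ n = -(n.valMinAbs.natAbs : ZMod R) := by
  have h := ZMod.coe_valMinAbs n
  rcases Int.natAbs_eq n.valMinAbs with h' | h'
  · left
    rw [h'] at h
    push_cast at h
    simpa using h.symm
  · right
    rw [h'] at h
    push_cast at h
    simpa using h.symm

theorem one_sub_stdAddChar_mul_re_le (a n : ZMod R) :
    1 - (stdAddChar (a * n)).re ≤ n.valMinAbs.natAbs * ‖1 - stdAddChar a‖ := by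
  set k := n.valMinAbs.natAbs
  have h1 : (stdAddChar (a * n)).re = (stdAddChar a ^ k).re := by
    rw [← AddChar.map_nsmul_eq_pow, nsmul_eq_mul, mul_comm]
    rcases eq_natAbs_valMinAbs_or n with h | h
    · rw [h]
    · rw [h, neg_mul, AddChar.map_neg_eq_conj, Complex.conj_re]
  rw [h1]
  refine le_trans ?_ (norm_one_sub_pow_le (AddChar.norm_apply stdAddChar a) k)
  refine le_trans ?_ (Complex.re_le_norm _)
  simp

theorem natAbs_valMinAbs_natCast {a : ℕ} (ha : 2 * a ≤ R) :
    ((a : ZMod R)).valMinAbs.natAbs = a := by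
  have := NeZero.pos R
  rw [ZMod.valMinAbs_natAbs_eq_min, ZMod.val_natCast, Nat.mod_eq_of_lt (by omega)]
  omega

/-- Tail bound for the spreading on the cycle. -/
theorem sum_norm_sq_propagator_tail_le (hR : 2 < R) (τ : ℝ) {m : ℕ} (hm : 0 < m) :
    ∑ n : ZMod R with m ≤ n.valMinAbs.natAbs, ‖propagator τ n‖ ^ 2 ≤ 5 * τ ^ 2 / m ^ 2 := by
  have hR0 : (0 : ℝ) < R := by exact_mod_cast NeZero.pos R
  have hm0 : (0 : ℝ) < m := by exact_mod_cast hm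
  -- A Chebyshev argument at the smallest momentum shift, where 1 - cos is comparable to the squared
  -- displacement over the whole cycle. The constant 5 comes from π² / 2.
  have h1 := sum_norm_sq_propagator_mul_one_sub_le hR τ (1 : ZMod R)
  have hw : ‖1 - stdAddChar (1 : ZMod R)‖ ^ 2 ≤ 4 * Real.pi ^ 2 / R ^ 2 := by
    have h := one_sub_stdAddChar_re_le (1 : ZMod R)
    have e := natAbs_valMinAbs_natCast (R := R) (a := 1) (by omega)
    rw [Nat.cast_one] at e
    rw [e] at h
    rw [norm_sq_one_sub_stdAddChar]
    calc _ ≤ 2 * (2 * Real.pi ^ 2 * ((1 : ℕ) : ℝ) ^ 2 / R ^ 2) := by linarith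
      _ = _ := by push_cast; ring
  have h2 : 8 * (m : ℝ) ^ 2 / R ^ 2 *
      ∑ n : ZMod R with m ≤ n.valMinAbs.natAbs, ‖propagator τ n‖ ^ 2 ≤
      ∑ n, ‖propagator τ n‖ ^ 2 * (1 - (stdAddChar ((1 : ZMod R) * n)).re) := by
    rw [Finset.mul_sum, Finset.sum_filter]
    refine Finset.sum_le_sum fun n _ => ?_
    rw [one_mul]
    have h3 := one_sub_stdAddChar_re_ge n
    split_ifs with h
    · rw [mul_comm]
      refine mul_le_mul_of_nonneg_left (le_trans ?_ h3) (by positivity)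
      gcongr
    · exact mul_nonneg (by positivity) (le_trans (by positivity) h3)
  have h4 := h2.trans (h1.trans (mul_le_mul_of_nonneg_left hw (sq_nonneg τ)))
  rw [div_mul_eq_mul_div, ← mul_div_assoc, div_le_div_iff_of_pos_right (by positivity)] at h4
  rw [le_div_iff₀ (by positivity)]
  have hpi : Real.pi ^ 2 ≤ 10 := by nlinarith [Real.pi_lt_d2, Real.pi_pos]
  nlinarith [mul_le_mul_of_nonneg_left hpi (sq_nonneg τ)]

/-- The shift a = ⌊R / (4τ)⌋ resolves displacements of order τ. The bound R ≥ 8τ makes the floor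
lose at most a factor 2, and τ ≥ 1/2 keeps a within half the cycle. -/
theorem exists_norm_one_sub_stdAddChar_mul_mem {τ : ℝ} (hτ : 1 / 2 ≤ τ) (hR : 8 * τ ≤ R) :
    ∃ a : ZMod R, 1 / 2 ≤ ‖1 - stdAddChar a‖ * τ ∧ 2 * ‖1 - stdAddChar a‖ * τ ≤ Real.pi := by
  have hR0 : (0 : ℝ) < R := by linarith
  have hτ0 : 0 < τ := by linarith
  obtain ⟨a, ha3, ha4⟩ : ∃ a : ℕ, a * (4 * τ) ≤ R ∧ (R : ℝ) / 2 ≤ a * (4 * τ) := by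
    refine ⟨⌊(R : ℝ) / (4 * τ)⌋₊, ?_, ?_⟩
    · rw [← le_div_iff₀ (by positivity)]
      exact Nat.floor_le (by positivity)
    · have h1 := (Nat.lt_floor_add_one ((R : ℝ) / (4 * τ))).le
      rw [div_le_iff₀ (by positivity)] at h1
      linarith
  have ha5 : 2 * a ≤ R := by
    have : (2 * a : ℝ) ≤ R := by nlinarith [(Nat.cast_nonneg a : (0 : ℝ) ≤ a)]
    exact_mod_cast this
  refine ⟨a, ?_⟩
  have hsq := norm_sq_one_sub_stdAddChar (a : ZMod R)
  have hge := one_sub_stdAddChar_re_ge (a : ZMod R)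
  have hle := one_sub_stdAddChar_re_le (a : ZMod R)
  rw [natAbs_valMinAbs_natCast ha5] at hge hle
  have hw0 : 0 ≤ ‖1 - stdAddChar (a : ZMod R)‖ := norm_nonneg _
  generalize ‖1 - stdAddChar (a : ZMod R)‖ = w at *
  have hwl : 4 * a / R ≤ w := by
    refine le_of_sq_le_sq ?_ hw0
    rw [hsq]
    calc (4 * a / R : ℝ) ^ 2 = 2 * (8 * (a : ℝ) ^ 2 / R ^ 2) := by ring
      _ ≤ _ := by linarith
  have hwu : w ≤ 2 * Real.pi * a / R := by
    refine le_of_sq_le_sq ?_ (by positivity)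
    rw [hsq]
    calc _ ≤ 2 * (2 * Real.pi ^ 2 * (a : ℝ) ^ 2 / R ^ 2) := by linarith
      _ = (2 * Real.pi * a / R : ℝ) ^ 2 := by ring
  constructor
  · rw [div_le_iff₀ hR0] at hwl
    have := mul_le_mul_of_nonneg_right hwl hτ0.le
    refine le_of_mul_le_mul_right (a := (R : ℝ)) ?_ hR0
    linarith
  · rw [le_div_iff₀ hR0] at hwu
    refine le_of_mul_le_mul_right (a := (R : ℝ)) ?_ hR0
    have h1 := mul_le_mul_of_nonneg_right hwu hτ0.le
    have h2 := mul_le_mul_of_nonneg_left ha3 Real.pi_pos.le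
    linarith

/-- Ballistic spreading on the cycle: the mean displacement grows linearly. -/
theorem le_sum_natAbs_mul_norm_sq_propagator {τ : ℝ} {m : ℕ} (hτ : 1 / 2 ≤ τ)
    (hm : 1000 * τ ≤ m) (hmR : 2 * m ≤ R) :
    τ / 10 ≤ ∑ n : ZMod R with n.valMinAbs.natAbs < m,
      (n.valMinAbs.natAbs : ℝ) * ‖propagator τ n‖ ^ 2 := by
  have hm0 : (0 : ℝ) < m := by linarith
  have hmN : 0 < m := by exact_mod_cast hm0
  have hmR' : 2 * (m : ℝ) ≤ R := by exact_mod_cast hmR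
  have hR : 2 < R := by
    have : (2 : ℝ) < R := by linarith
    exact_mod_cast this
  have hτ0 : 0 < τ := by linarith
  obtain ⟨a, hwτ1, hwτ2⟩ := exists_norm_one_sub_stdAddChar_mul_mem (R := R) hτ (by linarith)
  have hlow := le_sum_norm_sq_propagator_mul_one_sub hR hτ0.le a hwτ2
  have htail := sum_norm_sq_propagator_tail_le hR τ hmN
  -- Short displacements are estimated linearly, which produces the first moment; long ones
  -- trivially by 2, leaving only the tail.
  have hup : ∑ n, ‖propagator τ n‖ ^ 2 * (1 - (stdAddChar (a * n)).re) ≤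
      ‖1 - stdAddChar a‖ * (∑ n : ZMod R with n.valMinAbs.natAbs < m,
        (n.valMinAbs.natAbs : ℝ) * ‖propagator τ n‖ ^ 2) +
      2 * ∑ n : ZMod R with m ≤ n.valMinAbs.natAbs, ‖propagator τ n‖ ^ 2 := by
    rw [Finset.mul_sum, Finset.mul_sum, Finset.sum_filter, Finset.sum_filter,
      ← Finset.sum_add_distrib]
    refine Finset.sum_le_sum fun n _ => ?_
    have h0 := sq_nonneg ‖propagator τ n‖
    rcases lt_or_ge n.valMinAbs.natAbs m with h | h
    · rw [if_pos h, if_neg (not_le.2 h), add_zero]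
      have := mul_le_mul_of_nonneg_left (one_sub_stdAddChar_mul_re_le a n) h0
      linarith
    · rw [if_neg (not_lt.2 h), if_pos h, zero_add, mul_comm]
      refine mul_le_mul_of_nonneg_right ?_ h0
      have := (abs_le.1 ((Complex.abs_re_le_norm _).trans
        (AddChar.norm_apply stdAddChar (a * n)).le)).1
      linarith
  have hpi : 2 / 5 ≤ 4 / Real.pi ^ 2 := by
    have hpi : Real.pi ^ 2 ≤ 10 := by nlinarith [Real.pi_lt_d2, Real.pi_pos]
    rw [le_div_iff₀ (by positivity)]
    linarith
  have hP : 5 * τ ^ 2 / m ^ 2 ≤ 1 / 100000 := by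
    rw [div_le_iff₀ (by positivity)]
    have := pow_le_pow_left₀ (by positivity) hm 2
    nlinarith
  have h0 := hlow.trans hup
  generalize (∑ n : ZMod R with m ≤ n.valMinAbs.natAbs, ‖propagator τ n‖ ^ 2) = P at *
  generalize (∑ n : ZMod R with n.valMinAbs.natAbs < m,
        (n.valMinAbs.natAbs : ℝ) * ‖propagator τ n‖ ^ 2) = M at *
  have hw0 : 0 ≤ ‖1 - stdAddChar a‖ := norm_nonneg _
  generalize ‖1 - stdAddChar a‖ = w at *
  have h1 : 2 / 5 * (w * τ) ^ 2 ≤ w * M + 2 * P := by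
    refine le_trans ?_ h0
    rw [← mul_pow, mul_comm τ w]
    exact mul_le_mul_of_nonneg_right hpi (sq_nonneg _)
  -- With x = wτ ≥ 1/2, a mean displacement below τ / 10 would give (2/5) x² < x / 10 plus a tail of
  -- at most 2 · 10⁻⁵, which is impossible.
  by_contra! hc
  have h2 : w * M ≤ w * (τ / 10) := mul_le_mul_of_nonneg_left hc.le hw0
  nlinarith

end Ring

/-! ### The open chain by the method of images. -/

section Chain

open ZMod

/-- Sites are numbered 1 to N in the argument of `F`. Zeros at 0 and N + 1 supply the missing
neighbours of the end sites. -/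
theorem sum_pathGraph_adj (N : ℕ) (F : ℕ → ℂ) (h0 : F 0 = 0) (hN : F (N + 1) = 0) (x : Fin N)
    [DecidableRel (SimpleGraph.pathGraph N).Adj] :
    ∑ y : Fin N, (if (SimpleGraph.pathGraph N).Adj x y then (1 : ℂ) else 0) * F (y.val + 1) =
      F (x.val + 2) + F x.val := by
  have h1 : ∀ y : Fin N, (if (SimpleGraph.pathGraph N).Adj x y then (1 : ℂ) else 0) *
      F (y.val + 1) = (if x.val + 1 = y.val then F (y.val + 1) else 0) +
        (if y.val + 1 = x.val then F (y.val + 1) else 0) := by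
    intro y
    have hadj := SimpleGraph.pathGraph_adj (u := x) (v := y)
    by_cases h : x.val + 1 = y.val
    · rw [if_pos (hadj.2 (Or.inl h)), if_pos h, if_neg (by omega), one_mul, add_zero]
    · by_cases h' : y.val + 1 = x.val
      · rw [if_pos (hadj.2 (Or.inr h')), if_neg h, if_pos h', one_mul, zero_add]
      · rw [if_neg (by tauto : ¬(SimpleGraph.pathGraph N).Adj x y), if_neg h, if_neg h', zero_mul, add_zero]
  rw [Finset.sum_congr rfl fun y _ => h1 y, Finset.sum_add_distrib]
  congr 1
  · by_cases hx : x.val + 1 < N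
    · rw [Finset.sum_eq_single ⟨x.val + 1, hx⟩ (fun y _ hy => if_neg fun h => hy (Fin.ext h.symm))
        (by simp)]
      simp
    · have e : x.val + 2 = N + 1 := by omega
      rw [e, hN]
      exact Finset.sum_eq_zero fun y _ => if_neg (by omega)
  · rcases Nat.eq_zero_or_pos x.val with hx | hx
    · rw [hx, h0]
      exact Finset.sum_eq_zero fun y _ => if_neg (by omega)
    · rw [Finset.sum_eq_single ⟨x.val - 1, by omega⟩ (fun y _ hy => if_neg fun h => hy
        (Fin.ext (by simp; omega))) (by simp)]
      rw [if_pos (by simp; omega)]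
      congr 1
      simp
      omega

theorem exp_mulVec_of_mulVec_eq_smul {n : Type*} [Fintype n] [DecidableEq n] (A : Matrix n n ℂ)
    (v : n → ℂ) (μ : ℂ) (t : ℝ) (h : A *ᵥ v = μ • v) :
    NormedSpace.exp ((t : ℂ) • A) *ᵥ v = Complex.exp (t * μ) • v := by
  have h1 : (A - μ • (1 : Matrix n n ℂ)) *ᵥ v = 0 := by
    rw [sub_mulVec, smul_mulVec, one_mulVec, h, sub_self]
  have e : (t : ℂ) • A = (t * μ) • (1 : Matrix n n ℂ) + (t : ℂ) • (A - μ • (1 : Matrix n n ℂ)) := by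
    rw [smul_sub, smul_smul]; abel
  have h2 : NormedSpace.exp ((t * μ) • (1 : Matrix n n ℂ)) =
      Complex.exp (t * μ) • (1 : Matrix n n ℂ) := by
    rw [← Algebra.algebraMap_eq_smul_one, ← Algebra.algebraMap_eq_smul_one,
      Complex.exp_eq_exp_ℂ, NormedSpace.algebraMap_exp_comm]
  rw [e, Matrix.exp_add_of_commute _ _ ((Commute.one_left _).smul_left _), ← mulVec_mulVec,
    exp_mulVec_of_mulVec_eq_zero h1, h2, smul_mulVec, one_mulVec]

/-- A site of the open chain, seen on the cycle of twice the length. -/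
def toCycle {N : ℕ} (x : Fin N) : ZMod (2 * (N + 1)) := ((x.val + 1 : ℕ) : ZMod _)

/-- Standing waves of the open chain, as functions of both end points. -/
noncomputable def standingWave {N : ℕ} (l : ZMod (2 * (N + 1))) (y : Fin N) (n : ℕ) : ℂ :=
  (stdAddChar (l * ((n : ZMod (2 * (N + 1))) - toCycle y)) +
      stdAddChar (-(l * ((n : ZMod (2 * (N + 1))) - toCycle y)))) -
    (stdAddChar (l * ((n : ZMod (2 * (N + 1))) + toCycle y)) +
      stdAddChar (-(l * ((n : ZMod (2 * (N + 1))) + toCycle y))))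

theorem standingWave_zero {N : ℕ} (l : ZMod (2 * (N + 1))) (y : Fin N) :
    standingWave l y 0 = 0 := by
  simp [standingWave, add_comm]

theorem standingWave_last {N : ℕ} (l : ZMod (2 * (N + 1))) (y : Fin N) :
    standingWave l y (N + 1) = 0 := by
  have h : ((N + 1 : ℕ) : ZMod (2 * (N + 1))) = -((N + 1 : ℕ) : ZMod (2 * (N + 1))) := by
    rw [eq_neg_iff_add_eq_zero, ← two_mul]
    have := ZMod.natCast_self (2 * (N + 1))
    push_cast at this ⊢
    exact this
  have e : ((N + 1 : ℕ) : ZMod (2 * (N + 1))) + toCycle y =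
      -(((N + 1 : ℕ) : ZMod (2 * (N + 1))) - toCycle y) := by
    conv_lhs => rw [h]
    ring
  rw [standingWave, e, mul_neg, neg_neg]
  ring

theorem standingWave_add_two {N : ℕ} (l : ZMod (2 * (N + 1))) (y : Fin N) (n : ℕ) :
    standingWave l y (n + 2) + standingWave l y n =
      (dispersion l : ℂ) * standingWave l y (n + 1) := by
  have key : ∀ c : ZMod (2 * (N + 1)),
      (stdAddChar (l * (((n + 2 : ℕ) : ZMod (2 * (N + 1))) + c)) : ℂ) +
        stdAddChar (l * ((n : ZMod (2 * (N + 1))) + c)) =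
      (dispersion l : ℂ) * stdAddChar (l * (((n + 1 : ℕ) : ZMod (2 * (N + 1))) + c)) := by
    intro c
    rw [ofReal_dispersion, add_mul, ← AddChar.map_add_eq_mul, ← AddChar.map_add_eq_mul]
    congr 2 <;> (push_cast; ring)
  have key' : ∀ c : ZMod (2 * (N + 1)),
      (stdAddChar (-(l * (((n + 2 : ℕ) : ZMod (2 * (N + 1))) + c))) : ℂ) +
        stdAddChar (-(l * ((n : ZMod (2 * (N + 1))) + c))) =
      (dispersion l : ℂ) * stdAddChar (-(l * (((n + 1 : ℕ) : ZMod (2 * (N + 1))) + c))) := by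
    intro c
    rw [ofReal_dispersion, add_mul, ← AddChar.map_add_eq_mul, ← AddChar.map_add_eq_mul, add_comm]
    congr 2 <;> (push_cast; ring)
  have h1 := key (toCycle y)
  have h2 := key (-toCycle y)
  have h3 := key' (toCycle y)
  have h4 := key' (-toCycle y)
  simp only [← sub_eq_add_neg] at h2 h4
  unfold standingWave
  linear_combination h2 + h4 - h1 - h3

/-- For even `g` the terms with l and -l contribute equally, which explains the additional factor 2
in the normalization. -/
theorem sum_mul_standingWave {N : ℕ} (g : ZMod (2 * (N + 1)) → ℂ) (hg : ∀ l, g (-l) = g l)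
    (x y : Fin N) :
    (2 * ((2 * (N + 1) : ℕ) : ℂ))⁻¹ * ∑ l, g l * standingWave l y (x.val + 1) =
      fourierKernel g (toCycle x - toCycle y) - fourierKernel g (toCycle x + toCycle y) := by
  have h1 : ∀ c, ∑ l, g l * (stdAddChar (-(l * c)) : ℂ) = ∑ l, g l * stdAddChar (l * c) := by
    intro c
    refine Fintype.sum_equiv (Equiv.neg _) _ _ fun l => ?_
    simp [hg]
  simp only [standingWave, mul_sub, mul_add, Finset.sum_sub_distrib, Finset.sum_add_distrib]
  simp only [fourierKernel, ← mul_sub, ← mul_add, h1]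
  rw [show (((x.val + 1 : ℕ) : ZMod (2 * (N + 1)))) = toCycle x from rfl, mul_inv]
  ring

theorem toCycle_sub_eq_zero_iff {N : ℕ} (x y : Fin N) :
    toCycle x - toCycle y = 0 ↔ x = y := by
  rw [sub_eq_zero, toCycle, toCycle, ZMod.natCast_eq_natCast_iff']
  rw [Nat.mod_eq_of_lt (by omega), Nat.mod_eq_of_lt (by omega), Fin.ext_iff]
  omega

theorem toCycle_add_ne_zero {N : ℕ} (x y : Fin N) : toCycle x + toCycle y ≠ 0 := by
  rw [toCycle, toCycle, ← Nat.cast_add, Ne, ZMod.natCast_eq_zero_iff]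
  intro h
  have := Nat.le_of_dvd (by omega) h
  omega

theorem fourierKernel_one {R : ℕ} [NeZero R] (n : ZMod R) :
    fourierKernel (fun _ => 1) n = if n = 0 then 1 else 0 := by
  have hR : (R : ℂ) ≠ 0 := by exact_mod_cast NeZero.ne R
  simp only [fourierKernel, one_mul]
  rw [AddChar.sum_mulShift _ (isPrimitive_stdAddChar R)]
  split_ifs <;> simp [hR]

/-- Method of images for hopping on the open chain. -/
theorem exp_adjMatrix_pathGraph_apply (N : ℕ) [DecidableRel (SimpleGraph.pathGraph N).Adj]
    (τ : ℝ) (x y : Fin N) :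
    NormedSpace.exp ((τ : ℂ) • (Complex.I • (SimpleGraph.pathGraph N).adjMatrix ℂ)) x y =
      propagator τ (toCycle x - toCycle y) - propagator τ (toCycle x + toCycle y) := by
  set A := Complex.I • (SimpleGraph.pathGraph N).adjMatrix ℂ with hA
  set c : ℂ := (2 * ((2 * (N + 1) : ℕ) : ℂ))⁻¹ with hc
  have hw : ∀ l : ZMod (2 * (N + 1)), A *ᵥ (fun x : Fin N => standingWave l y (x.val + 1)) =
      (Complex.I * dispersion l) • (fun x : Fin N => standingWave l y (x.val + 1)) := by
    intro l
    rw [hA, smul_mulVec, mul_smul]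
    congr 1
    funext x
    simp only [mulVec, dotProduct, SimpleGraph.adjMatrix_apply, Pi.smul_apply, smul_eq_mul]
    rw [sum_pathGraph_adj N (standingWave l y) (standingWave_zero l y) (standingWave_last l y),
      standingWave_add_two]
  -- Completeness of the standing waves is the case `g = 1`; the image term drops out because the
  -- sum of two chain sites is never zero on the cycle.
  have h1 : Pi.single y (1 : ℂ) =
      c • ∑ l : ZMod (2 * (N + 1)), fun x : Fin N => standingWave l y (x.val + 1) := by
    funext x
    have := sum_mul_standingWave (fun _ => 1) (fun _ => rfl) x y
    simp only [one_mul] at this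
    rw [Pi.smul_apply, Finset.sum_apply, smul_eq_mul, this, fourierKernel_one, fourierKernel_one,
      if_neg (toCycle_add_ne_zero x y), sub_zero, Pi.single_apply]
    simp only [toCycle_sub_eq_zero_iff]
  have h2 : NormedSpace.exp ((τ : ℂ) • A) x y =
      (NormedSpace.exp ((τ : ℂ) • A) *ᵥ Pi.single y (1 : ℂ)) x := by
    rw [mulVec_single_one]; rfl
  rw [h2, h1, mulVec_smul, mulVec_sum, Finset.sum_congr rfl fun l _ =>
    exp_mulVec_of_mulVec_eq_smul A _ _ τ (hw l)]
  rw [Pi.smul_apply, Finset.sum_apply, smul_eq_mul]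
  simp only [Pi.smul_apply, smul_eq_mul]
  rw [hc, propagator, propagator, ← sum_mul_standingWave _ (fun l => by rw [dispersion_neg])]
  congr 1
  refine Finset.sum_congr rfl fun l _ => ?_
  congr 2
  push_cast
  ring

end Chain

/-! ### Weight transported across the boundary of a block. -/

section Block

open ZMod

theorem mem_block {N s : ℕ} {x : Fin N} : x ∈ block N s ↔ x.val < s := by
  simp [block]

theorem propagator_natAbs {R : ℕ} [NeZero R] (τ : ℝ) (n : ZMod R) :
    propagator τ n = propagator τ (n.valMinAbs.natAbs : ZMod R) := by
  rcases eq_natAbs_valMinAbs_or n with h | h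
  · rw [← h]
  · conv_lhs => rw [h, propagator_neg]

/-- Each absolute displacement is attained by at most two elements of the cycle, of opposite sign
and equal weight. -/
theorem sum_natAbs_mul_norm_sq_propagator_le {R : ℕ} [NeZero R] (τ : ℝ) (m : ℕ) :
    ∑ n : ZMod R with n.valMinAbs.natAbs < m,
      (n.valMinAbs.natAbs : ℝ) * ‖propagator τ n‖ ^ 2 ≤
    2 * ∑ j ∈ Finset.range m, (j : ℝ) * ‖propagator τ (j : ZMod R)‖ ^ 2 := by
  rw [← Finset.sum_fiberwise_of_maps_to (t := Finset.range m)
    (g := fun n : ZMod R => n.valMinAbs.natAbs) (fun n hn => by simpa using hn), Finset.mul_sum]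
  refine Finset.sum_le_sum fun j _ => ?_
  have h1 : ∀ n ∈ (Finset.univ.filter fun n : ZMod R => n.valMinAbs.natAbs < m).filter
      (fun n => n.valMinAbs.natAbs = j), (n.valMinAbs.natAbs : ℝ) * ‖propagator τ n‖ ^ 2 =
      (j : ℝ) * ‖propagator τ (j : ZMod R)‖ ^ 2 := by
    intro n hn
    rw [propagator_natAbs, (Finset.mem_filter.1 hn).2]
  rw [Finset.sum_congr rfl h1, Finset.sum_const, nsmul_eq_mul]
  refine mul_le_mul_of_nonneg_right ?_ (by positivity)
  have h2 : (Finset.univ.filter fun n : ZMod R => n.valMinAbs.natAbs < m).filter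
      (fun n => n.valMinAbs.natAbs = j) ⊆ {(j : ZMod R), -(j : ZMod R)} := by
    intro n hn
    rw [Finset.mem_insert, Finset.mem_singleton, ← (Finset.mem_filter.1 hn).2]
    exact eq_natAbs_valMinAbs_or n
  exact_mod_cast (Finset.card_le_card h2).trans Finset.card_le_two

/-- Exactly j pairs of sites at distance j straddle the cut as long as j fits on both sides, so
double sums over the cut contain first moments. -/
theorem sum_mul_le_sum_block {N s m : ℕ} (hms : m ≤ s) (hmN : s + m ≤ N)
    (f : ZMod (2 * (N + 1)) → ℝ) (hf : ∀ n, 0 ≤ f n) (hfn : ∀ n, f (-n) = f n) :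
    ∑ j ∈ Finset.range m, (j : ℝ) * f j ≤
      ∑ x ∈ block N s, ∑ z ∈ (block N s)ᶜ, f (toCycle x - toCycle z) := by
  have h1 : ∑ j ∈ Finset.range m, (j : ℝ) * f j =
      ∑ p ∈ (Finset.range m).sigma fun j => Finset.range j, f (p.1 : ℕ) := by
    rw [Finset.sum_sigma]
    refine Finset.sum_congr rfl fun j _ => ?_
    simp
  rw [h1, ← Finset.sum_product']
  have hN : ∀ p ∈ (Finset.range m).sigma fun j => Finset.range j, p.2 < p.1 ∧ p.1 < m := by
    intro p hp
    simpa [and_comm] using hp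
  rcases Nat.eq_zero_or_pos N with h0 | h0
  · rw [show m = 0 by omega, Finset.sum_sigma, Finset.range_zero, Finset.sum_empty]
    exact Finset.sum_nonneg fun _ _ => hf _
  have : NeZero N := ⟨h0.ne'⟩
  -- The pair (j, i) with i < j goes to the site i steps inside the last site of the block and the
  -- site j to its right.
  set e : (Σ _ : ℕ, ℕ) → Fin N × Fin N := fun p =>
    (Fin.ofNat N (s - 1 - p.2), Fin.ofNat N (s - 1 - p.2 + p.1)) with he
  have hv : ∀ p ∈ (Finset.range m).sigma fun j => Finset.range j,
      ((e p).1 : ℕ) = s - 1 - p.2 ∧ ((e p).2 : ℕ) = s - 1 - p.2 + p.1 := by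
    intro p hp
    obtain ⟨h1, h2⟩ := hN p hp
    simp only [he, Fin.val_ofNat]
    exact ⟨Nat.mod_eq_of_lt (by omega), Nat.mod_eq_of_lt (by omega)⟩
  have hinj : Set.InjOn e ((Finset.range m).sigma fun j => Finset.range j) := by
    intro p hp p' hp' h
    obtain ⟨h1, h2⟩ := hN p hp
    obtain ⟨h3, h4⟩ := hN p' hp'
    obtain ⟨h5, h6⟩ := hv p hp
    obtain ⟨h7, h8⟩ := hv p' hp'
    rw [h] at h5 h6
    refine Sigma.ext ?_ (heq_of_eq ?_) <;> omega
  calc _ = ∑ q ∈ ((Finset.range m).sigma fun j => Finset.range j).image e,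
        f (toCycle q.1 - toCycle q.2) := by
        rw [Finset.sum_image hinj]
        refine Finset.sum_congr rfl fun p hp => ?_
        obtain ⟨h5, h6⟩ := hv p hp
        rw [← hfn (toCycle _ - _), toCycle, toCycle, h5, h6]
        congr 1
        push_cast
        ring
    _ ≤ _ := by
        refine Finset.sum_le_sum_of_subset_of_nonneg ?_ fun _ _ _ => hf _
        intro q hq
        obtain ⟨p, hp, rfl⟩ := Finset.mem_image.1 hq
        obtain ⟨h1, h2⟩ := hN p hp
        obtain ⟨h5, h6⟩ := hv p hp
        rw [Finset.mem_product, Finset.mem_compl, mem_block, mem_block, h5, h6]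
        omega

/-- A path to the mirror image must pass one of the chain ends, so it is at least as long as the
distance from the cut to that end. -/
theorem le_natAbs_valMinAbs_toCycle_add {N s m : ℕ} (hms : m ≤ s) (hmN : s + m ≤ N)
    {x z : Fin N} (hx : x.val < s) (hz : s ≤ z.val) :
    m ≤ (toCycle x + toCycle z).valMinAbs.natAbs := by
  rw [ZMod.valMinAbs_natAbs_eq_min, toCycle, toCycle, ← Nat.cast_add, ZMod.val_natCast,
    Nat.mod_eq_of_lt (by omega)]
  omega

theorem toCycle_injective {N : ℕ} : Function.Injective (toCycle (N := N)) := fun x y h =>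
  (toCycle_sub_eq_zero_iff x y).1 (sub_eq_zero.2 h)

/-- With one site fixed the images of the others are distinct, so the inner sum is at most the tail.
Fixing the sites on the smaller side yields the factor `m`. -/
theorem sum_block_add_le {N s m : ℕ} (hm : m = min s (N - s)) (hs : s ≤ N)
    (f : ZMod (2 * (N + 1)) → ℝ) (hf : ∀ n, 0 ≤ f n) :
    ∑ x ∈ block N s, ∑ z ∈ (block N s)ᶜ, f (toCycle x + toCycle z) ≤
      m * ∑ n : ZMod (2 * (N + 1)) with m ≤ n.valMinAbs.natAbs, f n := by
  have hx : ∀ x ∈ block N s, ∑ z ∈ (block N s)ᶜ, f (toCycle x + toCycle z) ≤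
      ∑ n : ZMod (2 * (N + 1)) with m ≤ n.valMinAbs.natAbs, f n := by
    intro x hx
    have hinj : Set.InjOn (fun z => toCycle x + toCycle z) ((block N s)ᶜ : Finset (Fin N)) :=
      fun z _ z' _ h => toCycle_injective (add_left_cancel h)
    rw [← Finset.sum_image (f := f) hinj]
    refine Finset.sum_le_sum_of_subset_of_nonneg ?_ fun _ _ _ => hf _
    intro n hn
    obtain ⟨z, hz, rfl⟩ := Finset.mem_image.1 hn
    rw [Finset.mem_compl, mem_block, not_lt] at hz
    exact Finset.mem_filter.2 ⟨Finset.mem_univ _, le_natAbs_valMinAbs_toCycle_add (s := s)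
      (by omega) (by omega) (mem_block.1 hx) hz⟩
  have hz : ∀ z ∈ (block N s)ᶜ, ∑ x ∈ block N s, f (toCycle x + toCycle z) ≤
      ∑ n : ZMod (2 * (N + 1)) with m ≤ n.valMinAbs.natAbs, f n := by
    intro z hz
    rw [Finset.mem_compl, mem_block, not_lt] at hz
    have hinj : Set.InjOn (fun x => toCycle x + toCycle z) (block N s) :=
      fun x _ x' _ h => toCycle_injective (add_right_cancel h)
    rw [← Finset.sum_image (f := f) hinj]
    refine Finset.sum_le_sum_of_subset_of_nonneg ?_ fun _ _ _ => hf _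
    intro n hn
    obtain ⟨x, hx, rfl⟩ := Finset.mem_image.1 hn
    exact Finset.mem_filter.2 ⟨Finset.mem_univ _, le_natAbs_valMinAbs_toCycle_add (s := s)
      (by omega) (by omega) (mem_block.1 hx) hz⟩
  have hc : (block N s).card = s := by
    have e : block N s = (Finset.range s).attachFin (fun i hi => by
        have := Finset.mem_range.1 hi; omega) := by
      ext x; simp [mem_block]
    rw [e, Finset.card_attachFin, Finset.card_range]
  rcases le_total s (N - s) with h | h
  · rw [hm, min_eq_left h] at *
    refine (Finset.sum_le_sum hx).trans_eq ?_
    rw [Finset.sum_const, hc, nsmul_eq_mul]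
  · rw [hm, min_eq_right h] at *
    rw [Finset.sum_comm]
    refine (Finset.sum_le_sum hz).trans_eq ?_
    rw [Finset.sum_const, Finset.card_compl, hc, Fintype.card_fin, nsmul_eq_mul]

/-- The weight transported by hopping across the boundary of a block grows linearly in time. -/
theorem le_sum_norm_sq_exp_adjMatrix_pathGraph {N s : ℕ} (hs : s ≤ N)
    [DecidableRel (SimpleGraph.pathGraph N).Adj] {τ : ℝ} (hτ : 1 / 2 ≤ τ)
    (hm : 1000 * τ ≤ (min s (N - s) : ℕ)) :
    τ / 200 ≤ ∑ x ∈ block N s, ∑ z ∈ (block N s)ᶜ,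
      ‖NormedSpace.exp ((τ : ℂ) • (Complex.I • (SimpleGraph.pathGraph N).adjMatrix ℂ)) x z‖ ^ 2 := by
  obtain ⟨m, hmdef⟩ : ∃ m, m = min s (N - s) := ⟨_, rfl⟩
  rw [← hmdef] at hm
  have hm0 : (0 : ℝ) < m := by linarith
  have hmN : 0 < m := by exact_mod_cast hm0
  have h1 := le_sum_natAbs_mul_norm_sq_propagator (R := 2 * (N + 1)) hτ hm (by omega)
  have h2 := sum_natAbs_mul_norm_sq_propagator_le (R := 2 * (N + 1)) τ m
  have h3 := sum_mul_le_sum_block (N := N) (s := s) (m := m) (by omega) (by omega)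
    (fun n => ‖propagator τ n‖ ^ 2) (fun n => sq_nonneg _) (fun n => by rw [propagator_neg])
  have h4 := sum_block_add_le hmdef hs (fun n => ‖propagator τ n‖ ^ 2) (fun n => sq_nonneg _)
  have h5 := mul_le_mul_of_nonneg_left
    (sum_norm_sq_propagator_tail_le (R := 2 * (N + 1)) (by omega) τ hmN) hm0.le
  -- The images cost at most 5τ² / m ≤ τ / 200, while half the direct weight is at least τ / 40.
  have h6 : (m : ℝ) * (5 * τ ^ 2 / m ^ 2) ≤ τ / 200 := by
    rw [mul_div_assoc', div_le_iff₀ (by positivity)]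
    nlinarith [mul_le_mul_of_nonneg_left hm (mul_nonneg hm0.le (by linarith : (0 : ℝ) ≤ τ))]
  -- From |u|² ≤ 2 |u - v|² + 2 |v|².
  have key : ∀ x z : Fin N, ‖propagator τ (toCycle x - toCycle z)‖ ^ 2 / 2 -
      ‖propagator τ (toCycle x + toCycle z)‖ ^ 2 ≤
      ‖NormedSpace.exp ((τ : ℂ) • (Complex.I • (SimpleGraph.pathGraph N).adjMatrix ℂ)) x z‖
        ^ 2 := by
    intro x z
    rw [exp_adjMatrix_pathGraph_apply]
    generalize propagator τ (toCycle x - toCycle z) = u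
    generalize propagator τ (toCycle x + toCycle z) = v
    have h := norm_add_le (u - v) v
    rw [sub_add_cancel] at h
    nlinarith [norm_nonneg u, norm_nonneg v, norm_nonneg (u - v), sq_nonneg (‖u - v‖ - ‖v‖)]
  have h7 := Finset.sum_le_sum fun x (_ : x ∈ block N s) =>
    Finset.sum_le_sum fun z (_ : z ∈ (block N s)ᶜ) => key x z
  simp only [Finset.sum_sub_distrib, ← Finset.sum_div] at h7
  linarith

end Block

/-! ### Entropy growth from the Néel state. -/

section NeelState

/-- The `k`-th even site of the open chain. -/
def evenSite (N : ℕ) (k : Fin ((N + 1) / 2)) : Fin N := ⟨2 * k.val, by omega⟩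

theorem evenSite_strictMono (N : ℕ) : StrictMono ((Fin.val : Fin N → ℕ) ∘ evenSite N) := by
  intro i j h
  have h' : i.val < j.val := h
  simp only [Function.comp, evenSite]
  omega

theorem evenSite_injective (N : ℕ) : Function.Injective (evenSite N) := fun _ _ h =>
  (evenSite_strictMono N).injective (congrArg Fin.val h)

/-- The staggered sign operator on one-particle states. -/
def stagger (N : ℕ) : Matrix (Fin N) (Fin N) ℂ := diagonal fun x => (-1 : ℂ) ^ x.val

theorem stagger_mul_self (N : ℕ) : stagger N * stagger N = 1 := by
  rw [stagger, diagonal_mul_diagonal, ← diagonal_one]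
  congr 1
  funext x
  rw [← mul_pow]
  simp

/-- The chain is bipartite: neighbours carry opposite staggered signs. Conjugation by `stagger`
therefore reverses time in the one-particle evolution. -/
theorem stagger_mul_adjMatrix_mul (N : ℕ) [DecidableRel (SimpleGraph.pathGraph N).Adj] :
    stagger N * (SimpleGraph.pathGraph N).adjMatrix ℂ * stagger N =
      -(SimpleGraph.pathGraph N).adjMatrix ℂ := by
  ext x z
  rw [stagger, mul_diagonal, diagonal_mul, neg_apply, SimpleGraph.adjMatrix_apply]
  split_ifs with h
  · rw [SimpleGraph.pathGraph_adj] at h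
    have h1 : (-1 : ℂ) ^ (x.val + z.val) = -1 := Odd.neg_one_pow (by
      rcases h with h | h <;> rw [← h]
      · exact ⟨x.val, by ring⟩
      · exact ⟨z.val, by ring⟩)
    rw [mul_one, ← pow_add, h1]
  · simp

theorem exp_neg_mul_stagger (N : ℕ) [DecidableRel (SimpleGraph.pathGraph N).Adj] (t : ℝ) :
    NormedSpace.exp (((-t : ℝ) : ℂ) • (Complex.I • (SimpleGraph.pathGraph N).adjMatrix ℂ)) *
      stagger N = stagger N *
    NormedSpace.exp ((t : ℂ) • (Complex.I • (SimpleGraph.pathGraph N).adjMatrix ℂ)) := by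
  set u : (Matrix (Fin N) (Fin N) ℂ)ˣ :=
    ⟨stagger N, stagger N, stagger_mul_self N, stagger_mul_self N⟩ with hu
  have h := Matrix.exp_units_conj u
    ((t : ℂ) • (Complex.I • (SimpleGraph.pathGraph N).adjMatrix ℂ))
  have e : (u : Matrix (Fin N) (Fin N) ℂ) = stagger N := rfl
  have e' : ((u⁻¹ : (Matrix (Fin N) (Fin N) ℂ)ˣ) : Matrix (Fin N) (Fin N) ℂ) = stagger N := rfl
  rw [e, e'] at h
  have e2 : stagger N * ((t : ℂ) • (Complex.I • (SimpleGraph.pathGraph N).adjMatrix ℂ)) *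
      stagger N = ((-t : ℝ) : ℂ) • (Complex.I • (SimpleGraph.pathGraph N).adjMatrix ℂ) := by
    rw [Matrix.mul_smul, Matrix.mul_smul, Matrix.smul_mul, Matrix.smul_mul,
      stagger_mul_adjMatrix_mul]
    simp
  rw [e2] at h
  rw [h, Matrix.mul_assoc, stagger_mul_self, Matrix.mul_one]

theorem exp_I_smul_conjTranspose {n : Type*} [Fintype n] [DecidableEq n] {h : Matrix n n ℂ}
    (hh : h.IsHermitian) (t : ℝ) :
    (NormedSpace.exp (((-t : ℝ) : ℂ) • (Complex.I • h)))ᴴ =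
      NormedSpace.exp ((t : ℂ) • (Complex.I • h)) := by
  rw [← Matrix.exp_conjTranspose, conjTranspose_smul, conjTranspose_smul, hh.eq]
  simp

theorem sum_evenSite (N : ℕ) (f : Fin N → ℂ) :
    ∑ k, f (evenSite N k) = ∑ w, (1 + (-1 : ℂ) ^ w.val) / 2 * f w := by
  rw [← Finset.sum_image (f := f) (evenSite_injective N).injOn]
  refine Finset.sum_subset_zero_on_sdiff (Finset.subset_univ _) (fun w hw => ?_) fun w hw => ?_
  · have h : Odd w.val := by
      by_contra hc
      obtain ⟨k, hk⟩ := Nat.not_odd_iff_even.1 hc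
      refine (Finset.mem_sdiff.1 hw).2 (Finset.mem_image.2 ⟨⟨k, by omega⟩, Finset.mem_univ _, ?_⟩)
      exact Fin.ext (by simp only [evenSite]; omega)
    rw [h.neg_one_pow]
    simp
  · obtain ⟨k, -, rfl⟩ := Finset.mem_image.1 hw
    simp [evenSite]

/-- The Néel state: even sites occupied, odd sites empty. -/
noncomputable def neelState (N : ℕ) : (Fin N → Fin 2) → ℂ :=
  slater Fin.val_injective ((N + 1) / 2) fun k => Pi.single (evenSite N k) 1

theorem isProductState_neelState (N : ℕ) : IsProductState (d := fun _ => 2) (neelState N) := by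
  rw [neelState, slater_single_eq _ _ (evenSite_strictMono N)]
  exact isProductState_single _

/-- The XX chain, written as free fermion hopping. -/
noncomputable def hoppingHamiltonian (N : ℕ) [DecidableRel (SimpleGraph.pathGraph N).Adj] :
    Matrix (Fin N → Fin 2) (Fin N → Fin 2) ℂ :=
  secondQuantize Fin.val ((SimpleGraph.pathGraph N).adjMatrix ℂ)

theorem isLocalHamiltonian_hoppingHamiltonian (N : ℕ)
    [DecidableRel (SimpleGraph.pathGraph N).Adj] :
    IsLocalHamiltonian (d := fun _ => 2) (SimpleGraph.pathGraph N) 1 4 (hoppingHamiltonian N) :=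
  isLocalHamiltonian_secondQuantize_adjMatrix Fin.val_injective _ fun i j h => by
    rw [SimpleGraph.pathGraph_adj] at h
    omega

/-- The projection onto even sites is (1 + `stagger`) / 2, so the evolved correlation matrix is (1 +
`stagger` E(2t)) / 2. The condition on the block is the one for hopping at time τ = 2t, and the rate
1/400 is (1/4)(2/200). -/
theorem le_entanglementEntropy_evolve_neelState {N s : ℕ} (hs : s ≤ N)
    [DecidableRel (SimpleGraph.pathGraph N).Adj] {t : ℝ} (ht : 1 ≤ t)
    (hm : 2000 * t ≤ (min s (N - s) : ℕ)) :
    t / 400 ≤ entanglementEntropy (d := fun _ => 2) (block N s)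
      (evolve (hoppingHamiltonian N) t (neelState N)) := by
  set h := (SimpleGraph.pathGraph N).adjMatrix ℂ with hh
  have hherm : h.IsHermitian := by
    ext x z
    simp [hh, SimpleGraph.adjMatrix_apply, SimpleGraph.adj_comm, apply_ite (star : ℂ → ℂ)]
  set E : ℝ → Matrix (Fin N) (Fin N) ℂ := fun τ =>
    NormedSpace.exp ((τ : ℂ) • (Complex.I • h)) with hE
  have hinv : ∀ τ, E τ * E (-τ) = 1 := fun τ => by
    have := exp_neg_mul_exp (Complex.I • h) (-τ)
    rwa [neg_neg] at this
  have hadj : (E (-t))ᴴ = E t := exp_I_smul_conjTranspose hherm t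
  set V : Matrix (Fin N) (Fin ((N + 1) / 2)) ℂ := (E (-t)).submatrix id (evenSite N) with hVdef
  have hev : evolve (d := fun _ => 2) (hoppingHamiltonian N) t (neelState N) =
      slater Fin.val_injective ((N + 1) / 2) (fun k x => V x k) := by
    rw [evolve_eq, hoppingHamiltonian, neelState, exp_secondQuantize_mulVec_slater]
    congr 1
    funext k x
    rw [mulVec_single_one]
    rfl
  have hV : Vᴴ * V = 1 := by
    rw [hVdef, conjTranspose_submatrix, hadj,
      ← submatrix_mul _ _ (evenSite N) id (evenSite N) Function.bijective_id, hinv,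
      submatrix_one _ (evenSite_injective N)]
  have hn : ∑ σ, ‖slater (r := Fin.val) Fin.val_injective ((N + 1) / 2)
      (fun k x => V x k) σ‖ ^ 2 = 1 := by
    rw [← hev, sum_norm_sq_evolve (isLocalHamiltonian_hoppingHamiltonian N).isHermitian,
      (isProductState_neelState N).sum_norm_sq]
  have hmain := sum_norm_sq_le_entanglementEntropy_slater (r := (Fin.val : Fin N → ℕ))
    Fin.val_injective (I := block N s) (fun i hi j hj => by
      rw [mem_block] at hi hj
      omega) V hV hn
  rw [hev]
  refine le_trans ?_ hmain
  have hmul : E t * E t = E (2 * t) := by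
    simp only [hE]
    rw [← Matrix.exp_add_of_commute _ _ (Commute.refl _), ← add_smul]
    congr 2
    push_cast
    ring
  have hst : E (-t) * stagger N * E t = stagger N * E (2 * t) := by
    rw [show E (-t) * stagger N = stagger N * E t from exp_neg_mul_stagger N t,
      Matrix.mul_assoc, hmul]
  have hVV : ∀ x z : Fin N, x ≠ z → ‖(V * Vᴴ) x z‖ ^ 2 = ‖E (2 * t) x z‖ ^ 2 / 4 := by
    intro x z hxz
    have h1 : (V * Vᴴ) x z = ∑ k, E (-t) x (evenSite N k) * E t (evenSite N k) z := by
      rw [hVdef, conjTranspose_submatrix, hadj]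
      rfl
    -- The identity part of the projection evolves to the identity and vanishes off the diagonal,
    -- the only place where the cut looks.
    have h2 : ∑ w, E (-t) x w * E t w z = 0 := by
      have := hinv (-t)
      rw [neg_neg] at this
      rw [← Matrix.mul_apply, this, one_apply_ne hxz]
    have h3 : ∑ w : Fin N, E (-t) x w * (-1 : ℂ) ^ w.val * E t w z =
        (-1 : ℂ) ^ x.val * E (2 * t) x z := by
      have := congrFun (congrFun hst x) z
      rw [stagger, diagonal_mul, Matrix.mul_apply] at this
      simpa only [mul_diagonal] using this
    have h4 : (V * Vᴴ) x z = (-1 : ℂ) ^ x.val * E (2 * t) x z / 2 := by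
      rw [h1, sum_evenSite N fun w => E (-t) x w * E t w z, ← h3, ← add_zero (_ / 2),
        ← zero_div (2 : ℂ), ← h2, Finset.sum_div, Finset.sum_div, ← Finset.sum_add_distrib]
      refine Finset.sum_congr rfl fun w _ => ?_
      ring
    rw [h4, norm_div, norm_mul, norm_pow, norm_neg, norm_one, one_pow, one_mul, div_pow]
    norm_num
  have hkin := le_sum_norm_sq_exp_adjMatrix_pathGraph hs (τ := 2 * t) (by linarith) (by linarith)
  have hsum : ∑ x ∈ block N s, ∑ z ∈ (block N s)ᶜ, ‖(V * Vᴴ) x z‖ ^ 2 =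
      (∑ x ∈ block N s, ∑ z ∈ (block N s)ᶜ, ‖E (2 * t) x z‖ ^ 2) / 4 := by
    rw [Finset.sum_div]
    refine Finset.sum_congr rfl fun x hx => ?_
    rw [Finset.sum_div]
    refine Finset.sum_congr rfl fun z hz => hVV x z ?_
    rintro rfl
    exact Finset.mem_compl.1 hz hx
  rw [hsum]
  linarith

end NeelState
end SpinLattice

/-! ### Assembly of the theorem. -/

open SpinLattice in
theorem mainTheorem9 :
    -- general lattices of bounded degree, local dimensions at most `q`
    (∀ (Δ q r : ℕ) (J t : ℝ), 0 < t → ∃ c₀ c₁ : ℝ, 0 < c₀ ∧ 0 < c₁ ∧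
      ∀ (L : Type) [Fintype L] [DecidableEq L] (G : SimpleGraph L) [DecidableRel G.Adj],
        (∀ v, G.degree v ≤ Δ) →
      ∀ (d : L → ℕ), (∀ j, d j ≤ q) →
      ∀ (H : Matrix (Config d) (Config d) ℂ) (ψ : Config d → ℂ),
        IsLocalHamiltonian G r J H → IsProductState ψ →
      ∀ I : Finset L,
        entanglementEntropy I (evolve H t ψ) ≤ c₀ * (boundaryArea G I : ℝ) + c₁) ∧
    -- cubic lattices of dimension `D`
    (∀ (D q r : ℕ) (J t : ℝ), 0 < t → ∃ c₀ c₁ : ℝ, 0 < c₀ ∧ 0 < c₁ ∧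
      ∀ (n : ℕ) [NeZero n] (d : (Fin D → ZMod n) → ℕ), (∀ j, d j ≤ q) →
      ∀ (H : Matrix (Config d) (Config d) ℂ) (ψ : Config d → ℂ),
        IsLocalHamiltonian (cubicLattice D n) r J H → IsProductState ψ →
      ∀ I : Finset (Fin D → ZMod n),
        entanglementEntropy I (evolve H t ψ) ≤
          c₀ * (boundaryArea (cubicLattice D n) I : ℝ) + c₁) ∧
    -- linear growth in open spin chains with nearest-neighbour interactions
    (∃ (q : ℕ) (J : ℝ)
      (H : ∀ N : ℕ, Matrix (Config (fun _ : Fin N => q)) (Config (fun _ : Fin N => q)) ℂ)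
      (ψ : ∀ N : ℕ, Config (fun _ : Fin N => q) → ℂ),
      (∀ N, IsLocalHamiltonian (SimpleGraph.pathGraph N) 1 J (H N)) ∧
      (∀ N, IsProductState (ψ N)) ∧
      ∃ (c₂ c₃ c₄ t₀ : ℝ) (L₀ s₀ : ℕ),
        0 < c₂ ∧ 0 < c₃ ∧ 0 < c₄ ∧ 0 < t₀ ∧ 0 < L₀ ∧ 0 < s₀ ∧
        ∀ (N s : ℕ), L₀ ≤ N → s₀ ≤ s → s ≤ N →
        ∀ t : ℝ, t₀ ≤ t → t ≤ c₄ * min (s : ℝ) ((N : ℝ) - (s : ℝ)) →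
          c₂ * t + c₃ ≤ entanglementEntropy (block N s) (evolve (H N) t (ψ N))) := by

  classical
  -- Since t ≥ 1, the bound t / 400 may be split as t / 800 + 1 / 800, which produces a positive
  -- additive constant.
  refine ⟨entanglementEntropy_evolve_le_boundaryArea, fun D q r J t ht => ?_, 2, 4,
    fun N => hoppingHamiltonian N, neelState, fun N => isLocalHamiltonian_hoppingHamiltonian N,
    isProductState_neelState, 1 / 800, 1 / 800, 1 / 2000, 1, 1, 1, by norm_num, by norm_num,
    by norm_num, one_pos, one_pos, one_pos, fun N s _ _ hs t ht htm => ?_⟩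
  · obtain ⟨c₀, c₁, h₀, h₁, h⟩ := entanglementEntropy_evolve_le_boundaryArea (2 * D) q r J t ht
    exact ⟨c₀, c₁, h₀, h₁, fun n _ d hd H ψ hH hψ I =>
      h _ (cubicLattice D n) (degree_cubicLattice_le D n) d hd H ψ hH hψ I⟩
  · have hm : 2000 * t ≤ (min s (N - s) : ℕ) := by
      rw [Nat.cast_min, Nat.cast_sub hs]
      linarith
    have h := le_entanglementEntropy_evolve_neelState hs ht hm
    exact le_trans (by linarith) h
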